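/- Let $Q$ be a smooth manifold, $(N,\Psi)$ a Poisson manifold with bracket $\{f,h\}_N=\Psi(\mathrm{d}f,\mathrm{d}h)$, and $G$ a compact connected Lie group with Lie algebra $\mathfrak g$ and normalized Haar measure $\mathrm{d}g$. (Manifolds are finite-dimensional, Hausdorff, second countable and without boundary; sums over repeated indices are understood.) Let $\Phi_g(q,y)=(q,\Phi_g^q(y))$ be a smooth left action of $G$ on $Q\times N$ along the fibers of $Q\times N\to Q$, and let $\mathbb J:Q\times N\to\mathfrak g^*$ be a smooth fiberwise momentum map: for all $a\in\mathfrak g$, with $\mathbb J_a=\langle\mathbb J,a\rangle$, $$\frac{\mathrm d}{\mathrm dt}\Big|_{t=0}\Phi^q_{\exp(ta)}(y)=\Psi\big(\mathrm d_y\mathbb J_a(q,\cdot),\,\cdot\,\big)=-\Psi^{\alpha\beta}\frac{\partial\mathbb J_a}{\partial y^\beta}(q,y)\,\frac{\partial}{\partial y^\alpha}.$$ Let $g\mapsto a(g)\in\mathfrak g$ be a measurable map with relatively compact range (up to null sets) such that $\exp a(g)=g$ for almost every $g\in G$, and let $C=C_i(q,y)\,\mathrm dq^i$ be a smooth form on $Q\times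 N$ such that all $C_i(q,\cdot)$ are Casimir functions of $\Psi$. Put $\mathcal A=\mathcal A_i\,\mathrm dq^i$, $$\mathcal A_i(q,y)=-\int_G\Big(\int_0^1\frac{\partial\mathbb J_{a(g)}}{\partial q^i}\big(q,\Phi^q_{\exp(t\,a(g))}(y)\big)\,\mathrm dt\Big)\mathrm dg+C_i(q,y),$$ $$\mathcal F_{ij}=\frac{\partial\mathcal A_j}{\partial q^i}-\frac{\partial\mathcal A_i}{\partial q^j}+\{\mathcal A_i,\mathcal A_j\}_N,\qquad \mathrm{hor}_i=\frac{\partial}{\partial q^i}+\Psi^{\alpha\beta}\frac{\partial\mathcal A_i}{\partial y^\alpha}\frac{\partial}{\partial y^\beta},$$ and let $$\Pi_{\mathcal A}=\tfrac12\Psi^{\alpha\beta}\frac{\partial}{\partial y^\alpha}\wedge\frac{\partial}{\partial y^\beta}+\frac{\partial}{\partial p_i}\wedge\mathrm{hor}_i+\tfrac12\mathcal F_{ij}\frac{\partial}{\partial p_i}\wedge\frac{\partial}{\partial p_j}$$ be the associated gauge Poisson tensor on $E=T^*Q\times N$, with bracket $\{\cdot,\cdot\}_{\mathcal A}$; the Hamiltonian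 system of $\mathcal H$ is $\dot x=\{\mathcal H,x\}_{\mathcal A}$. Let $\overline\Phi_g(p,q,y)=(p,q,\Phi_g^q(y))$ be the lifted action on $E$ and $\overline\tau(p,q,y)=(q,y)$. Then $\mathcal A$ is smooth, and: 1. $\overline\Phi{}_g^*\Pi_{\mathcal A}=\Pi_{\mathcal A}$ for all $g\in G$. 2. For every smooth $G$-invariant $\mathcal H$ on $E$, the Hamiltonian vector field of $\mathcal H$ with respect to $\Pi_{\mathcal A}$ is $G$-invariant. In particular this holds for $\mathcal H=\frac12 g^{ij}(q)p_ip_j$, for any pseudo-Riemannian metric on $Q$; such an $\mathcal H$ is $G$-invariant. 3. Suppose moreover that $\int_G\frac{\partial\mathbb J_a}{\partial q^j}\big(q,\Phi_g^q(y)\big)\,\mathrm dg=0$ for all $a\in\mathfrak g$, all $j$ and all $(q,y)$. Then (a) the lifted action preserves $\Pi_{\mathcal A}$ and is Hamiltonian with respect to $\Pi_{\mathcal A}$ with momentum map $\mathbb J\circ\overline\tau$: its infinitesimal generator for $a\in\mathfrak g$ is $\Pi_{\mathcal A}\big(\mathrm d(\mathbb J_a\circ\overline\tau),\,\cdot\,\big)$;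 (b) for every smooth $G$-invariant $\mathcal H$ and every $a\in\mathfrak g$, $\{\mathcal H,\mathbb J_a\circ\overline\tau\}_{\mathcal A}=0$, and $\mathbb J_a\circ\overline\tau$ is constant along the trajectories of the Hamiltonian system of $\mathcal H$. -/

import Mathlib

open scoped Manifold ContDiff
open MeasureTheory Bundle

noncomputable section

/-! ### Bivector fields and Poisson tensors -/

section Poisson

variable {E : Type*} [NormedAddCommGroup E] [NormedSpace ℝ E]
  {H : Type*} [TopologicalSpace H] (I : ModelWithCorners ℝ E H)
  (M : Type*) [TopologicalSpace M] [ChartedSpace H M]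

/-- A contravariant 2-tensor field `P` on `M`, given through its contraction
`α ↦ P(α, ·)`, a linear map from covectors to vectors at every point. -/
abbrev TwoTensorField : Type _ :=
  ∀ x : M, (TangentSpace I x →L[ℝ] ℝ) →ₗ[ℝ] TangentSpace I x

variable {I M}

/-- The contraction `α ↦ (u ∧ v)(α, ·) = α(u) v - α(v) u` of the bivector `u ∧ v`. -/
def wedge {V : Type*} [TopologicalSpace V] [AddCommGroup V] [Module ℝ V] (u v : V) :
    (V →L[ℝ] ℝ) →ₗ[ℝ] V where
  toFun α := α u • v - α v • u
  map_add' α β := by simp only [_root_.add_apply, add_smul]; abel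
  map_smul' c α := by
    simp only [_root_.smul_apply, smul_eq_mul, mul_smul, smul_sub, RingHom.id_apply]

/-- The bivector `∑ u_i ∧ v_i + ½ ∑ F_ij u_i ∧ u_j`. -/
def couplingTensor {m : ℕ} {V : Type*} [TopologicalSpace V] [AddCommGroup V] [Module ℝ V]
    (u v : Fin m → V) (F : Fin m → Fin m → ℝ) : (V →L[ℝ] ℝ) →ₗ[ℝ] V :=
  ∑ i, wedge (u i) (v i) + (1 / 2 : ℝ) • ∑ i, ∑ j, F i j • wedge (u i) (u j)

/-- The image of a contravariant 2-tensor under a linear map `ι`. -/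
def pushTensor {V W : Type*} [TopologicalSpace V] [AddCommGroup V] [Module ℝ V]
    [TopologicalSpace W] [AddCommGroup W] [Module ℝ W] (ι : V →L[ℝ] W)
    (T : (V →L[ℝ] ℝ) →ₗ[ℝ] V) : (W →L[ℝ] ℝ) →ₗ[ℝ] W where
  toFun α := ι (T (α.comp ι))
  map_add' α β := by simp only [ContinuousLinearMap.add_comp, map_add]
  map_smul' c α := by simp only [ContinuousLinearMap.smul_comp, map_smul, RingHom.id_apply]

/-- The bracket `{f, g} = P(df, dg)`. -/
def bracket (P : TwoTensorField I M) (f g : M → ℝ) (x : M) : ℝ :=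
  mvfderiv I g x (P x (mvfderiv I f x))

/-- The Hamiltonian vector field `P(dh, ·) = {h, ·}` of the function `h`. -/
def hamiltonianField (P : TwoTensorField I M) (h : M → ℝ) (x : M) : TangentSpace I x :=
  P x (mvfderiv I h x)

/-- Invariance of a contravariant 2-tensor field under a diffeomorphism `φ`:
`dφ` carries `P` at `x` to `P` at `φ x`. -/
def TensorInvariant (P : TwoTensorField I M) (φ : M → M) : Prop :=
  ∀ (x : M) (α : TangentSpace I (φ x) →L[ℝ] ℝ),
    mfderiv I I φ x (P x (α.comp (mfderiv I I φ x))) = P (φ x) α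

/-- Invariance of a vector field under a diffeomorphism `φ`. -/
def FieldInvariant (X : ∀ x : M, TangentSpace I x) (φ : M → M) : Prop :=
  ∀ x : M, mfderiv I I φ x (X x) = X (φ x)

variable (I M)

/-- A Poisson tensor on `M`: a smooth skew-symmetric contravariant 2-tensor field whose
bracket satisfies the Jacobi identity. -/
structure PoissonTensor where
  sharp : TwoTensorField I M
  skew : ∀ (x : M) (α β : TangentSpace I x →L[ℝ] ℝ), β (sharp x α) = -α (sharp x β)
  smooth : ∀ f g : M → ℝ, ContMDiff I 𝓘(ℝ, ℝ) ∞ f → ContMDiff I 𝓘(ℝ, ℝ) ∞ g →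
    ContMDiff I 𝓘(ℝ, ℝ) ∞ (bracket sharp f g)
  jacobi : ∀ f g h : M → ℝ, ContMDiff I 𝓘(ℝ, ℝ) ∞ f → ContMDiff I 𝓘(ℝ, ℝ) ∞ g →
    ContMDiff I 𝓘(ℝ, ℝ) ∞ h → ∀ x : M,
      bracket sharp f (bracket sharp g h) x + bracket sharp g (bracket sharp h f) x
        + bracket sharp h (bracket sharp f g) x = 0

end Poisson

/-! ### Lie groups: exponential map, infinitesimal generators, momentum maps -/

section LieGroupActions

variable {k : ℕ} {G : Type*} [TopologicalSpace G] [ChartedSpace (EuclideanSpace ℝ (Fin k)) G]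
  [Group G]
  {E : Type*} [NormedAddCommGroup E] [NormedSpace ℝ E]
  {H : Type*} [TopologicalSpace H] {I : ModelWithCorners ℝ E H}
  {M : Type*} [TopologicalSpace M] [ChartedSpace H M]

/-- The exponential map of a Lie group: the value at time 1 of the integral curve through `1`
of the left-invariant vector field determined by `a`. -/
def lieExp (a : GroupLieAlgebra (𝓡 k) G) : G :=
  open Classical in
  if h : ∃ γ : ℝ → G, γ 0 = 1 ∧ IsMIntegralCurve (I := 𝓡 k) γ (mulInvariantVectorField a)
  then h.choose 1 else 1

/-- The infinitesimal generator `d/dt (Φ_{exp(ta)} x)` at `t = 0` of a left action `Φ`. The curve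
passes through `Φ 1 x = x` at `t = 0`, so that its velocity is a tangent vector at `x`. -/
def infinitesimalGenerator (I : ModelWithCorners ℝ E H) (Φ : G → M → M)
    (a : GroupLieAlgebra (𝓡 k) G) (x : M) : TangentSpace I x :=
  (mfderiv 𝓘(ℝ, ℝ) I (fun t : ℝ => Φ (lieExp (t • a)) x) 0 (1 : ℝ) : E)

/-- `J` is a momentum map of the action `Φ` with respect to `P`: the generator of every `a` is the
Hamiltonian vector field of the smooth function `J_a = ⟨J, a⟩`. -/
def IsMomentumMap (P : TwoTensorField I M) (Φ : G → M → M)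
    (J : M → Module.Dual ℝ (GroupLieAlgebra (𝓡 k) G)) : Prop :=
  ∀ a : GroupLieAlgebra (𝓡 k) G,
    ContMDiff I 𝓘(ℝ, ℝ) ∞ (fun x => J x a) ∧
    ∀ x : M, infinitesimalGenerator I Φ a x = hamiltonianField P (fun x => J x a) x

/-- A measurable choice `g ↦ ℓ g` of logarithms on a compact Lie group, with values in a compact
part of the Lie algebra: `g = exp (ℓ g)` for almost every `g`. -/
structure IsLogarithm [MeasurableSpace G] (μ : Measure G)
    (ℓ : G → GroupLieAlgebra (𝓡 k) G) : Prop where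
  measurable : AEStronglyMeasurable ℓ μ
  bounded : ∃ K : Set (GroupLieAlgebra (𝓡 k) G), IsCompact K ∧ ∀ᵐ g ∂μ, ℓ g ∈ K
  exp_eq : ∀ᵐ g ∂μ, lieExp (ℓ g) = g

end LieGroupActions

/-! ### Fibered phase spaces -/

section Fibered

variable {k m n : ℕ}
  (G : Type*) [TopologicalSpace G] [ChartedSpace (EuclideanSpace ℝ (Fin k)) G] [Group G]
  (Q : Type*) [TopologicalSpace Q] [ChartedSpace (EuclideanSpace ℝ (Fin m)) Q]
  (N : Type*) [TopologicalSpace N] [ChartedSpace (EuclideanSpace ℝ (Fin n)) N]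

/-- A smooth left action of `G` on `Q × N` of the form `Φ_g (q, y) = (q, Φ_g^q y)`;
`act g q y` is `Φ_g^q y`. -/
structure FiberwiseAction where
  act : G → Q → N → N
  one_act : ∀ (q : Q) (y : N), act 1 q y = y
  mul_act : ∀ (g h : G) (q : Q) (y : N), act (g * h) q y = act g q (act h q y)
  smooth : ContMDiff ((𝓡 k).prod ((𝓡 m).prod (𝓡 n))) (𝓡 n) ∞
    (fun z : G × Q × N => act z.1 z.2.1 z.2.2)

variable {G Q N}

/-- A family of Hamiltonian actions: `J` is smooth on `Q × N`, and for every `q` it restricts to a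
momentum map of the action `Φ^q` on the Poisson manifold `N`. -/
def IsFiberwiseMomentumMap (Ψ : PoissonTensor (𝓡 n) N) (Φ : FiberwiseAction (k := k) (m := m)
    (n := n) G Q N) (J : Q × N → Module.Dual ℝ (GroupLieAlgebra (𝓡 k) G)) : Prop :=
  (∀ a, ContMDiff ((𝓡 m).prod (𝓡 n)) 𝓘(ℝ, ℝ) ∞ (fun x : Q × N => J x a)) ∧
  ∀ q : Q, IsMomentumMap Ψ.sharp (fun g y => Φ.act g q y) (fun y => J (q, y))

/-- The partial differential `∂f/∂q` at `(q, y)`, a covector at `q`; its type is written with the model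
space (which the tangent space at `q` is by definition), so that such covectors can be integrated. -/
def dQ (f : Q × N → ℝ) (x : Q × N) : EuclideanSpace ℝ (Fin m) →L[ℝ] ℝ :=
  mvfderiv (𝓡 m) (fun q : Q => f (q, x.2)) x.1

variable (Q N) in
/-- Forms `A = A_i(q, y) dq^i` on `Q × N`: a covector of `Q` at `q` for every `(q, y)`. -/
abbrev HorizontalForm : Type _ := ∀ x : Q × N, TangentSpace (𝓡 m) x.1 →L[ℝ] ℝ

/-- The form `-∫_G ∫_0^1 (∂J_a/∂q)(q, Φ_{exp(ta)}^q y) dt dg + C`, where `a = ℓ g`. -/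
def averagedForm [MeasurableSpace G] (μ : Measure G)
    (Φ : FiberwiseAction (k := k) (m := m) (n := n) G Q N)
    (J : Q × N → Module.Dual ℝ (GroupLieAlgebra (𝓡 k) G))
    (ℓ : G → GroupLieAlgebra (𝓡 k) G) (C : HorizontalForm (m := m) Q N) :
    HorizontalForm (m := m) Q N := fun x =>
  let c : EuclideanSpace ℝ (Fin m) →L[ℝ] ℝ := C x
  c - ∫ g, (∫ t in (0 : ℝ)..1,
    dQ (m := m) (fun z => J z (ℓ g)) (x.1, Φ.act (lieExp (t • ℓ g)) x.1 x.2)) ∂μ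

/-- The coordinate vector `∂/∂q^j` at `q'` of the chart of `Q` around `q₀`. -/
def coordVec (q₀ : Q) (j : Fin m) (q' : Q) : TangentSpace (𝓡 m) q' :=
  (mfderiv 𝓘(ℝ, EuclideanSpace ℝ (Fin m)) (𝓡 m) (extChartAt (𝓡 m) q₀).symm
    (extChartAt (𝓡 m) q₀ q') (EuclideanSpace.single j (1 : ℝ)) : EuclideanSpace ℝ (Fin m))

/-- The component `A_j(q, y) = A(∂/∂q^j)` in the chart of `Q` around `q₀`. -/
def coeff (A : HorizontalForm (m := m) Q N) (q₀ : Q) (j : Fin m) (x : Q × N) : ℝ :=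
  A x (coordVec q₀ j x.1)

/-- The partial derivative `∂f/∂q^i` at `(q₀, y)` in the chart of `Q` around `q₀`. -/
def partialQ (q₀ : Q) (i : Fin m) (f : Q × N → ℝ) (y : N) : ℝ :=
  dQ f (q₀, y) (coordVec q₀ i q₀)

/-- The differential `d_y A_i` at `(q, y)` of the `i`-th component of `A` along `N`. -/
def dCoeff (A : HorizontalForm (m := m) Q N) (i : Fin m) (q : Q) (y : N) :
    TangentSpace (𝓡 n) y →L[ℝ] ℝ :=
  mvfderiv (𝓡 n) (fun y' : N => coeff A q i (q, y')) y

/-- The components `F_ij = ∂A_j/∂q^i - ∂A_i/∂q^j + {A_i, A_j}_N` at `(q, y)`, in the chart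
of `Q` around `q`. -/
def curvature (Ψ : PoissonTensor (𝓡 n) N) (A : HorizontalForm (m := m) Q N) (i j : Fin m)
    (q : Q) (y : N) : ℝ :=
  partialQ q i (coeff A q j) y - partialQ q j (coeff A q i) y
    + dCoeff A j q y (Ψ.sharp y (dCoeff A i q y))

end Fibered

/-! ### The phase space `T*Q × N` -/

section PhaseSpace

variable {k m n : ℕ}
  (G : Type*) [TopologicalSpace G] [ChartedSpace (EuclideanSpace ℝ (Fin k)) G] [Group G]
  (Q : Type*) [TopologicalSpace Q] [ChartedSpace (EuclideanSpace ℝ (Fin m)) Q]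
  [IsManifold (𝓡 m) ∞ Q]
  (N : Type*) [TopologicalSpace N] [ChartedSpace (EuclideanSpace ℝ (Fin n)) N]

/-- The cotangent bundle `T*Q`; a point is a pair `⟨q, p⟩` with `p` a covector at `q`. -/
abbrev Cotangent : Type _ :=
  TotalSpace (EuclideanSpace ℝ (Fin m) →L[ℝ] ℝ) (fun q : Q => TangentSpace (𝓡 m) q →L[ℝ] ℝ)

/-- The model with corners of `T*Q`. -/
abbrev cotangentModel (m : ℕ) :=
  (𝓡 m).prod 𝓘(ℝ, EuclideanSpace ℝ (Fin m) →L[ℝ] ℝ)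

/-- The model with corners of `T*Q × N`. -/
abbrev phaseModel (m n : ℕ) := (cotangentModel m).prod (𝓡 n)

variable {G Q N}

/-- The projection `T*Q × N → Q × N`. -/
def tauBar (x : Cotangent (m := m) Q × N) : Q × N := (x.1.proj, x.2)

/-- The lifted action `(p, q, y) ↦ (p, q, Φ_g^q y)`. -/
def FiberwiseAction.lift (Φ : FiberwiseAction (k := k) (m := m) (n := n) G Q N) (g : G)
    (x : Cotangent (m := m) Q × N) : Cotangent (m := m) Q × N :=
  (x.1, Φ.act g x.1.proj x.2)

/-- The vector `∂/∂p_i` at a point `(p, q, y)`, in the coordinates `(q, p)` of `T*Q` induced by the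
chart of `Q` around `q`. The chart of `T*Q` at a point over `q` is this one, so that the tangent
space at the point is the space of coordinate vectors `((q̇, ṗ), ẏ)`. -/
def vecP (x : Cotangent (m := m) Q × N) (i : Fin m) : TangentSpace (phaseModel m n) x :=
  (((0, EuclideanSpace.proj i), 0) :
    (EuclideanSpace ℝ (Fin m) × (EuclideanSpace ℝ (Fin m) →L[ℝ] ℝ)) × EuclideanSpace ℝ (Fin n))

/-- The vector `hor_i = ∂/∂q^i + Ψ(d_y A_i, ·)` at a point `(p, q, y)`, in the same
coordinates. -/
def vecHor (Ψ : PoissonTensor (𝓡 n) N) (A : HorizontalForm (m := m) Q N)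
    (x : Cotangent (m := m) Q × N) (i : Fin m) : TangentSpace (phaseModel m n) x :=
  (((EuclideanSpace.single i (1 : ℝ), 0), Ψ.sharp x.2 (dCoeff A i x.1.proj x.2)) :
    (EuclideanSpace ℝ (Fin m) × (EuclideanSpace ℝ (Fin m) →L[ℝ] ℝ)) × EuclideanSpace ℝ (Fin n))

/-- The Poisson tensor of `N`, as a tensor on `T*Q × N`. -/
def verticalTensor (Ψ : PoissonTensor (𝓡 n) N) : TwoTensorField (phaseModel m n)
    (Cotangent (m := m) Q × N) := fun x =>
  pushTensor (ContinuousLinearMap.inr ℝ (TangentSpace (cotangentModel m) x.1)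
    (TangentSpace (𝓡 n) x.2)) (Ψ.sharp x.2)

/-- The gauge tensor `Ψ + ∑ ∂/∂p_i ∧ hor_i + ½ ∑ F_ij ∂/∂p_i ∧ ∂/∂p_j` on `T*Q × N`. -/
def gaugeTensor (Ψ : PoissonTensor (𝓡 n) N) (A : HorizontalForm (m := m) Q N) :
    TwoTensorField (phaseModel m n) (Cotangent (m := m) Q × N) := fun x =>
  verticalTensor Ψ x +
    couplingTensor (vecP x) (vecHor Ψ A x) (fun i j => curvature Ψ A i j x.1.proj x.2)

variable (m Q) in
/-- A smooth pseudo-Riemannian metric on `Q`. -/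
structure PseudoRiemannianMetric where
  inner : ∀ q : Q, TangentSpace (𝓡 m) q →L[ℝ] TangentSpace (𝓡 m) q →L[ℝ] ℝ
  symm : ∀ (q : Q) (u v : TangentSpace (𝓡 m) q), inner q u v = inner q v u
  nondegenerate : ∀ (q : Q) (u : TangentSpace (𝓡 m) q), (∀ v, inner q u v = 0) → u = 0
  smooth : ContMDiff (𝓡 m) ((𝓡 m).prod 𝓘(ℝ, EuclideanSpace ℝ (Fin m) →L[ℝ]
      EuclideanSpace ℝ (Fin m) →L[ℝ] ℝ)) ∞
    (fun q : Q => TotalSpace.mk' (EuclideanSpace ℝ (Fin m) →L[ℝ]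
      EuclideanSpace ℝ (Fin m) →L[ℝ] ℝ)
      (E := fun q : Q => TangentSpace (𝓡 m) q →L[ℝ] TangentSpace (𝓡 m) q →L[ℝ] ℝ) q (inner q))

/-- The Hamiltonian `½ g^{ij}(q) p_i p_j` on `T*Q × N`, where `(g^{ij})` is the inverse of the matrix
`g_ij = g(∂/∂q^i, ∂/∂q^j)`. -/
def kineticEnergy (γ : PseudoRiemannianMetric m Q) (x : Cotangent (m := m) Q × N) : ℝ :=
  let q := x.1.proj
  let e : Fin m → TangentSpace (𝓡 m) q := fun i => coordVec q i q
  let gm : Matrix (Fin m) (Fin m) ℝ := Matrix.of fun i j => γ.inner q (e i) (e j)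
  (1 / 2) * ∑ i, ∑ j, gm⁻¹ i j * x.1.2 (e i) * x.1.2 (e j)

end PhaseSpace

end

open scoped Manifold ContDiff Topology
open MeasureTheory Bundle

noncomputable section

section Charts

variable {E : Type*} [NormedAddCommGroup E] [NormedSpace ℝ E]
  {M : Type*} [TopologicalSpace M] [ChartedSpace E M]

/-- In the preferred coordinates at `x`, the inverse chart at `x` has the identity as differential. -/
theorem hasMFDerivAt_extChartAt_symm_center (x : M) :
    HasMFDerivAt 𝓘(ℝ, E) 𝓘(ℝ, E) (extChartAt 𝓘(ℝ, E) x).symm (extChartAt 𝓘(ℝ, E) x x)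
      (ContinuousLinearMap.id ℝ E) := by
  refine ⟨continuousAt_extChartAt_symm x, ?_⟩
  have h : writtenInExtChartAt 𝓘(ℝ, E) 𝓘(ℝ, E) (extChartAt 𝓘(ℝ, E) x x)
      (extChartAt 𝓘(ℝ, E) x).symm = extChartAt 𝓘(ℝ, E) x ∘ (extChartAt 𝓘(ℝ, E) x).symm := by
    rw [writtenInExtChartAt, extChartAt_to_inv]
    rfl
  rw [h]
  refine HasFDerivWithinAt.congr_of_eventuallyEq (hasFDerivWithinAt_id _ _) ?_ ?_
  · refine Filter.Eventually.filter_mono nhdsWithin_le_nhds ?_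
    filter_upwards [extChartAt_target_mem_nhds (I := 𝓘(ℝ, E)) x] with z hz
    exact (extChartAt 𝓘(ℝ, E) x).right_inv hz
  · simp [chartAt_self_eq]

/-- In the preferred coordinates at `x`, the chart at `x` has the identity as differential. -/
theorem hasMFDerivAt_extChartAt_center (x : M) :
    HasMFDerivAt 𝓘(ℝ, E) 𝓘(ℝ, E) (extChartAt 𝓘(ℝ, E) x) x (ContinuousLinearMap.id ℝ E) := by
  refine ⟨continuousAt_extChartAt x, ?_⟩
  refine HasFDerivWithinAt.congr_of_eventuallyEq (hasFDerivWithinAt_id _ _) ?_ ?_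
  · refine Filter.Eventually.filter_mono nhdsWithin_le_nhds ?_
    filter_upwards [extChartAt_target_mem_nhds (I := 𝓘(ℝ, E)) x] with z hz
    exact (extChartAt 𝓘(ℝ, E) x).right_inv hz
  · simp [chartAt_self_eq, writtenInExtChartAt]

end Charts

section LieExponential

variable {k : ℕ} {G : Type*} [TopologicalSpace G] [ChartedSpace (EuclideanSpace ℝ (Fin k)) G]
  [Group G] [LieGroup (𝓡 k) ∞ G]

/-- The differential at `ξ = φ 1` of the multiplication `(x, ξ) ↦ φ (φ⁻¹ x * φ⁻¹ ξ)` written in the chart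
`φ` at `1`. -/
def chartLeftTranslation (G : Type*) [TopologicalSpace G]
    [ChartedSpace (EuclideanSpace ℝ (Fin k)) G] [Group G] (x : EuclideanSpace ℝ (Fin k)) :
    EuclideanSpace ℝ (Fin k) →L[ℝ] EuclideanSpace ℝ (Fin k) :=
  fderiv ℝ (fun ξ => extChartAt (𝓡 k) (1 : G)
    ((extChartAt (𝓡 k) (1 : G)).symm x * (extChartAt (𝓡 k) (1 : G)).symm ξ))
    (extChartAt (𝓡 k) (1 : G) 1)

theorem contDiffAt_chartMul {x : EuclideanSpace ℝ (Fin k)}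
    (hx : x ∈ (extChartAt (𝓡 k) (1 : G)).target) :
    ContDiffAt ℝ ∞ (fun z : EuclideanSpace ℝ (Fin k) × EuclideanSpace ℝ (Fin k) =>
      extChartAt (𝓡 k) (1 : G)
        ((extChartAt (𝓡 k) (1 : G)).symm z.1 * (extChartAt (𝓡 k) (1 : G)).symm z.2))
      (x, extChartAt (𝓡 k) (1 : G) 1) := by
  have : IsManifold (𝓡 k) ∞ G := ContMDiffMul.toIsManifold
  have h1 : ∀ y ∈ (extChartAt (𝓡 k) (1 : G)).target,
      ContMDiffAt (𝓡 k) (𝓡 k) ∞ (extChartAt (𝓡 k) (1 : G)).symm y := fun y hy =>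
    (contMDiffOn_extChartAt_symm (n := ∞) (1 : G)).contMDiffAt
      ((isOpen_extChartAt_target (1 : G)).mem_nhds hy)
  have h2 : ContMDiffAt (𝓘(ℝ, EuclideanSpace ℝ (Fin k) × EuclideanSpace ℝ (Fin k))) (𝓡 k) ∞
      (fun z : EuclideanSpace ℝ (Fin k) × EuclideanSpace ℝ (Fin k) =>
        (extChartAt (𝓡 k) (1 : G)).symm z.1 * (extChartAt (𝓡 k) (1 : G)).symm z.2)
      (x, extChartAt (𝓡 k) (1 : G) 1) :=
    ContMDiffAt.mul
      (ContMDiffAt.comp (x, extChartAt (𝓡 k) (1 : G) 1) (h1 x hx) contDiff_fst.contMDiff.contMDiffAt)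
      (ContMDiffAt.comp (x, extChartAt (𝓡 k) (1 : G) 1) (h1 _ (mem_extChartAt_target _))
        contDiff_snd.contMDiff.contMDiffAt)
  rw [← contMDiffAt_iff_contDiffAt]
  refine ContMDiffAt.comp _ (I' := 𝓡 k) ?_ h2
  refine contMDiffAt_extChartAt' ?_
  rw [extChartAt_to_inv, mul_one]
  simpa using (extChartAt (𝓡 k) (1 : G)).map_target hx

theorem contDiffAt_chartLeftTranslation {x : EuclideanSpace ℝ (Fin k)}
    (hx : x ∈ (extChartAt (𝓡 k) (1 : G)).target) :
    ContDiffAt ℝ ∞ (chartLeftTranslation G) x := by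
  have h := contDiffAt_chartMul (G := G) hx
  exact ContDiffAt.fderiv (n := ∞) (m := ∞) (f := fun x ξ => extChartAt (𝓡 k) (1 : G)
    ((extChartAt (𝓡 k) (1 : G)).symm x * (extChartAt (𝓡 k) (1 : G)).symm ξ)) h
      contDiffAt_const (by simp)

/-- A solution in the chart at `1` of the left invariant differential equation yields an integral
curve. -/
theorem hasMFDerivAt_of_chart_solution {a : GroupLieAlgebra (𝓡 k) G}
    {β : ℝ → EuclideanSpace ℝ (Fin k)} {t : ℝ}
    (hβ : β t ∈ (extChartAt (𝓡 k) (1 : G)).target)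
    (hd : HasDerivAt β (chartLeftTranslation G (β t) a) t) :
    HasMFDerivAt 𝓘(ℝ, ℝ) (𝓡 k) (fun s => (extChartAt (𝓡 k) (1 : G)).symm (β s)) t
      ((1 : ℝ →L[ℝ] ℝ).smulRight
        (mulInvariantVectorField a ((extChartAt (𝓡 k) (1 : G)).symm (β t)))) := by
  have : IsManifold (𝓡 k) ∞ G := ContMDiffMul.toIsManifold
  have : IsTopologicalGroup G := topologicalGroup_of_lieGroup (𝓡 k) ∞
  set φ := extChartAt (𝓡 k) (1 : G) with hφ
  set x := β t with hx
  have hsymm : MDifferentiableAt 𝓘(ℝ, EuclideanSpace ℝ (Fin k)) (𝓡 k) φ.symm x :=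
    ((contMDiffOn_extChartAt_symm (n := ∞) (1 : G)).contMDiffAt
      ((isOpen_extChartAt_target (1 : G)).mem_nhds hβ)).mdifferentiableAt (by simp)
  have hx1 : φ (φ.symm x * φ.symm (φ 1)) = x := by
    rw [hφ, extChartAt_to_inv, mul_one]
    exact φ.right_inv hβ
  have hm : HasMFDerivAt 𝓘(ℝ, EuclideanSpace ℝ (Fin k)) 𝓘(ℝ, EuclideanSpace ℝ (Fin k))
      (fun ξ => φ (φ.symm x * φ.symm ξ)) (φ 1) (chartLeftTranslation G x) := by
    refine HasFDerivAt.hasMFDerivAt (DifferentiableAt.hasFDerivAt ?_)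
    have := (contDiffAt_chartMul (G := G) hβ).differentiableAt (by simp)
    exact DifferentiableAt.comp (φ 1) (f := fun ξ => (x, ξ)) this (by fun_prop)
  have hsymm' := hsymm.hasMFDerivAt
  have h1 : HasMFDerivAt 𝓘(ℝ, EuclideanSpace ℝ (Fin k)) (𝓡 k)
      (φ.symm ∘ fun ξ => φ (φ.symm x * φ.symm ξ)) (φ 1)
      ((mfderiv 𝓘(ℝ, EuclideanSpace ℝ (Fin k)) (𝓡 k) φ.symm x).comp
        (chartLeftTranslation G x)) := by
    refine HasMFDerivAt.comp (φ 1) ?_ hm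
    rw [hx1]
    exact hsymm'
  have hL : HasMFDerivAt (𝓡 k) (𝓡 k) (fun g : G => φ.symm x * g) (φ.symm (φ 1))
      (mfderiv (𝓡 k) (𝓡 k) (fun g : G => φ.symm x * g) (1 : G)) := by
    rw [hφ, extChartAt_to_inv]
    exact ((contMDiff_mul_left (I := 𝓡 k) (n := ∞)).contMDiffAt.mdifferentiableAt
      (by simp)).hasMFDerivAt
  have h2 := HasMFDerivAt.comp (φ 1) hL (hasMFDerivAt_extChartAt_symm_center (1 : G))
  have heq : (φ.symm ∘ fun ξ => φ (φ.symm x * φ.symm ξ)) =ᶠ[𝓝 (φ 1)]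
      ((fun g : G => φ.symm x * g) ∘ φ.symm) := by
    have hc : ContinuousAt (fun ξ => φ.symm x * φ.symm ξ) (φ 1) :=
      (continuousAt_const).mul (continuousAt_extChartAt_symm (I := 𝓡 k) (1 : G))
    have : φ.source ∈ 𝓝 (φ.symm x * φ.symm (φ 1)) := by
      refine (isOpen_extChartAt_source (1 : G)).mem_nhds ?_
      rw [hφ, extChartAt_to_inv, mul_one]
      exact φ.map_target hβ
    filter_upwards [hc this] with ξ hξ
    exact φ.left_inv hξ
  have h3 := hasMFDerivAt_unique (h2.congr_of_eventuallyEq heq) h1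
  have h4 : (mfderiv 𝓘(ℝ, EuclideanSpace ℝ (Fin k)) (𝓡 k) φ.symm x)
      (chartLeftTranslation G x a) = mulInvariantVectorField a (φ.symm x) := by
    have := congrArg (fun T : EuclideanSpace ℝ (Fin k) →L[ℝ] EuclideanSpace ℝ (Fin k) => T a) h3
    exact this.symm
  have hβ' : HasMFDerivAt 𝓘(ℝ, ℝ) 𝓘(ℝ, EuclideanSpace ℝ (Fin k)) β t
    ((1 : ℝ →L[ℝ] ℝ).smulRight (chartLeftTranslation G x a)) := hd.hasFDerivAt.hasMFDerivAt
  have h5 := HasMFDerivAt.comp t hsymm' hβ'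
  refine h5.congr_mfderiv ?_
  rw [← h4]
  ext
  exact (mfderiv 𝓘(ℝ, EuclideanSpace ℝ (Fin k)) (𝓡 k) φ.symm x).map_smul (1 : ℝ) _

/-- The local flow of left invariant vector fields near `1`, in the chart at `1`. -/
theorem exists_chart_flow (G : Type*) [TopologicalSpace G]
    [ChartedSpace (EuclideanSpace ℝ (Fin k)) G] [Group G] [LieGroup (𝓡 k) ∞ G] :
    ∃ r > 0, ∃ ε > 0, ∃ β : EuclideanSpace ℝ (Fin k) × ℝ → EuclideanSpace ℝ (Fin k),
      ContinuousOn β (Metric.ball 0 r ×ˢ Set.Ioo (-ε) ε) ∧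
      ∀ a ∈ Metric.ball (0 : EuclideanSpace ℝ (Fin k)) r, β (a, 0) = extChartAt (𝓡 k) (1 : G) 1 ∧
        ∀ t ∈ Set.Ioo (-ε) ε, β (a, t) ∈ (extChartAt (𝓡 k) (1 : G)).target ∧
          HasDerivAt (fun s => β (a, s)) (chartLeftTranslation G (β (a, t)) a) t := by
  set x₀ := extChartAt (𝓡 k) (1 : G) 1 with hx₀
  set V : EuclideanSpace ℝ (Fin k) × EuclideanSpace ℝ (Fin k) →
    EuclideanSpace ℝ (Fin k) × EuclideanSpace ℝ (Fin k) :=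
    fun z => (chartLeftTranslation G z.1 z.2, 0) with hV
  have hVs : ContDiffAt ℝ 1 V (x₀, 0) := by
    have h1 : ContDiffAt ℝ 1 (chartLeftTranslation G) x₀ :=
      (contDiffAt_chartLeftTranslation (mem_extChartAt_target (I := 𝓡 k) (1 : G))).of_le
        (by exact_mod_cast le_top)
    have h2 : ContDiffAt ℝ 1 (fun z : EuclideanSpace ℝ (Fin k) × EuclideanSpace ℝ (Fin k) =>
        chartLeftTranslation G z.1) (x₀, 0) :=
      ContDiffAt.comp (x₀, (0 : EuclideanSpace ℝ (Fin k))) h1 contDiffAt_fst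
    exact (h2.clm_apply contDiffAt_snd).prodMk contDiffAt_const
  obtain ⟨ε, hε, A, r, L', K, hr, hPL⟩ := IsPicardLindelof.of_contDiffAt_one hVs
  obtain ⟨α, hα, hαc⟩ :=
    (hPL 0).exists_forall_mem_closedBall_eq_hasDerivWithinAt_continuousOn
  simp only [zero_sub, zero_add] at hα hαc
  have hball : ∀ a ∈ Metric.ball (0 : EuclideanSpace ℝ (Fin k)) r,
      (x₀, a) ∈ Metric.closedBall (x₀, (0 : EuclideanSpace ℝ (Fin k))) r := by
    intro a ha
    rw [mem_closedBall_iff_norm]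
    simpa [Prod.norm_def] using (mem_ball_zero_iff.1 ha).le
  have hsnd : ∀ a ∈ Metric.ball (0 : EuclideanSpace ℝ (Fin k)) r, ∀ t ∈ Set.Ioo (-ε) ε,
      (α ((x₀, a), t)).2 = a := by
    intro a ha t ht
    have h0 := (hα _ (hball a ha)).1
    have hd : ∀ s ∈ Set.Icc (-ε) ε,
        HasDerivWithinAt (fun s => (α ((x₀, a), s)).2) 0 (Set.Icc (-ε) ε) s := by
      intro s hs
      exact (ContinuousLinearMap.snd ℝ (EuclideanSpace ℝ (Fin k))
        (EuclideanSpace ℝ (Fin k))).hasFDerivAt.comp_hasDerivWithinAt s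
        ((hα _ (hball a ha)).2 s hs)
    have hconst := (convex_Icc (-ε) ε).is_const_of_fderivWithin_eq_zero (𝕜 := ℝ)
      (f := fun s => (α ((x₀, a), s)).2)
      (fun s hs => (hd s hs).differentiableWithinAt) (fun s hs => by
        have h1 : UniqueDiffWithinAt ℝ (Set.Icc (-ε) ε) s :=
          uniqueDiffOn_Icc (by linarith) s hs
        have := (hd s hs).hasFDerivWithinAt.fderivWithin h1
        rw [this]
        ext
        simp)
      (Set.Ioo_subset_Icc_self ht) (⟨by linarith, hε.le⟩ : (0 : ℝ) ∈ Set.Icc (-ε) ε)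
    simpa [h0] using hconst
  have hcont : ContinuousOn (fun z : EuclideanSpace ℝ (Fin k) × ℝ => (α ((x₀, z.1), z.2)).1)
      (Metric.ball 0 r ×ˢ Set.Ioo (-ε) ε) := by
    refine continuous_fst.comp_continuousOn (hαc.comp (by fun_prop) ?_)
    rintro ⟨a, t⟩ ⟨ha, ht⟩
    exact ⟨hball a ha, Set.Ioo_subset_Icc_self ht⟩
  have hnhds : (Metric.ball (0 : EuclideanSpace ℝ (Fin k)) r ×ˢ Set.Ioo (-ε) ε) ∈
      𝓝 ((0 : EuclideanSpace ℝ (Fin k)), (0 : ℝ)) :=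
    prod_mem_nhds (Metric.ball_mem_nhds _ hr) (Ioo_mem_nhds (by linarith) hε)
  have hca := hcont.continuousAt hnhds
  have h00 : (α ((x₀, (0 : EuclideanSpace ℝ (Fin k))), 0)).1 = x₀ := by
    rw [(hα _ (hball 0 (Metric.mem_ball_self hr))).1]
  have htgt : (extChartAt (𝓡 k) (1 : G)).target ∈
      𝓝 (α ((x₀, (0 : EuclideanSpace ℝ (Fin k))), 0)).1 := by
    rw [h00]
    exact extChartAt_target_mem_nhds (I := 𝓡 k) (1 : G)
  have hev := Filter.inter_mem hnhds (hca htgt)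
  rw [nhds_prod_eq, Filter.mem_prod_iff] at hev
  obtain ⟨U, hU, T, hT, hUT⟩ := hev
  obtain ⟨r', hr', hU'⟩ := Metric.mem_nhds_iff.1 hU
  obtain ⟨ε', hε', hT'⟩ := Metric.mem_nhds_iff.1 hT
  rw [Real.ball_eq_Ioo, zero_sub, zero_add] at hT'
  have hsub := (Set.prod_mono hU' hT').trans hUT
  refine ⟨r', hr', ε', hε', fun z => (α ((x₀, z.1), z.2)).1,
    hcont.mono fun z hz => (hsub hz).1, fun a ha => ⟨?_, fun t ht => ?_⟩⟩
  · have := (hsub (Set.mk_mem_prod (b := (0 : ℝ)) ha ⟨by linarith, hε'⟩)).1.1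
    simp [(hα _ (hball a this)).1]
  · obtain ⟨⟨ha', ht'⟩, h2⟩ := hsub (Set.mk_mem_prod ha ht)
    refine ⟨h2, ?_⟩
    have hd := ((hα _ (hball a ha')).2 t (Set.Ioo_subset_Icc_self ht')).hasDerivAt
      (Icc_mem_nhds ht'.1 ht'.2)
    have hd' := (ContinuousLinearMap.fst ℝ (EuclideanSpace ℝ (Fin k))
        (EuclideanSpace ℝ (Fin k))).hasFDerivAt.comp_hasDerivAt t hd
    simp only [hV, hsnd a ha' t ht'] at hd'
    exact hd'

end LieExponential

section LieExponential

variable {k : ℕ} {G : Type*} [TopologicalSpace G] [ChartedSpace (EuclideanSpace ℝ (Fin k)) G]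
  [Group G] [LieGroup (𝓡 k) ∞ G]

theorem contMDiff_one_mulInvariantVectorField (a : GroupLieAlgebra (𝓡 k) G) :
    ContMDiff (𝓡 k) (𝓡 k).tangent 1
      (fun g : G => (⟨g, mulInvariantVectorField a g⟩ : TangentBundle (𝓡 k) G)) := by
  have : LieGroup (𝓡 k) (minSmoothness ℝ 3) G :=
    LieGroup.of_le (n := ∞) (by simp only [minSmoothness_of_isRCLikeNormedField]; exact ENat.LEInfty.out)
  refine (contMDiff_mulInvariantVectorField a).of_le ?_
  simp only [minSmoothness_of_isRCLikeNormedField]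
  exact one_le_two

/-- Left translates of integral curves of a left invariant vector field are integral curves. -/
theorem IsMIntegralCurveOn.mul_left {a : GroupLieAlgebra (𝓡 k) G} {γ : ℝ → G} {s : Set ℝ}
    (hγ : IsMIntegralCurveOn (I := 𝓡 k) γ (mulInvariantVectorField a) s) (g : G) :
    IsMIntegralCurveOn (I := 𝓡 k) (fun t => g * γ t) (mulInvariantVectorField a) s := by
  intro t ht
  have hmul : ∀ h x : G, MDifferentiableAt (𝓡 k) (𝓡 k) (fun y : G => h * y) x := fun h x =>
    (contMDiff_mul_left (I := 𝓡 k) (n := ∞)).contMDiffAt.mdifferentiableAt (by simp)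
  have h1 := HasMFDerivAt.comp_hasMFDerivWithinAt t (hmul g (γ t)).hasMFDerivAt (hγ t ht)
  refine h1.congr_mfderiv ?_
  have h2 : mulInvariantVectorField a (g * γ t) =
      mfderiv (𝓡 k) (𝓡 k) (fun y : G => g * y) (γ t) (mulInvariantVectorField a (γ t)) := by
    have h3 := HasMFDerivAt.comp (1 : G) (I := 𝓡 k) (I' := 𝓡 k) (g := fun y : G => g * y)
      (f := fun y : G => γ t * y) (g' := mfderiv (𝓡 k) (𝓡 k) (fun y : G => g * y) (γ t))
      (by rw [mul_one]; exact (hmul g (γ t)).hasMFDerivAt)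
      (hmul (γ t) 1).hasMFDerivAt
    have h4 : ((fun y : G => g * y) ∘ fun y : G => γ t * y) = fun y => (g * γ t) * y := by
      ext y; simp [mul_assoc]
    rw [h4] at h3
    exact congrArg (fun T : EuclideanSpace ℝ (Fin k) →L[ℝ] EuclideanSpace ℝ (Fin k) => T a)
      h3.mfderiv
  rw [h2]
  ext
  exact (mfderiv (𝓡 k) (𝓡 k) (fun y : G => g * y) (γ t)).map_smul (1 : ℝ) _

variable [T2Space G]

theorem exists_isMIntegralCurve_mulInvariant (a : GroupLieAlgebra (𝓡 k) G) :
    ∃ γ : ℝ → G, γ 0 = 1 ∧ IsMIntegralCurve (I := 𝓡 k) γ (mulInvariantVectorField a) := by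
  have : IsManifold (𝓡 k) ∞ G := ContMDiffMul.toIsManifold
  have : IsManifold (𝓡 k) 1 G := IsManifold.of_le (n := ∞) (by exact mod_cast le_top)
  obtain ⟨γ, hγ, hγ'⟩ := exists_isMIntegralCurveAt_of_contMDiffAt_boundaryless
    (t₀ := 0) ((contMDiff_one_mulInvariantVectorField a) (1 : G))
  obtain ⟨ε, hε, h⟩ := isMIntegralCurveAt_iff'.1 hγ'
  rw [Real.ball_eq_Ioo, zero_sub, zero_add] at h
  refine exists_isMIntegralCurve_of_isMIntegralCurveOn (contMDiff_one_mulInvariantVectorField a)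
    hε (fun x => ⟨fun t => x * γ t, by simp [hγ], h.mul_left x⟩) 1

theorem lieExp_smul_eq {a : GroupLieAlgebra (𝓡 k) G} {γ : ℝ → G} (h0 : γ 0 = 1)
    (hγ : IsMIntegralCurve (I := 𝓡 k) γ (mulInvariantVectorField a)) (t : ℝ) :
    lieExp (t • a) = γ t := by
  have : IsManifold (𝓡 k) ∞ G := ContMDiffMul.toIsManifold
  have : IsManifold (𝓡 k) 1 G := IsManifold.of_le (n := ∞) (by exact mod_cast le_top)
  have hex := exists_isMIntegralCurve_mulInvariant (t • a)
  have h1 : IsMIntegralCurve (I := 𝓡 k) (γ ∘ (· * t)) (mulInvariantVectorField (t • a)) := by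
    rw [mulInvariantVectorField_smul]
    exact hγ.comp_mul t
  have h2 := isMIntegralCurve_Ioo_eq_of_contMDiff_boundaryless (t₀ := 0)
    (contMDiff_one_mulInvariantVectorField (t • a)) hex.choose_spec.2 h1
    (by rw [hex.choose_spec.1]; simp [h0])
  rw [lieExp, dif_pos hex, h2]
  simp

theorem isMIntegralCurve_lieExp (a : GroupLieAlgebra (𝓡 k) G) :
    IsMIntegralCurve (I := 𝓡 k) (fun t : ℝ => lieExp (t • a)) (mulInvariantVectorField a) := by
  obtain ⟨γ, h0, hγ⟩ := exists_isMIntegralCurve_mulInvariant a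
  have : (fun t : ℝ => lieExp (t • a)) = γ := funext fun t => lieExp_smul_eq h0 hγ t
  rwa [this]

theorem lieExp_zero : lieExp (0 : GroupLieAlgebra (𝓡 k) G) = 1 := by
  obtain ⟨γ, h0, hγ⟩ := exists_isMIntegralCurve_mulInvariant (0 : GroupLieAlgebra (𝓡 k) G)
  have := lieExp_smul_eq h0 hγ 0
  rwa [zero_smul, h0] at this

theorem lieExp_add_smul (a : GroupLieAlgebra (𝓡 k) G) (s t : ℝ) :
    lieExp ((s + t) • a) = lieExp (s • a) * lieExp (t • a) := by
  have : IsManifold (𝓡 k) ∞ G := ContMDiffMul.toIsManifold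
  have : IsManifold (𝓡 k) 1 G := IsManifold.of_le (n := ∞) (by exact mod_cast le_top)
  have h1 := (isMIntegralCurve_lieExp a).comp_add s
  have h2 : IsMIntegralCurve (I := 𝓡 k) (fun t : ℝ => lieExp (s • a) * lieExp (t • a))
      (mulInvariantVectorField a) := by
    rw [isMIntegralCurve_iff_isMIntegralCurveOn]
    exact ((isMIntegralCurve_lieExp a).isMIntegralCurveOn _).mul_left _
  have h3 := isMIntegralCurve_Ioo_eq_of_contMDiff_boundaryless (t₀ := 0)
    (contMDiff_one_mulInvariantVectorField a) h1 h2 (by simp [lieExp_zero])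
  have := congrFun h3 t
  simpa [add_comm] using this

theorem lieExp_smul_pow (a : GroupLieAlgebra (𝓡 k) G) (n : ℕ) :
    lieExp ((n : ℝ) • a) = lieExp a ^ n := by
  induction n with
  | zero => simp [lieExp_zero]
  | succ n ih =>
    rw [Nat.cast_succ, lieExp_add_smul, ih, one_smul, pow_succ]

/-- The chart flow represents the exponential map. -/
theorem lieExp_smul_eq_of_chart_solution {a : GroupLieAlgebra (𝓡 k) G} {ε : ℝ} (hε : 0 < ε)
    {β : ℝ → EuclideanSpace ℝ (Fin k)} (h0 : β 0 = extChartAt (𝓡 k) (1 : G) 1)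
    (hβ : ∀ t ∈ Set.Ioo (-ε) ε, β t ∈ (extChartAt (𝓡 k) (1 : G)).target ∧
      HasDerivAt β (chartLeftTranslation G (β t) a) t) {t : ℝ} (ht : t ∈ Set.Ioo (-ε) ε) :
    lieExp (t • a) = (extChartAt (𝓡 k) (1 : G)).symm (β t) := by
  have : IsManifold (𝓡 k) ∞ G := ContMDiffMul.toIsManifold
  have : IsManifold (𝓡 k) 1 G := IsManifold.of_le (n := ∞) (by exact mod_cast le_top)
  have h1 : IsMIntegralCurveOn (I := 𝓡 k) (fun t => (extChartAt (𝓡 k) (1 : G)).symm (β t))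
      (mulInvariantVectorField a) (Set.Ioo (-ε) ε) := fun s hs =>
    (hasMFDerivAt_of_chart_solution (hβ s hs).1 (hβ s hs).2).hasMFDerivWithinAt
  exact isMIntegralCurveOn_Ioo_eqOn_of_contMDiff_boundaryless (t₀ := 0) ⟨by linarith, hε⟩
    (contMDiff_one_mulInvariantVectorField a) ((isMIntegralCurve_lieExp a).isMIntegralCurveOn _) h1
    (by simp [lieExp_zero, h0]) ht

theorem continuous_lieExp :
    Continuous (lieExp : GroupLieAlgebra (𝓡 k) G → G) := by
  have : IsTopologicalGroup G := topologicalGroup_of_lieGroup (𝓡 k) ∞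
  obtain ⟨r, hr, ε, hε, β, hβc, hβ⟩ := exists_chart_flow (k := k) G
  have hsmall : ∀ b : EuclideanSpace ℝ (Fin k), ‖b‖ < r → 
      ContinuousAt (fun b : EuclideanSpace ℝ (Fin k) => 
        (lieExp ((ε / 2) • b : GroupLieAlgebra (𝓡 k) G) : G)) b := by
    intro b hb
    have hmem : ε / 2 ∈ Set.Ioo (-ε) ε := ⟨by linarith, by linarith⟩
    have hb' : b ∈ Metric.ball (0 : EuclideanSpace ℝ (Fin k)) r := by simpa using hb
    have h1 : ContinuousAt (fun b : EuclideanSpace ℝ (Fin k) => β (b, ε / 2)) b := by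
      have := hβc.continuousAt (x := (b, ε / 2)) (prod_mem_nhds (Metric.isOpen_ball.mem_nhds hb')
        (isOpen_Ioo.mem_nhds hmem))
      exact ContinuousAt.comp (f := fun b : EuclideanSpace ℝ (Fin k) => (b, ε / 2)) this
        (by fun_prop)
    have h2 : ContinuousAt (extChartAt (𝓡 k) (1 : G)).symm (β (b, ε / 2)) :=
      continuousAt_extChartAt_symm'' ((hβ b hb').2 _ hmem).1
    refine (ContinuousAt.comp (f := fun b : EuclideanSpace ℝ (Fin k) => β (b, ε / 2))
      h2 h1).congr ?_
    filter_upwards [Metric.isOpen_ball.mem_nhds hb'] with c hc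
    exact (lieExp_smul_eq_of_chart_solution (a := c) hε (β := fun t => β (c, t)) (hβ c hc).1
      (hβ c hc).2 hmem).symm
  rw [continuous_iff_continuousAt]
  intro (a : EuclideanSpace ℝ (Fin k))
  obtain ⟨n, hn⟩ := exists_nat_gt ((2 / ε) * ‖a‖ / r)
  have hn0 : (0 : ℝ) < n := lt_of_le_of_lt (by positivity) hn
  set c : ℝ := 2 / ε / n with hc
  have hc0 : 0 < c := by positivity
  have hca : ‖c • a‖ < r := by
    rw [norm_smul, Real.norm_of_nonneg hc0.le, hc]
    rw [div_lt_iff₀ hr] at hn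
    rw [div_mul_eq_mul_div, div_lt_iff₀ hn0]
    linarith
  have h1 : ContinuousAt (fun b : EuclideanSpace ℝ (Fin k) =>
      (lieExp ((ε / 2) • (c • b) : GroupLieAlgebra (𝓡 k) G) : G) ^ n) a :=
    (ContinuousAt.comp (f := fun b : EuclideanSpace ℝ (Fin k) => c • b) (hsmall _ hca)
      (by fun_prop)).pow n
  refine h1.congr (Filter.Eventually.of_forall fun b => ?_)
  change (lieExp ((ε / 2) • (c • b) : GroupLieAlgebra (𝓡 k) G) : G) ^ n = lieExp b
  have h2 : (n : ℝ) * (ε / 2 * c) = 1 := by rw [hc]; field_simp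
  have h3 : (n : ℝ) • (ε / 2) • c • b = b := by
    rw [← mul_smul, ← mul_smul, mul_assoc, h2, one_smul]
  exact (lieExp_smul_pow (G := G) ((ε / 2) • c • b : EuclideanSpace ℝ (Fin k)) n).symm.trans
    (congrArg (lieExp (G := G)) h3)

theorem contMDiff_lieExp_smul (a : GroupLieAlgebra (𝓡 k) G) :
    ContMDiff 𝓘(ℝ, ℝ) (𝓡 k) ∞ (fun t : ℝ => lieExp (t • a)) := by
  have : IsManifold (𝓡 k) ∞ G := ContMDiffMul.toIsManifold
  have key : ContMDiffAt 𝓘(ℝ, ℝ) (𝓡 k) ∞ (fun t : ℝ => lieExp (t • a)) 0 := by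
    have hexp := isMIntegralCurve_lieExp a
    obtain ⟨r, hr, ε, hε, β, hβc, hβ⟩ := exists_chart_flow (k := k) G
    obtain ⟨v, rfl⟩ : ∃ v : EuclideanSpace ℝ (Fin k), v = a := ⟨a, rfl⟩
    obtain ⟨c, hc0, hc⟩ : ∃ c : ℝ, c > 0 ∧ ‖c • v‖ < r := by
      refine ⟨r / (2 * (‖v‖ + 1)), by positivity, ?_⟩
      rw [norm_smul, Real.norm_of_nonneg (by positivity), div_mul_eq_mul_div,
        div_lt_iff₀ (by positivity)]
      nlinarith [norm_nonneg v]
    have hb' : c • v ∈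
      Metric.ball (0 : EuclideanSpace ℝ (Fin k)) r := by simpa using hc
    have hsol := (hβ _ hb').2
    have hsub : Set.Icc (-(ε / 2)) (ε / 2) ⊆ Set.Ioo (-ε) ε := fun t ht =>
      ⟨by linarith [ht.1], by linarith [ht.2]⟩
    have hsm : ContDiffOn ℝ ∞ (fun t => β (c • v, t))
        (Set.Icc (-(ε / 2)) (ε / 2)) := by
      refine ODE.contDiffOn_enat_Icc_of_hasDerivWithinAt (n := ⊤)
        (f := fun _ x => chartLeftTranslation G x (c • v))
        (u := (extChartAt (𝓡 k) (1 : G)).target) ?_ (fun t ht =>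
          (hsol t (hsub ht)).2.hasDerivWithinAt) (fun t ht => (hsol t (hsub ht)).1)
      rintro ⟨s, x⟩ ⟨-, hx⟩
      refine ContDiffAt.contDiffWithinAt ?_
      exact ContDiffAt.clm_apply (ContDiffAt.comp (s, x) (contDiffAt_chartLeftTranslation hx)
        contDiffAt_snd) contDiffAt_const
    have h0 : ContMDiffAt 𝓘(ℝ, ℝ) (𝓡 k) ∞
        (fun t : ℝ => lieExp (k := k) (G := G) (t • c • v)) 0 := by
      have h1 : ContMDiffAt 𝓘(ℝ, ℝ) 𝓘(ℝ, EuclideanSpace ℝ (Fin k)) ∞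
          (fun t => β (c • v, t)) 0 :=
        (hsm.contDiffAt (Icc_mem_nhds (by linarith) (by linarith))).contMDiffAt
      have h2 := (contMDiffOn_extChartAt_symm (I := 𝓡 k) (n := ∞) (1 : G)).contMDiffAt
        ((isOpen_extChartAt_target (1 : G)).mem_nhds (hsol 0 ⟨by linarith, hε⟩).1)
      refine (ContMDiffAt.comp (0 : ℝ) h2 h1).congr_of_eventuallyEq ?_
      filter_upwards [Ioo_mem_nhds (by linarith : -ε < 0) hε] with t ht
      exact lieExp_smul_eq_of_chart_solution (k := k) (G := G) hε
        (β := fun t => β (c • v, t)) (hβ _ hb').1 (hβ _ hb').2 ht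
    have h3 : (fun t : ℝ => lieExp (k := k) (G := G) (t • v)) =
        (fun t : ℝ => lieExp (k := k) (G := G) (t • c • v)) ∘ fun t => t / c := by
      ext t
      change lieExp (k := k) (G := G) (t • v) = lieExp (k := k) (G := G) ((t / c) • c • v)
      rw [smul_smul, div_mul_cancel₀ _ hc0.ne']
    have h4 : ContMDiffAt 𝓘(ℝ, ℝ) 𝓘(ℝ, ℝ) ∞ (fun t : ℝ => t / c) 0 :=
      (contDiff_id.div_const c).contMDiff.contMDiffAt
    exact (ContMDiffAt.comp (0 : ℝ) (by simpa using h0) h4).congr_of_eventuallyEq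
      (Filter.Eventually.of_forall (congrFun h3))
  intro s
  have h1 : (fun t : ℝ => lieExp (t • a)) =
      (fun g => lieExp (s • a) * g) ∘ (fun t : ℝ => lieExp (t • a)) ∘ fun t => t - s := by
    ext t
    simp only [Function.comp]
    rw [← lieExp_add_smul, add_sub_cancel]
  rw [h1]
  refine ContMDiffAt.comp s (contMDiff_mul_left (I := 𝓡 k) (n := ∞)).contMDiffAt ?_
  refine ContMDiffAt.comp s (by simpa using key) ?_
  exact (contDiff_id.sub contDiff_const).contMDiff.contMDiffAt

end LieExponential

section PartialDerivatives

variable {E₀ : Type*} [NormedAddCommGroup E₀] [NormedSpace ℝ E₀] {H₀ : Type*} [TopologicalSpace H₀]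
  {I₀ : ModelWithCorners ℝ E₀ H₀} {X : Type*} [TopologicalSpace X] [ChartedSpace H₀ X]
  [IsManifold I₀ ∞ X]
  {E : Type*} [NormedAddCommGroup E] [NormedSpace ℝ E]
  {F : Type*} [NormedAddCommGroup F] [NormedSpace ℝ F]

/-- The partial derivative along a vector space of a smooth function is smooth. -/
theorem ContMDiffAt.partial_fderiv {f : X × E → F} {x₀ : X} {e₀ : E}
    (hf : ContMDiffAt (I₀.prod 𝓘(ℝ, E)) 𝓘(ℝ, F) ∞ f (x₀, e₀)) :
    ContMDiffAt (I₀.prod 𝓘(ℝ, E)) 𝓘(ℝ, E →L[ℝ] F) ∞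
      (fun z : X × E => fderiv ℝ (fun e => f (z.1, e)) z.2) (x₀, e₀) := by
  have h := ContMDiffAt.mfderiv (I := 𝓘(ℝ, E)) (I' := 𝓘(ℝ, F)) (J := I₀.prod 𝓘(ℝ, E)) (n := ∞)
    (m := ∞) (x₀ := (x₀, e₀)) (fun (z : X × E) e => f (z.1, e)) (fun z => z.2)
    (ContMDiffAt.comp (I' := I₀.prod 𝓘(ℝ, E)) ((x₀, e₀), e₀) hf
      ((contMDiffAt_fst.comp _ contMDiffAt_fst).prodMk contMDiffAt_snd))
    contMDiffAt_snd (by simp)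
  simp only [inTangentCoordinates_model_space, mfderiv_eq_fderiv] at h
  exact h

end PartialDerivatives

section Covectors

theorem clm_apply_eq_sum {d : ℕ} {F : Type*} [AddCommGroup F] [Module ℝ F] [TopologicalSpace F]
    (L : EuclideanSpace ℝ (Fin d) →L[ℝ] F) (v : EuclideanSpace ℝ (Fin d)) :
    L v = ∑ i, v i • L (EuclideanSpace.single i 1) := by
  have hsum : v = ∑ i, v i • EuclideanSpace.single i (1 : ℝ) := by
    ext j
    simp [Finset.sum_apply, Pi.single_apply]
  conv_lhs => rw [hsum]
  simp only [map_sum, map_smul]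

variable {n : ℕ} {N : Type*} [TopologicalSpace N] [ChartedSpace (EuclideanSpace ℝ (Fin n)) N]

variable (n) in
/-- The differential of a function, as a covector of the model space. -/
def dN (f : N → ℝ) (y : N) : EuclideanSpace ℝ (Fin n) →L[ℝ] ℝ := mvfderiv (𝓡 n) f y

theorem HasMFDerivAt.dN_eq {f : N → ℝ} {y : N} {L : EuclideanSpace ℝ (Fin n) →L[ℝ] ℝ}
    (h : HasMFDerivAt (𝓡 n) 𝓘(ℝ, ℝ) f y L) : dN n f y = L :=
  h.mfderiv

theorem MDifferentiableAt.hasMFDerivAt_dN {f : N → ℝ} {y : N}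
    (h : MDifferentiableAt (𝓡 n) 𝓘(ℝ, ℝ) f y) : HasMFDerivAt (𝓡 n) 𝓘(ℝ, ℝ) f y (dN n f y) :=
  h.hasMFDerivAt

theorem Filter.EventuallyEq.dN_eq {f g : N → ℝ} {y : N} (h : f =ᶠ[𝓝 y] g) :
    dN n f y = dN n g y := by
  have := h.mfderiv_eq (I := 𝓡 n) (I' := 𝓘(ℝ, ℝ))
  exact this

variable [IsManifold (𝓡 n) ∞ N]

theorem contMDiffAt_extChartAt_of_mem {y₀ y : N} (hy : y ∈ (extChartAt (𝓡 n) y₀).source) :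
    ContMDiffAt (𝓡 n) (𝓡 n) ∞ (extChartAt (𝓡 n) y₀) y :=
  contMDiffAt_extChartAt' (by simpa using hy)

theorem contMDiffAt_extChartAt_symm_of_mem {y₀ : N} {x : EuclideanSpace ℝ (Fin n)}
    (hx : x ∈ (extChartAt (𝓡 n) y₀).target) :
    ContMDiffAt (𝓡 n) (𝓡 n) ∞ (extChartAt (𝓡 n) y₀).symm x :=
  (contMDiffOn_extChartAt_symm (n := ∞) y₀).contMDiffAt
    ((isOpen_extChartAt_target y₀).mem_nhds hx)

/-- The differential of a function, through the chart at a nearby point. -/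
theorem dN_eq_chart {f : N → ℝ} {y₀ y : N} (hy : y ∈ (extChartAt (𝓡 n) y₀).source)
    (hf : MDifferentiableAt (𝓡 n) 𝓘(ℝ, ℝ) f y) (v : EuclideanSpace ℝ (Fin n)) :
    dN n f y v = fderiv ℝ (f ∘ (extChartAt (𝓡 n) y₀).symm) (extChartAt (𝓡 n) y₀ y)
      (mfderiv (𝓡 n) (𝓡 n) (extChartAt (𝓡 n) y₀) y v) := by
  set χ := extChartAt (𝓡 n) y₀
  have hs := (contMDiffAt_extChartAt_symm_of_mem (χ.map_source hy)).mdifferentiableAt (by simp)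
  have h1 : MDifferentiableAt 𝓘(ℝ, EuclideanSpace ℝ (Fin n)) 𝓘(ℝ, ℝ) (f ∘ χ.symm) (χ y) := by
    refine MDifferentiableAt.comp (χ y) ?_ hs
    rwa [χ.left_inv hy]
  have h2 := (contMDiffAt_extChartAt_of_mem hy).mdifferentiableAt (by simp)
  have h3 : (f ∘ χ.symm) ∘ χ =ᶠ[𝓝 y] f := by
    filter_upwards [(isOpen_extChartAt_source y₀).mem_nhds hy] with z hz
    simp [χ.left_inv hz]
  rw [← h3.dN_eq]
  have h4 := HasMFDerivAt.comp y h1.hasMFDerivAt h2.hasMFDerivAt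
  rw [mfderiv_eq_fderiv] at h4
  rw [HasMFDerivAt.dN_eq h4]
  rfl

/-- The differential of a function in the preferred chart. -/
theorem dN_eq_fderiv {f : N → ℝ} {y : N} (hf : MDifferentiableAt (𝓡 n) 𝓘(ℝ, ℝ) f y) :
    dN n f y = fderiv ℝ (f ∘ (extChartAt (𝓡 n) y).symm) (extChartAt (𝓡 n) y y) := by
  ext v
  rw [dN_eq_chart (mem_extChartAt_source y) hf, (hasMFDerivAt_extChartAt_center y).mfderiv]
  rfl

variable [T2Space N]

/-- Globally defined smooth functions that are coordinates near a given point. -/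
theorem exists_global_coordinates (y₀ : N) :
    ∃ η : Fin n → N → ℝ, (∀ i, ContMDiff (𝓡 n) 𝓘(ℝ, ℝ) ∞ (η i)) ∧
      (∀ i, dN n (η i) y₀ = EuclideanSpace.proj i) ∧
      ∀ᶠ y in 𝓝 y₀, y ∈ (extChartAt (𝓡 n) y₀).source ∧
        ∀ f : N → ℝ, MDifferentiableAt (𝓡 n) 𝓘(ℝ, ℝ) f y → dN n f y =
          ∑ i, fderiv ℝ (f ∘ (extChartAt (𝓡 n) y₀).symm) (extChartAt (𝓡 n) y₀ y)
            (EuclideanSpace.single i 1) • dN n (η i) y := by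
  set χ := extChartAt (𝓡 n) y₀ with hχ
  obtain ⟨b⟩ := (inferInstance : Nonempty (SmoothBumpFunction (𝓡 n) y₀))
  have hη : ∀ i : Fin n, ContMDiff (𝓡 n) 𝓘(ℝ, ℝ) ∞ (fun y => b y • χ y i) := by
    intro i
    refine b.contMDiff_smul ?_
    have h1 : ContMDiffOn (𝓡 n) (𝓡 n) ∞ χ (chartAt (EuclideanSpace ℝ (Fin n)) y₀).source :=
      contMDiffOn_extChartAt
    have h2 : ContMDiff (𝓡 n) 𝓘(ℝ, ℝ) ∞ (fun x : EuclideanSpace ℝ (Fin n) => x i) :=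
      (EuclideanSpace.proj (𝕜 := ℝ) i).contDiff.contMDiff
    exact h2.comp_contMDiffOn h1
  have hloc : ∀ᶠ y in 𝓝 y₀, y ∈ χ.source ∧ ∀ i, (fun y => b y • χ y i) =ᶠ[𝓝 y] fun y => χ y i := by
    have h1 : ∀ᶠ y in 𝓝 y₀, ∀ᶠ z in 𝓝 y, b z = 1 := by
      have := b.eventuallyEq_one.eventually_nhds
      filter_upwards [this] with y hy
      filter_upwards [hy] with z hz
      simpa using hz
    filter_upwards [h1, extChartAt_source_mem_nhds (I := 𝓡 n) y₀] with y hy hy'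
    refine ⟨hy', fun i => ?_⟩
    filter_upwards [hy] with z hz
    rw [hz, one_smul]
  have hd : ∀ y ∈ χ.source, ∀ i v, dN n (fun y => χ y i) y v =
      (EuclideanSpace.proj i : EuclideanSpace ℝ (Fin n) →L[ℝ] ℝ) (mfderiv (𝓡 n) (𝓡 n) χ y v) := by
    intro y hy i v
    have h1 := ((contMDiffAt_extChartAt_of_mem hy).mdifferentiableAt (by simp)).hasMFDerivAt
    have h2 : HasMFDerivAt (𝓡 n) 𝓘(ℝ, ℝ) (EuclideanSpace.proj i : EuclideanSpace ℝ (Fin n) →L[ℝ] ℝ) (χ y)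
      (EuclideanSpace.proj (𝕜 := ℝ) i) := (EuclideanSpace.proj (𝕜 := ℝ) i).hasFDerivAt.hasMFDerivAt
    exact congrArg (fun T : EuclideanSpace ℝ (Fin n) →L[ℝ] ℝ => T v)
      (HasMFDerivAt.dN_eq (HasMFDerivAt.comp y h2 h1))
  refine ⟨fun i y => b y • χ y i, hη, fun i => ?_, ?_⟩
  · rw [(hloc.self_of_nhds.2 i).dN_eq]
    ext v
    rw [hd _ (mem_extChartAt_source y₀), hχ, (hasMFDerivAt_extChartAt_center y₀).mfderiv]
    rfl
  · filter_upwards [hloc] with y hy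
    refine ⟨hy.1, fun f hf => ?_⟩
    ext v
    rw [dN_eq_chart hy.1 hf]
    obtain ⟨w, hw⟩ : ∃ w : EuclideanSpace ℝ (Fin n), w = mfderiv (𝓡 n) (𝓡 n) χ y v := ⟨_, rfl⟩
    rw [← hw]
    have : ∀ i, dN n (fun y => b y • χ y i) y v = w i := by
      intro i
      rw [(hy.2 i).dN_eq, hd y hy.1, ← hw]
      rfl
    simp only [_root_.sum_apply, _root_.smul_apply, this]
    rw [clm_apply_eq_sum _ w]
    simp only [smul_eq_mul, mul_comm]
    rfl

/-- Every covector is the differential of a globally defined smooth function. -/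
theorem exists_dN_eq (y : N) (α : EuclideanSpace ℝ (Fin n) →L[ℝ] ℝ) :
    ∃ f : N → ℝ, ContMDiff (𝓡 n) 𝓘(ℝ, ℝ) ∞ f ∧ dN n f y = α := by
  obtain ⟨η, hη, hd, -⟩ := exists_global_coordinates (n := n) y
  refine ⟨fun z => ∑ i, α (EuclideanSpace.single i 1) • η i z,
    contMDiff_finsetSum fun i _ => (contDiff_const_smul (n := ∞) (α (EuclideanSpace.single i 1))).contMDiff.comp (hη i), ?_⟩
  have h1 : HasMFDerivAt (𝓡 n) 𝓘(ℝ, ℝ)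
      (∑ i, (fun z => α (EuclideanSpace.single i 1) • η i z)) y
      (∑ i, α (EuclideanSpace.single i 1) • dN n (η i) y) :=
    HasMFDerivAt.sum fun i _ => (((hη i).mdifferentiable (by simp) y).hasMFDerivAt_dN).const_smul
      (α (EuclideanSpace.single i 1))
  have h2 : (fun z => ∑ i, α (EuclideanSpace.single i 1) • η i z) =
    ∑ i, (fun z => α (EuclideanSpace.single i 1) • η i z) := by ext; simp
  have h3 : dN n (∑ i, (fun z => α (EuclideanSpace.single i 1) • η i z)) y =
    ∑ i, α (EuclideanSpace.single i 1) • dN n (η i) y := h1.dN_eq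
  rw [h2, h3]
  ext v
  rw [clm_apply_eq_sum α v]
  simp [hd, mul_comm]

end Covectors

section Brackets

variable {n : ℕ} {N : Type*} [TopologicalSpace N] [ChartedSpace (EuclideanSpace ℝ (Fin n)) N]
  (Ψ : PoissonTensor (𝓡 n) N)

/-- The Poisson tensor as a bilinear form on the covectors of the model space. -/
def PoissonTensor.form (y : N) : (EuclideanSpace ℝ (Fin n) →L[ℝ] ℝ) →L[ℝ]
    (EuclideanSpace ℝ (Fin n) →L[ℝ] ℝ) →L[ℝ] ℝ :=
  (ContinuousLinearMap.apply ℝ ℝ : EuclideanSpace ℝ (Fin n) →L[ℝ] _).comp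
    (LinearMap.toContinuousLinearMap
      (Ψ.sharp y : (EuclideanSpace ℝ (Fin n) →L[ℝ] ℝ) →ₗ[ℝ] EuclideanSpace ℝ (Fin n)))

/-- The Poisson bracket `{f, h}` of functions on `N`. -/
def PoissonTensor.br (f h : N → ℝ) (y : N) : ℝ := Ψ.form y (dN n f y) (dN n h y)

theorem PoissonTensor.br_eq_bracket (f h : N → ℝ) : Ψ.br f h = bracket Ψ.sharp f h := rfl

theorem PoissonTensor.form_apply (y : N) (α β : EuclideanSpace ℝ (Fin n) →L[ℝ] ℝ) :
    Ψ.form y α β = β (Ψ.sharp y α) := rfl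

theorem PoissonTensor.form_skew (y : N) (α β : EuclideanSpace ℝ (Fin n) →L[ℝ] ℝ) :
    Ψ.form y α β = - Ψ.form y β α := Ψ.skew y α β

theorem PoissonTensor.br_skew (f h : N → ℝ) (y : N) : Ψ.br f h y = - Ψ.br h f y :=
  Ψ.form_skew y _ _

theorem PoissonTensor.contMDiff_br {f h : N → ℝ} (hf : ContMDiff (𝓡 n) 𝓘(ℝ, ℝ) ∞ f)
    (hh : ContMDiff (𝓡 n) 𝓘(ℝ, ℝ) ∞ h) : ContMDiff (𝓡 n) 𝓘(ℝ, ℝ) ∞ (Ψ.br f h) :=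
  Ψ.smooth f h hf hh

/-- The Jacobi identity, as the Leibniz rule for `{f, ·}`. -/
theorem PoissonTensor.br_br {f g h : N → ℝ} (hf : ContMDiff (𝓡 n) 𝓘(ℝ, ℝ) ∞ f)
    (hg : ContMDiff (𝓡 n) 𝓘(ℝ, ℝ) ∞ g) (hh : ContMDiff (𝓡 n) 𝓘(ℝ, ℝ) ∞ h) (y : N) :
    Ψ.br f (Ψ.br g h) y = Ψ.br (Ψ.br f g) h y + Ψ.br g (Ψ.br f h) y := by
  have h1 := Ψ.jacobi f g h hf hg hh y
  simp only [← Ψ.br_eq_bracket] at h1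
  have h2 : Ψ.br g (Ψ.br h f) y = - Ψ.br g (Ψ.br f h) y := by
    have : Ψ.br h f = -Ψ.br f h := funext fun z => Ψ.br_skew h f z
    simp only [this, PoissonTensor.br, dN, mvfderiv_neg]
    rfl
  have h3 := Ψ.br_skew h (Ψ.br f g) y
  linarith

end Brackets

section Families

theorem differentiableAt_bilin {W D : Type*} [NormedAddCommGroup W] [NormedSpace ℝ W]
    [NormedAddCommGroup D] [NormedSpace ℝ D] (B : D →L[ℝ] D →L[ℝ] ℝ) {a b : W → D} {w : W}
    (ha : DifferentiableAt ℝ a w) (hb : DifferentiableAt ℝ b w) :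
    DifferentiableAt ℝ (fun w => B (a w) (b w)) w ∧
      ∀ u, fderiv ℝ (fun w => B (a w) (b w)) w u =
        B (fderiv ℝ a w u) (b w) + B (a w) (fderiv ℝ b w u) := by
  have h := B.hasFDerivAt_of_bilinear ha.hasFDerivAt hb.hasFDerivAt
  refine ⟨h.differentiableAt, fun u => ?_⟩
  rw [h.fderiv]
  simp [add_comm]

theorem bilin_sum_smul {D ι : Type*} [NormedAddCommGroup D] [NormedSpace ℝ D] [Fintype ι]
    (B : D →L[ℝ] D →L[ℝ] ℝ) (a b : ι → ℝ) (x : ι → D) :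
    B (∑ i, a i • x i) (∑ i, b i • x i) = ∑ i, ∑ j, a i * b j * B (x i) (x j) := by
  simp only [map_sum, map_smul, _root_.sum_apply, _root_.smul_apply, smul_eq_mul,
    Finset.mul_sum]
  refine Finset.sum_comm.trans ?_
  refine Finset.sum_congr rfl fun i _ => Finset.sum_congr rfl fun j _ => ?_
  ring

variable {W : Type*} [NormedAddCommGroup W] [NormedSpace ℝ W]
  {n : ℕ} {N : Type*} [TopologicalSpace N] [ChartedSpace (EuclideanSpace ℝ (Fin n)) N]

variable (n) in
/-- Smooth functions on the product of a vector space and a manifold. -/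
abbrev SmoothFamily (f : W × N → ℝ) : Prop :=
  ContMDiff (𝓘(ℝ, W).prod (𝓡 n)) 𝓘(ℝ, ℝ) ∞ f

/-- The partial derivative of a family of functions in the direction `u` of the parameter space. -/
def dirDeriv (u : W) (f : W × N → ℝ) (z : W × N) : ℝ :=
  fderiv ℝ (fun w => f (w, z.2)) z.1 u

/-- The fiberwise Poisson bracket of families of functions. -/
def PoissonTensor.fbr (Ψ : PoissonTensor (𝓡 n) N) (f h : W × N → ℝ) (z : W × N) : ℝ :=
  Ψ.br (fun y => f (z.1, y)) (fun y => h (z.1, y)) z.2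

theorem SmoothFamily.slice {f : W × N → ℝ} (hf : SmoothFamily n f) (w : W) :
    ContMDiff (𝓡 n) 𝓘(ℝ, ℝ) ∞ (fun y => f (w, y)) :=
  hf.comp (contMDiff_const.prodMk contMDiff_id)

theorem SmoothFamily.slice_mdifferentiableAt {f : W × N → ℝ} (hf : SmoothFamily n f) (w : W)
    (y : N) : MDifferentiableAt (𝓡 n) 𝓘(ℝ, ℝ) (fun y => f (w, y)) y :=
  (hf.slice w).mdifferentiable (by simp) y

theorem SmoothFamily.contDiff {f : W × N → ℝ} (hf : SmoothFamily n f) (y : N) :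
    ContDiff ℝ ∞ (fun w => f (w, y)) := by
  have : ContMDiff 𝓘(ℝ, W) 𝓘(ℝ, ℝ) ∞ (fun w => f (w, y)) :=
    hf.comp (contMDiff_id.prodMk contMDiff_const)
  exact this.contDiff

theorem SmoothFamily.differentiableAt {f : W × N → ℝ} (hf : SmoothFamily n f) (w : W) (y : N) :
    DifferentiableAt ℝ (fun w => f (w, y)) w :=
  (hf.contDiff y).differentiable (by simp) w

variable [IsManifold (𝓡 n) ∞ N]

theorem SmoothFamily.smooth_dirDeriv {f : W × N → ℝ} (hf : SmoothFamily n f) (u : W) :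
    SmoothFamily n (dirDeriv u f) := by
  intro z
  have h1 : ContMDiffAt ((𝓡 n).prod 𝓘(ℝ, W)) 𝓘(ℝ, ℝ) ∞ (fun p : N × W => f (p.2, p.1))
      (z.2, z.1) :=
    hf.comp (contMDiff_snd.prodMk contMDiff_fst) _
  have h2 := h1.partial_fderiv
  have h3 : ContMDiffAt (𝓘(ℝ, W).prod (𝓡 n)) 𝓘(ℝ, W →L[ℝ] ℝ) ∞
      (fun p : W × N => fderiv ℝ (fun w => f (w, p.2)) p.1) z :=
    ContMDiffAt.comp (I' := (𝓡 n).prod 𝓘(ℝ, W)) z h2 (contMDiffAt_snd.prodMk contMDiffAt_fst)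
  exact h3.clm_apply contMDiffAt_const

theorem SmoothFamily.contDiffAt_chart {f : W × N → ℝ} (hf : SmoothFamily n f) (w : W) {y₀ : N}
    {x : EuclideanSpace ℝ (Fin n)} (hx : x ∈ (extChartAt (𝓡 n) y₀).target) :
    ContDiffAt ℝ ∞ (fun p : W × EuclideanSpace ℝ (Fin n) =>
      f (p.1, (extChartAt (𝓡 n) y₀).symm p.2)) (w, x) := by
  rw [← contMDiffAt_iff_contDiffAt]
  refine ContMDiffAt.comp (I' := 𝓘(ℝ, W).prod (𝓡 n)) _ (hf _) ?_
  exact contDiff_fst.contMDiff.contMDiffAt.prodMk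
    (ContMDiffAt.comp (w, x) (contMDiffAt_extChartAt_symm_of_mem hx)
      contDiff_snd.contMDiff.contMDiffAt)

/-- The partial derivatives of a smooth family along the parameter space and along the manifold
commute. -/
theorem SmoothFamily.hasFDerivAt_dN {f : W × N → ℝ} (hf : SmoothFamily n f) (w : W) (y : N) :
    DifferentiableAt ℝ (fun w => dN n (fun y => f (w, y)) y) w ∧
    ∀ u, fderiv ℝ (fun w => dN n (fun y => f (w, y)) y) w u =
      dN n (fun y => dirDeriv u f (w, y)) y := by
  set χ := extChartAt (𝓡 n) y with hχ
  set g : W × EuclideanSpace ℝ (Fin n) → ℝ := fun p => f (p.1, χ.symm p.2) with hg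
  have hgs : ∀ w, ContDiffAt ℝ ∞ g (w, χ y) := fun w =>
    hf.contDiffAt_chart w (mem_extChartAt_target y)
  have hgd : ∀ w, DifferentiableAt ℝ g (w, χ y) := fun w => (hgs w).differentiableAt (by simp)
  have hdN : ∀ w, dN n (fun y => f (w, y)) y =
      (fderiv ℝ g (w, χ y)).comp (ContinuousLinearMap.inr ℝ W _) := by
    intro w
    rw [dN_eq_fderiv (hf.slice_mdifferentiableAt w y)]
    have := (hgd w).hasFDerivAt.comp (χ y) (hasFDerivAt_prodMk_right w (χ y))
    exact this.fderiv
  have hd2 : DifferentiableAt ℝ (fderiv ℝ g) (w, χ y) :=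
    ((hgs w).fderiv_right (m := ∞) (by simp)).differentiableAt (by simp)
  have hfd : HasFDerivAt (fun w => dN n (fun y => f (w, y)) y)
      (((ContinuousLinearMap.compL ℝ _ _ ℝ).flip (ContinuousLinearMap.inr ℝ W _)).comp
        ((fderiv ℝ (fderiv ℝ g) (w, χ y)).comp (ContinuousLinearMap.inl ℝ W _))) w := by
    simp_rw [hdN]
    exact ((ContinuousLinearMap.compL ℝ _ _ ℝ).flip
      (ContinuousLinearMap.inr ℝ W _)).hasFDerivAt.comp w
        (HasFDerivAt.comp w (f := fun w => (w, χ y)) hd2.hasFDerivAt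
          (hasFDerivAt_prodMk_left w (χ y)))
  refine ⟨hfd.differentiableAt, fun u => ?_⟩
  rw [hfd.fderiv]
  rw [dN_eq_fderiv ((hf.smooth_dirDeriv u).slice_mdifferentiableAt w y)]
  have hev : ((fun y => dirDeriv u f (w, y)) ∘ χ.symm) =ᶠ[𝓝 (χ y)]
      fun x => fderiv ℝ g (w, x) (u, 0) := by
    filter_upwards [(isOpen_extChartAt_target y).mem_nhds (mem_extChartAt_target y)] with x hx
    have h1 := HasFDerivAt.comp w (f := fun w => (w, x)) ((hf.contDiffAt_chart w
      hx).differentiableAt (by simp)).hasFDerivAt (hasFDerivAt_prodMk_left w x)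
    simp only [Function.comp_apply, dirDeriv]
    have h2 := h1.fderiv
    simp only [Function.comp_def] at h2
    rw [h2]
    rfl
  rw [hev.fderiv_eq]
  have h4 : HasFDerivAt (fun x => fderiv ℝ g (w, x) (u, 0))
      ((ContinuousLinearMap.apply ℝ ℝ ((u, 0) : W × EuclideanSpace ℝ (Fin n))).comp
        ((fderiv ℝ (fderiv ℝ g) (w, χ y)).comp (ContinuousLinearMap.inr ℝ W _))) (χ y) :=
    (ContinuousLinearMap.apply ℝ ℝ ((u, 0) : W × EuclideanSpace ℝ (Fin n))).hasFDerivAt.comp (χ y)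
      (hd2.hasFDerivAt.comp (χ y) (hasFDerivAt_prodMk_right w (χ y)))
  rw [h4.fderiv]
  ext v
  have hsymm := (hgs w).isSymmSndFDerivAt (by simpa using ENat.LEInfty.out)
  simpa using hsymm (u, 0) (0, v)

omit [IsManifold (𝓡 n) ∞ N] in
theorem SmoothFamily.dirDeriv_comm {f : W × N → ℝ} (hf : SmoothFamily n f) (u v : W) (z : W × N) :
    dirDeriv u (dirDeriv v f) z = dirDeriv v (dirDeriv u f) z := by
  have hs := hf.contDiff z.2
  have hd : DifferentiableAt ℝ (fderiv ℝ fun w => f (w, z.2)) z.1 :=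
    (hs.fderiv_right (m := ∞) (by simp)).differentiable (by simp) _
  have h1 : ∀ u v, dirDeriv u (dirDeriv v f) z =
      fderiv ℝ (fderiv ℝ fun w => f (w, z.2)) z.1 u v := by
    intro u v
    have : HasFDerivAt (fun w => fderiv ℝ (fun w => f (w, z.2)) w v)
      ((ContinuousLinearMap.apply ℝ ℝ v).comp (fderiv ℝ (fderiv ℝ fun w => f (w, z.2)) z.1)) z.1 :=
      (ContinuousLinearMap.apply ℝ ℝ v).hasFDerivAt.comp z.1 hd.hasFDerivAt
    simp only [dirDeriv]
    rw [this.fderiv]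
    rfl
  rw [h1, h1]
  exact (hs.contDiffAt.isSymmSndFDerivAt (by simpa using ENat.LEInfty.out)) u v

variable (Ψ : PoissonTensor (𝓡 n) N)

/-- The Leibniz rule for the derivative of a fiberwise bracket along the parameter space. -/
theorem SmoothFamily.hasFDerivAt_fbr {f h : W × N → ℝ} (hf : SmoothFamily n f)
    (hh : SmoothFamily n h) (w : W) (y : N) :
    DifferentiableAt ℝ (fun w => Ψ.fbr f h (w, y)) w ∧ ∀ u, 
      dirDeriv u (Ψ.fbr f h) (w, y) =
      Ψ.fbr (dirDeriv u f) h (w, y) + Ψ.fbr f (dirDeriv u h) (w, y) := by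
  obtain ⟨hf1, hf2⟩ := hf.hasFDerivAt_dN w y
  obtain ⟨hh1, hh2⟩ := hh.hasFDerivAt_dN w y
  obtain ⟨h1, h2⟩ := differentiableAt_bilin (Ψ.form y) hf1 hh1
  refine ⟨h1, fun u => ?_⟩
  have h3 := h2 u
  rw [hf2, hh2] at h3
  exact h3

theorem SmoothFamily.dirDeriv_fbr {f h : W × N → ℝ} (hf : SmoothFamily n f)
    (hh : SmoothFamily n h) (u : W) (z : W × N) :
    dirDeriv u (Ψ.fbr f h) z =
      Ψ.fbr (dirDeriv u f) h z + Ψ.fbr f (dirDeriv u h) z :=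
  (hf.hasFDerivAt_fbr Ψ hh z.1 z.2).2 u

/-- The fiberwise bracket of smooth families is smooth. -/
theorem SmoothFamily.smooth_fbr [T2Space N] {f h : W × N → ℝ} (hf : SmoothFamily n f)
    (hh : SmoothFamily n h) : SmoothFamily n (Ψ.fbr f h) := by
  rintro ⟨w₀, y₀⟩
  obtain ⟨η, hη, -, hloc⟩ := exists_global_coordinates (n := n) y₀
  set χ := extChartAt (𝓡 n) y₀ with hχ
  have hcoef : ∀ {f : W × N → ℝ}, SmoothFamily n f → ∀ i : Fin n,
      ContMDiffAt (𝓘(ℝ, W).prod (𝓡 n)) 𝓘(ℝ, ℝ) ∞ (fun z : W × N =>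
        fderiv ℝ ((fun y => f (z.1, y)) ∘ χ.symm) (χ z.2) (EuclideanSpace.single i 1))
        (w₀, y₀) := by
    intro f hf i
    have h1 : ContMDiffAt (𝓘(ℝ, W).prod 𝓘(ℝ, EuclideanSpace ℝ (Fin n))) 𝓘(ℝ, ℝ) ∞
        (fun p : W × EuclideanSpace ℝ (Fin n) => f (p.1, χ.symm p.2)) (w₀, χ y₀) := by
      refine ContMDiffAt.comp (I' := 𝓘(ℝ, W).prod (𝓡 n)) _ (hf _) ?_
      exact contMDiffAt_fst.prodMk (ContMDiffAt.comp (w₀, χ y₀)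
        (contMDiffAt_extChartAt_symm_of_mem (mem_extChartAt_target y₀)) contMDiffAt_snd)
    have h2 := h1.partial_fderiv
    have h3 : ContMDiffAt (𝓘(ℝ, W).prod (𝓡 n)) 𝓘(ℝ, EuclideanSpace ℝ (Fin n) →L[ℝ] ℝ) ∞
        (fun z : W × N => fderiv ℝ (fun x => f (z.1, χ.symm x)) (χ z.2)) (w₀, y₀) :=
      ContMDiffAt.comp (I' := 𝓘(ℝ, W).prod 𝓘(ℝ, EuclideanSpace ℝ (Fin n))) (w₀, y₀)
        (f := fun z : W × N => (z.1, χ z.2)) h2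
        (contMDiffAt_fst.prodMk (ContMDiffAt.comp (w₀, y₀)
          (contMDiffAt_extChartAt_of_mem (mem_extChartAt_source y₀)) contMDiffAt_snd))
    exact h3.clm_apply contMDiffAt_const
  have hsm : ContMDiffAt (𝓘(ℝ, W).prod (𝓡 n)) 𝓘(ℝ, ℝ) ∞ (fun z : W × N =>
      ∑ i, ∑ j, fderiv ℝ ((fun y => f (z.1, y)) ∘ χ.symm) (χ z.2) (EuclideanSpace.single i 1) *
        fderiv ℝ ((fun y => h (z.1, y)) ∘ χ.symm) (χ z.2) (EuclideanSpace.single j 1) *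
          Ψ.br (η i) (η j) z.2) (w₀, y₀) := by
    refine contMDiffAt_finsetSum fun i _ => contMDiffAt_finsetSum fun j _ => ?_
    exact ((hcoef hf i).mul (hcoef hh j)).mul
      ((Ψ.contMDiff_br (hη i) (hη j)).comp contMDiff_snd _)
  refine hsm.congr_of_eventuallyEq ?_
  have hloc' : ∀ᶠ z : W × N in 𝓝 (w₀, y₀), _ := (continuous_snd.tendsto (w₀, y₀)).eventually hloc
  filter_upwards [hloc'] with z hz
  simp only [PoissonTensor.fbr, PoissonTensor.br]
  rw [hz.2 _ (hf.slice_mdifferentiableAt z.1 z.2), hz.2 _ (hh.slice_mdifferentiableAt z.1 z.2)]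
  exact bilin_sum_smul (Ψ.form z.2) _ _ _

end Families

section ParametricIntegrals

variable {T : Type*} [MeasurableSpace T] {X : Type*} [TopologicalSpace X]

/-- A bounded weight `c` and an almost everywhere compactly valued map `ξ` on a measure space, both
measurable. -/
structure IsCompactWeight (ν : Measure T) (ξ : T → X) (c : T → ℝ) : Prop where
  aesm_map : AEStronglyMeasurable ξ ν
  aesm_weight : AEStronglyMeasurable c ν
  bounded : ∃ B : ℝ, ∀ᵐ τ ∂ν, ‖c τ‖ ≤ B
  compact : ∃ K : Set X, IsCompact K ∧ ∀ᵐ τ ∂ν, ξ τ ∈ K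

variable {ν : Measure T} [IsFiniteMeasure ν] {ξ : T → X} {c : T → ℝ}

theorem IsCompactWeight.integrable (h : IsCompactWeight ν ξ c) {F : Type*} [NormedAddCommGroup F]
    [NormedSpace ℝ F] {f : X → F} (hf : Continuous f) : Integrable (fun τ => c τ • f (ξ τ)) ν := by
  obtain ⟨B, hB⟩ := h.bounded
  obtain ⟨K, hK, hKξ⟩ := h.compact
  obtain ⟨D, hD⟩ := hK.exists_bound_of_continuousOn hf.continuousOn
  refine Integrable.of_bound (h.aesm_weight.smul (hf.comp_aestronglyMeasurable h.aesm_map))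
    (B * D) ?_
  filter_upwards [hB, hKξ] with τ h1 h2
  rw [norm_smul]
  exact mul_le_mul h1 (hD _ h2) (norm_nonneg _) ((norm_nonneg _).trans h1)

variable {E₀ : Type*} [NormedAddCommGroup E₀] [NormedSpace ℝ E₀] {H₀ : Type*} [TopologicalSpace H₀]
  {I₀ : ModelWithCorners ℝ E₀ H₀} [ChartedSpace H₀ X] [IsManifold I₀ ∞ X]

omit [IsFiniteMeasure ν] [IsManifold I₀ ∞ X] in
theorem continuous_of_contMDiffAt_slice {E F : Type*} [NormedAddCommGroup E] [NormedSpace ℝ E]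
    [NormedAddCommGroup F] [NormedSpace ℝ F] {f : X × E → F} {e : E}
    (hf : ∀ x, ContMDiffAt (I₀.prod 𝓘(ℝ, E)) 𝓘(ℝ, F) ∞ f (x, e)) :
    Continuous fun x => f (x, e) := by
  rw [continuous_iff_continuousAt]
  intro x
  exact (hf x).continuousAt.comp (f := fun x => (x, e)) (by fun_prop)

theorem IsCompactWeight.hasFDerivAt (h : IsCompactWeight ν ξ c) {E F : Type*}
    [NormedAddCommGroup E] [NormedSpace ℝ E] [FiniteDimensional ℝ E] [NormedAddCommGroup F]
    [NormedSpace ℝ F] {f : X × E → F} {V : Set E} (hV : IsOpen V)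
    (hf : ∀ x, ∀ e ∈ V, ContMDiffAt (I₀.prod 𝓘(ℝ, E)) 𝓘(ℝ, F) ∞ f (x, e)) {e : E} (he : e ∈ V) :
    HasFDerivAt (fun e => ∫ τ, c τ • f (ξ τ, e) ∂ν)
      (∫ τ, c τ • fderiv ℝ (fun e => f (ξ τ, e)) e ∂ν) e := by
  have := FiniteDimensional.proper_real E
  obtain ⟨B, hB⟩ := h.bounded
  obtain ⟨K, hK, hKξ⟩ := h.compact
  obtain ⟨ε, hε, hεV⟩ := Metric.nhds_basis_closedBall.mem_iff.1 (hV.mem_nhds he)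
  have hd : ∀ x, ∀ e ∈ V, ContMDiffAt (I₀.prod 𝓘(ℝ, E)) 𝓘(ℝ, E →L[ℝ] F) ∞
      (fun z : X × E => fderiv ℝ (fun e => f (z.1, e)) z.2) (x, e) := fun x e he =>
    (hf x e he).partial_fderiv
  have hc : ContinuousOn (fun z : X × E => fderiv ℝ (fun e => f (z.1, e)) z.2)
      (K ×ˢ Metric.closedBall e ε) := fun z hz =>
    (hd z.1 z.2 (hεV hz.2)).continuousAt.continuousWithinAt
  obtain ⟨D, hD⟩ := (hK.prod (isCompact_closedBall e ε)).exists_bound_of_continuousOn hc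
  have hdiff : ∀ x, ∀ e ∈ V, DifferentiableAt ℝ (fun e => f (x, e)) e := by
    intro x e he
    have h1 : ContMDiffAt 𝓘(ℝ, E) 𝓘(ℝ, F) ∞ (fun e => f (x, e)) e :=
      ContMDiffAt.comp (I' := I₀.prod 𝓘(ℝ, E)) e (hf x e he)
        (contMDiffAt_const.prodMk contMDiffAt_id)
    exact h1.contDiffAt.differentiableAt (by simp)
  refine (hasFDerivAt_integral_of_dominated_of_fderiv_le
    (F' := fun e τ => c τ • fderiv ℝ (fun e => f (ξ τ, e)) e) (bound := fun _ => B * D)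
    (Metric.ball_mem_nhds e hε) ?_ ?_ ?_ ?_ (integrable_const _) ?_)
  · filter_upwards [hV.mem_nhds he] with e' he'
    exact (h.integrable (continuous_of_contMDiffAt_slice fun x => hf x e' he')).aestronglyMeasurable
  · exact h.integrable (continuous_of_contMDiffAt_slice fun x => hf x e he)
  · exact (h.integrable (continuous_of_contMDiffAt_slice fun x => hd x e he)).aestronglyMeasurable
  · filter_upwards [hB, hKξ] with τ h1 h2 e' he'
    rw [norm_smul]
    exact mul_le_mul h1 (hD (ξ τ, e') ⟨h2, Metric.ball_subset_closedBall he'⟩) (norm_nonneg _)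
      ((norm_nonneg _).trans h1)
  · refine Filter.Eventually.of_forall fun τ e' he' => ?_
    exact ((hdiff (ξ τ) e' (hεV (Metric.ball_subset_closedBall he'))).hasFDerivAt).const_smul (c τ)

theorem IsCompactWeight.contDiffOn (h : IsCompactWeight ν ξ c) {E F : Type}
    [NormedAddCommGroup E] [NormedSpace ℝ E] [FiniteDimensional ℝ E] [NormedAddCommGroup F]
    [NormedSpace ℝ F] {f : X × E → F} {V : Set E} (hV : IsOpen V)
    (hf : ∀ x, ∀ e ∈ V, ContMDiffAt (I₀.prod 𝓘(ℝ, E)) 𝓘(ℝ, F) ∞ f (x, e)) :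
    ContDiffOn ℝ ∞ (fun e => ∫ τ, c τ • f (ξ τ, e) ∂ν) V := by
  rw [contDiffOn_infty]
  intro k
  induction k generalizing F with
  | zero =>
    exact contDiffOn_zero.2 fun e he => (h.hasFDerivAt hV hf he).continuousAt.continuousWithinAt
  | succ k ih =>
    rw [Nat.cast_succ, contDiffOn_succ_iff_fderiv_of_isOpen hV]
    refine ⟨fun e he => (h.hasFDerivAt hV hf he).differentiableAt.differentiableWithinAt,
      by simp, ?_⟩
    exact (ih (fun x e he => (hf x e he).partial_fderiv)).congr fun e he =>
      (h.hasFDerivAt hV hf he).fderiv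

variable {E : Type} [NormedAddCommGroup E] [NormedSpace ℝ E] [FiniteDimensional ℝ E]
  {H : Type*} [TopologicalSpace H] {I : ModelWithCorners ℝ E H} [I.Boundaryless]
  {Z : Type*} [TopologicalSpace Z] [ChartedSpace H Z] [IsManifold I ∞ Z]
  {f : X × Z → ℝ}

omit [IsFiniteMeasure ν] [IsManifold I₀ ∞ X] [FiniteDimensional ℝ E] in
theorem contMDiffAt_chart_param (hf : ContMDiff (I₀.prod I) 𝓘(ℝ, ℝ) ∞ f) (z₀ : Z) (x : X) {e : E}
    (he : e ∈ (extChartAt I z₀).target) :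
    ContMDiffAt (I₀.prod 𝓘(ℝ, E)) 𝓘(ℝ, ℝ) ∞
      (fun p : X × E => f (p.1, (extChartAt I z₀).symm p.2)) (x, e) := by
  refine ContMDiffAt.comp (I' := I₀.prod I) _ (hf _) ?_
  refine contMDiffAt_fst.prodMk (ContMDiffAt.comp (x, e) (I' := 𝓘(ℝ, E)) ?_ contMDiffAt_snd)
  exact (contMDiffOn_extChartAt_symm (n := ∞) z₀).contMDiffAt
    ((isOpen_extChartAt_target z₀).mem_nhds he)

theorem IsCompactWeight.contMDiff (h : IsCompactWeight ν ξ c)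
    (hf : ContMDiff (I₀.prod I) 𝓘(ℝ, ℝ) ∞ f) :
    ContMDiff I 𝓘(ℝ, ℝ) ∞ (fun z => ∫ τ, c τ * f (ξ τ, z) ∂ν) := by
  intro z₀
  have h1 := h.contDiffOn (isOpen_extChartAt_target (I := I) z₀)
    fun x e he => contMDiffAt_chart_param hf z₀ x he
  have h2 : ContMDiffAt 𝓘(ℝ, E) 𝓘(ℝ, ℝ) ∞ _ (extChartAt I z₀ z₀) :=
    (h1.contDiffAt ((isOpen_extChartAt_target (I := I) z₀).mem_nhds
      (mem_extChartAt_target z₀))).contMDiffAt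
  refine (ContMDiffAt.comp z₀ h2 contMDiffAt_extChartAt).congr_of_eventuallyEq ?_
  filter_upwards [extChartAt_source_mem_nhds (I := I) z₀] with z hz
  simp only [Function.comp_apply, (extChartAt I z₀).left_inv hz, smul_eq_mul]

theorem IsCompactWeight.mvfderiv_eq (h : IsCompactWeight ν ξ c)
    (hf : ContMDiff (I₀.prod I) 𝓘(ℝ, ℝ) ∞ f) (z₀ : Z) (v : E) :
    mvfderiv I (fun z => ∫ τ, c τ * f (ξ τ, z) ∂ν) z₀ v =
      ∫ τ, c τ * mvfderiv I (fun z => f (ξ τ, z)) z₀ v ∂ν ∧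
    Integrable (fun τ => c τ * mvfderiv I (fun z => f (ξ τ, z)) z₀ v) ν := by
  set χ := extChartAt I z₀ with hχ
  have hsl : ∀ x, MDifferentiableAt I 𝓘(ℝ, ℝ) (fun z => f (x, z)) z₀ := fun x =>
    (hf.comp (contMDiff_const.prodMk contMDiff_id)).mdifferentiable (by simp) z₀
  have hg := fun x e (he : e ∈ χ.target) => contMDiffAt_chart_param hf z₀ x he
  have h1 := h.hasFDerivAt (isOpen_extChartAt_target (I := I) z₀) hg (mem_extChartAt_target z₀)
  have hint : Integrable (fun τ => c τ • fderiv ℝ (fun e => f (ξ τ, χ.symm e)) (χ z₀)) ν :=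
    h.integrable (continuous_of_contMDiffAt_slice fun x =>
      (hg x _ (mem_extChartAt_target z₀)).partial_fderiv)
  have h2 : ∀ x, ∀ v : E, fderiv ℝ (fun e => f (x, χ.symm e)) (χ z₀) v =
      mvfderiv I (fun z => f (x, z)) z₀ v := by
    intro x v
    rw [(hsl x).mvfderiv, I.range_eq_univ, fderivWithin_univ]
    rfl
  have h3 : mvfderiv I (fun z => ∫ τ, c τ * f (ξ τ, z) ∂ν) z₀ v =
      (∫ τ, c τ • fderiv ℝ (fun e => f (ξ τ, χ.symm e)) (χ z₀) ∂ν) v := by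
    rw [((h.contMDiff hf).mdifferentiable (by simp) z₀).mvfderiv, I.range_eq_univ,
      fderivWithin_univ]
    exact congrArg (fun L : E →L[ℝ] ℝ => L v) h1.fderiv
  refine ⟨?_, ?_⟩
  · rw [h3]
    refine (ContinuousLinearMap.integral_apply hint v).trans ?_
    exact integral_congr_ae (Filter.Eventually.of_forall fun τ => congrArg (c τ * ·) (h2 (ξ τ) v))
  · refine (hint.apply_continuousLinearMap v).congr ?_
    exact Filter.Eventually.of_forall fun τ => congrArg (c τ * ·) (h2 (ξ τ) v)

end ParametricIntegrals

section TimeDependent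

variable {W : Type} [NormedAddCommGroup W] [NormedSpace ℝ W]
  {n : ℕ} {N : Type*} [TopologicalSpace N] [ChartedSpace (EuclideanSpace ℝ (Fin n)) N]

theorem hasDerivAt_diagonal {h : ℝ × ℝ → ℝ} {t a b : ℝ} (hd : DifferentiableAt ℝ h (t, t))
    (ha : HasDerivAt (fun s => h (s, t)) a t) (hb : HasDerivAt (fun s => h (t, s)) b t) :
    HasDerivAt (fun s => h (s, s)) (a + b) t := by
  have h1 := HasFDerivAt.comp_hasDerivAt t (f := fun s => (s, t)) hd.hasFDerivAt
    ((hasDerivAt_id t).prodMk (hasDerivAt_const t t))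
  have h2 := HasFDerivAt.comp_hasDerivAt t (f := fun s => (t, s)) hd.hasFDerivAt
    ((hasDerivAt_const t t).prodMk (hasDerivAt_id t))
  have h3 := HasFDerivAt.comp_hasDerivAt t (f := fun s => (s, s)) hd.hasFDerivAt
    ((hasDerivAt_id t).prodMk (hasDerivAt_id t))
  have e1 := ha.unique h1
  have e2 := hb.unique h2
  rw [e1, e2, ← map_add]
  simp only [Prod.mk_add_mk, add_zero, zero_add]
  exact h3

theorem SmoothFamily.hasDerivAt_time {g : (ℝ × W) × N → ℝ} (hg : SmoothFamily n g) (t : ℝ) (w : W)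
    (y : N) : HasDerivAt (fun t => g ((t, w), y)) (dirDeriv (1, 0) g ((t, w), y)) t := by
  have h := HasFDerivAt.comp_hasDerivAt t (f := fun t => (t, w))
    (hg.differentiableAt (t, w) y).hasFDerivAt ((hasDerivAt_id t).prodMk (hasDerivAt_const t w))
  exact h

theorem SmoothFamily.freeze_time {g : (ℝ × W) × N → ℝ} (hg : SmoothFamily n g) (t : ℝ) :
    SmoothFamily n (fun z : W × N => g ((t, z.1), z.2)) := by
  refine ContMDiff.comp (I' := 𝓘(ℝ, ℝ × W).prod (𝓡 n)) hg ?_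
  have h1 : ContMDiff 𝓘(ℝ, W) 𝓘(ℝ, ℝ × W) ∞ (fun w : W => (t, w)) :=
    (contDiff_const.prodMk contDiff_id).contMDiff
  exact (h1.comp contMDiff_fst).prodMk contMDiff_snd

theorem SmoothFamily.comp_snd {f : W × N → ℝ} (hf : SmoothFamily n f) :
    SmoothFamily n (fun z : (ℝ × W) × N => f (z.1.2, z.2)) := by
  refine ContMDiff.comp (I' := 𝓘(ℝ, W).prod (𝓡 n)) hf ?_
  have h1 : ContMDiff 𝓘(ℝ, ℝ × W) 𝓘(ℝ, W) ∞ (fun w : ℝ × W => w.2) := contDiff_snd.contMDiff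
  exact (h1.comp contMDiff_fst).prodMk contMDiff_snd

theorem SmoothFamily.of_function {f : N → ℝ} (hf : ContMDiff (𝓡 n) 𝓘(ℝ, ℝ) ∞ f) :
    SmoothFamily n (fun z : W × N => f z.2) :=
  hf.comp contMDiff_snd

theorem SmoothFamily.dirDeriv_freeze {g : (ℝ × W) × N → ℝ} (hg : SmoothFamily n g) (t : ℝ) (u w : W)
    (y : N) : dirDeriv u (fun z : W × N => g ((t, z.1), z.2)) (w, y) =
      dirDeriv (0, u) g ((t, w), y) := by
  have h := HasFDerivAt.comp w (f := fun w => (t, w)) (hg.differentiableAt (t, w) y).hasFDerivAt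
    (hasFDerivAt_prodMk_right t w)
  exact congrArg (fun L : W →L[ℝ] ℝ => L u) h.fderiv

theorem SmoothFamily.dirDeriv_comp_snd {f : W × N → ℝ} (hf : SmoothFamily n f) (r : ℝ) (u : W)
    (z : (ℝ × W) × N) : dirDeriv (r, u) (fun z : (ℝ × W) × N => f (z.1.2, z.2)) z =
      dirDeriv u f (z.1.2, z.2) := by
  have h := HasFDerivAt.comp z.1 (hf.differentiableAt z.1.2 z.2).hasFDerivAt
    (hasFDerivAt_snd (𝕜 := ℝ) (E := ℝ) (F := W) (p := z.1))
  exact congrArg (fun L : ℝ × W →L[ℝ] ℝ => L (r, u)) h.fderiv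

theorem SmoothFamily.dirDeriv_sub {f g : W × N → ℝ} (hf : SmoothFamily n f) (hg : SmoothFamily n g)
    (u : W) (z : W × N) : dirDeriv u (fun z => f z - g z) z =
      dirDeriv u f z - dirDeriv u g z := by
  have := ((hf.differentiableAt z.1 z.2).hasFDerivAt.sub
    (hg.differentiableAt z.1 z.2).hasFDerivAt).fderiv
  exact congrArg (fun L : W →L[ℝ] ℝ => L u) this

theorem SmoothFamily.dirDeriv_add {f g : W × N → ℝ} (hf : SmoothFamily n f) (hg : SmoothFamily n g)
    (u : W) (z : W × N) : dirDeriv u (fun z => f z + g z) z =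
      dirDeriv u f z + dirDeriv u g z := by
  have := ((hf.differentiableAt z.1 z.2).hasFDerivAt.add
    (hg.differentiableAt z.1 z.2).hasFDerivAt).fderiv
  exact congrArg (fun L : W →L[ℝ] ℝ => L u) this

theorem SmoothFamily.sub {f g : W × N → ℝ} (hf : SmoothFamily n f) (hg : SmoothFamily n g) :
    SmoothFamily n (fun z => f z - g z) := ContMDiff.sub hf hg

theorem SmoothFamily.add {f g : W × N → ℝ} (hf : SmoothFamily n f) (hg : SmoothFamily n g) :
    SmoothFamily n (fun z => f z + g z) := ContMDiff.add hf hg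

end TimeDependent

section Flows

variable {n : ℕ} {N : Type*} [TopologicalSpace N] [ChartedSpace (EuclideanSpace ℝ (Fin n)) N]

/-- A family, parametrized by a vector space `W`, of Hamiltonian flows on the Poisson manifold `N`. -/
structure HamiltonianFlow (Ψ : PoissonTensor (𝓡 n) N) (W : Type) [NormedAddCommGroup W]
    [NormedSpace ℝ W] where
  flow : ℝ → W → N → N
  ham : W × N → ℝ
  smooth : ContMDiff (𝓘(ℝ, ℝ × W).prod (𝓡 n)) (𝓡 n) ∞
    (fun z : (ℝ × W) × N => flow z.1.1 z.1.2 z.2)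
  smooth_ham : SmoothFamily n ham
  flow_zero : ∀ w y, flow 0 w y = y
  flow_add : ∀ s t w y, flow (s + t) w y = flow s w (flow t w y)
  generator : ∀ (w : W) (y : N) (f : N → ℝ), ContMDiff (𝓡 n) 𝓘(ℝ, ℝ) ∞ f →
    HasDerivAt (fun t => f (flow t w y)) (Ψ.br (fun y => ham (w, y)) f y) 0

namespace HamiltonianFlow

variable {Ψ : PoissonTensor (𝓡 n) N} {W : Type} [NormedAddCommGroup W] [NormedSpace ℝ W]
  (F : HamiltonianFlow Ψ W)

/-- The pullback of a family of functions under a family of flows, as a time-dependent family. -/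
def pull (f : W × N → ℝ) (z : (ℝ × W) × N) : ℝ := f (z.1.2, F.flow z.1.1 z.1.2 z.2)

theorem smooth_pull {f : W × N → ℝ} (hf : SmoothFamily n f) : SmoothFamily n (F.pull f) := by
  refine ContMDiff.comp (I' := 𝓘(ℝ, W).prod (𝓡 n)) hf ?_
  have h1 : ContMDiff 𝓘(ℝ, ℝ × W) 𝓘(ℝ, W) ∞ (fun w : ℝ × W => w.2) := contDiff_snd.contMDiff
  exact (h1.comp contMDiff_fst).prodMk F.smooth

theorem smooth_orbit (w : W) (y : N) :
    ContMDiff 𝓘(ℝ, ℝ) (𝓡 n) ∞ (fun t => F.flow t w y) := by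
  have h1 : ContMDiff 𝓘(ℝ, ℝ) 𝓘(ℝ, ℝ × W) ∞ (fun t : ℝ => (t, w)) :=
    (contDiff_id.prodMk contDiff_const).contMDiff
  exact ContMDiff.comp (I' := 𝓘(ℝ, ℝ × W).prod (𝓡 n)) F.smooth (h1.prodMk contMDiff_const)

theorem smooth_flow (t : ℝ) (w : W) : ContMDiff (𝓡 n) (𝓡 n) ∞ (F.flow t w) :=
  ContMDiff.comp (I' := 𝓘(ℝ, ℝ × W).prod (𝓡 n)) F.smooth (contMDiff_const.prodMk contMDiff_id)
    (f := fun y => ((t, w), y))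

theorem hasDerivAt_flow {f : N → ℝ} (hf : ContMDiff (𝓡 n) 𝓘(ℝ, ℝ) ∞ f) (t : ℝ) (w : W) (y : N) :
    HasDerivAt (fun t => f (F.flow t w y)) (Ψ.br (fun y => F.ham (w, y)) f (F.flow t w y)) t := by
  have h1 := F.generator w (F.flow t w y) f hf
  have h2 := HasDerivAt.comp_sub_const (f := fun s => f (F.flow s w (F.flow t w y))) t t
    (by simpa using h1)
  refine h2.congr_of_eventuallyEq (Filter.Eventually.of_forall fun s => ?_)
  simp only [← F.flow_add, sub_add_cancel]

theorem hasDerivAt_flow' {f : N → ℝ} (hf : ContMDiff (𝓡 n) 𝓘(ℝ, ℝ) ∞ f) (t : ℝ) (w : W) (y : N) :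
    HasDerivAt (fun t => f (F.flow t w y))
      (Ψ.br (fun y => F.ham (w, y)) (fun y => f (F.flow t w y)) y) t := by
  have h1 := F.generator w y (fun y => f (F.flow t w y)) (hf.comp (F.smooth_flow t w))
  have h2 := HasDerivAt.comp_sub_const (f := fun s => f (F.flow t w (F.flow s w y))) t t
    (by simpa using h1)
  refine h2.congr_of_eventuallyEq (Filter.Eventually.of_forall fun s => ?_)
  simp only [← F.flow_add, add_sub_cancel]

theorem dirDeriv_time_pull {f : W × N → ℝ} (hf : SmoothFamily n f) (z : (ℝ × W) × N) :
    dirDeriv (1, 0) (F.pull f) z =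
      Ψ.fbr (fun z : (ℝ × W) × N => F.ham (z.1.2, z.2)) (F.pull f) z :=
  ((F.smooth_pull hf).hasDerivAt_time z.1.1 z.1.2 z.2).unique
    (F.hasDerivAt_flow' (hf.slice z.1.2) z.1.1 z.1.2 z.2)

/-- Differentiation of a time-dependent function along an orbit. -/
theorem hasDerivAt_along {g : (ℝ × W) × N → ℝ} (hg : SmoothFamily n g) (a b : ℝ) (w : W) (y : N)
    (t : ℝ) (c : ℝ) :
    HasDerivAt (fun s => g ((a + c * s, w), F.flow (b - c * s) w y))
      (c * (dirDeriv (1, 0) g ((a + c * t, w), F.flow (b - c * t) w y) -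
        Ψ.br (fun y => F.ham (w, y)) (fun y => g ((a + c * t, w), y)) (F.flow (b - c * t) w y)))
      t := by
  set h : ℝ × ℝ → ℝ := fun p => g ((a + c * p.1, w), F.flow (b - c * p.2) w y) with hh
  have hs : ContDiff ℝ ∞ h := by
    rw [← contMDiff_iff_contDiff]
    refine ContMDiff.comp (I' := 𝓘(ℝ, ℝ × W).prod (𝓡 n)) hg (ContMDiff.prodMk ?_ ?_)
    · exact ContDiff.contMDiff (by fun_prop)
    · exact (F.smooth_orbit w y).comp (ContDiff.contMDiff (by fun_prop))
  have h1 : HasDerivAt (fun s => h (s, t))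
      (c * dirDeriv (1, 0) g ((a + c * t, w), F.flow (b - c * t) w y)) t := by
    have h2 : HasDerivAt (fun s : ℝ => a + c * s) c t := by
      simpa using ((hasDerivAt_id t).const_mul c).const_add a
    have := HasDerivAt.comp t (hg.hasDerivAt_time (a + c * t) w (F.flow (b - c * t) w y)) h2
    rw [mul_comm]
    exact this
  have h2 : HasDerivAt (fun s => h (t, s)) (-(c * Ψ.br (fun y => F.ham (w, y))
      (fun y => g ((a + c * t, w), y)) (F.flow (b - c * t) w y))) t := by
    have h2 : HasDerivAt (fun s : ℝ => b - c * s) (-c) t := by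
      simpa using ((hasDerivAt_id t).const_mul c).const_sub b
    have := HasDerivAt.comp t (F.hasDerivAt_flow (hg.slice (a + c * t, w)) (b - c * t) w y) h2
    rw [← mul_neg_one, mul_comm c, mul_assoc, mul_neg_one]
    exact this
  have h3 := hasDerivAt_diagonal (hs.differentiable (by simp) _) h1 h2
  rw [← sub_eq_add_neg, ← mul_sub] at h3
  exact h3

variable [IsManifold (𝓡 n) ∞ N] [T2Space N]

/-- Hamiltonian flows preserve the Poisson bracket. -/
theorem br_comp_flow {f h : N → ℝ} (hf : ContMDiff (𝓡 n) 𝓘(ℝ, ℝ) ∞ f)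
    (hh : ContMDiff (𝓡 n) 𝓘(ℝ, ℝ) ∞ h) (t : ℝ) (w : W) (y : N) :
    Ψ.br (fun y => f (F.flow t w y)) (fun y => h (F.flow t w y)) y =
      Ψ.br f h (F.flow t w y) := by
  have hf' := SmoothFamily.of_function (W := W) hf
  have hh' := SmoothFamily.of_function (W := W) hh
  set P := F.pull (fun z => f z.2)
  set R := F.pull (fun z => h z.2)
  have hP : SmoothFamily n P := F.smooth_pull hf'
  have hR : SmoothFamily n R := F.smooth_pull hh'
  have hg := hP.smooth_fbr Ψ hR
  have hd : ∀ s, HasDerivAt (fun s => Ψ.fbr P R ((0 + 1 * s, w), F.flow (t - 1 * s) w y)) 0 s := by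
    intro s
    have h1 := F.hasDerivAt_along hg 0 t w y s 1
    rw [hP.dirDeriv_fbr Ψ hR] at h1
    set z : (ℝ × W) × N := ((0 + 1 * s, w), F.flow (t - 1 * s) w y)
    have h2 := Ψ.br_br (F.smooth_ham.slice w) (hP.slice z.1) (hR.slice z.1) z.2
    have h3 : Ψ.fbr (dirDeriv (1, 0) P) R z =
        Ψ.br (Ψ.br (fun y => F.ham (w, y)) fun y => P (z.1, y)) (fun y => R (z.1, y)) z.2 := by
      have : dirDeriv (1, 0) P = _ := funext (F.dirDeriv_time_pull hf')
      rw [this]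
      rfl
    have h4 : Ψ.fbr P (dirDeriv (1, 0) R) z =
        Ψ.br (fun y => P (z.1, y)) (Ψ.br (fun y => F.ham (w, y)) fun y => R (z.1, y)) z.2 := by
      have : dirDeriv (1, 0) R = _ := funext (F.dirDeriv_time_pull hh')
      rw [this]
      rfl
    convert h1 using 1
    rw [h3, h4, ← h2]
    exact (mul_eq_zero_of_right _ (sub_self _)).symm
  have hconst := is_const_of_deriv_eq_zero (fun s => (hd s).differentiableAt)
    (fun s => (hd s).deriv) t 0
  simp only [zero_add, one_mul, sub_self, F.flow_zero, sub_zero, mul_zero] at hconst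
  refine hconst.trans ?_
  simp only [PoissonTensor.fbr, P, R, pull, F.flow_zero]

end HamiltonianFlow

end Flows

section Flows

variable {n : ℕ} {N : Type*} [TopologicalSpace N] [ChartedSpace (EuclideanSpace ℝ (Fin n)) N]

theorem PoissonTensor.br_const_right (Ψ : PoissonTensor (𝓡 n) N) (f : N → ℝ) (c : ℝ) (y : N) :
    Ψ.br f (fun _ => c) y = 0 := by
  have : dN n (fun _ : N => c) y = 0 := mvfderiv_const c
  rw [PoissonTensor.br, this, map_zero]

namespace HamiltonianFlow

variable {Ψ : PoissonTensor (𝓡 n) N} {W : Type} [NormedAddCommGroup W] [NormedSpace ℝ W]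
  (F : HamiltonianFlow Ψ W)

/-- The time-dependent Hamiltonian `∫₀ᵗ (∂_u J)(φ_s) ds` of the derivative of the flow in the
direction `u` of the parameter space. -/
def potential (u : W) (z : (ℝ × W) × N) : ℝ :=
  ∫ s in (0 : ℝ)..z.1.1, F.pull (dirDeriv u F.ham) ((s, z.1.2), z.2)

theorem potential_zero (u w : W) (y : N) : F.potential u ((0, w), y) = 0 := by
  simp [potential]

variable [IsManifold (𝓡 n) ∞ N]

theorem smooth_potential [FiniteDimensional ℝ W] (u : W) : SmoothFamily n (F.potential u) := by
  set k := F.pull (dirDeriv u F.ham)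
  have hk : SmoothFamily n k := F.smooth_pull (F.smooth_ham.smooth_dirDeriv u)
  have hw : IsCompactWeight (volume.restrict (Set.Ioc (0 : ℝ) 1)) (fun s : ℝ => s)
      (fun _ => (1 : ℝ)) := by
    refine ⟨continuous_id.aestronglyMeasurable, aestronglyMeasurable_const, ⟨1, by simp⟩,
      ⟨Set.Icc 0 1, isCompact_Icc, ?_⟩⟩
    filter_upwards [ae_restrict_mem measurableSet_Ioc] with s hs
    exact Set.Ioc_subset_Icc_self hs
  have hf : ContMDiff (𝓘(ℝ, ℝ).prod (𝓘(ℝ, ℝ × W).prod (𝓡 n))) 𝓘(ℝ, ℝ) ∞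
      (fun p : ℝ × ((ℝ × W) × N) => p.2.1.1 * k ((p.1 * p.2.1.1, p.2.1.2), p.2.2)) := by
    have h1 : ContMDiff (𝓘(ℝ, ℝ).prod (𝓘(ℝ, ℝ × W).prod (𝓡 n))) 𝓘(ℝ, ℝ × W) ∞
        (fun p : ℝ × ((ℝ × W) × N) => p.2.1) := contMDiff_fst.comp contMDiff_snd
    have h2 : ContMDiff (𝓘(ℝ, ℝ).prod (𝓘(ℝ, ℝ × W).prod (𝓡 n))) 𝓘(ℝ, ℝ) ∞
        (fun p : ℝ × ((ℝ × W) × N) => p.2.1.1) :=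
      (contDiff_fst.contMDiff : ContMDiff 𝓘(ℝ, ℝ × W) 𝓘(ℝ, ℝ) ∞ Prod.fst).comp h1
    have h3 : ContMDiff (𝓘(ℝ, ℝ).prod (𝓘(ℝ, ℝ × W).prod (𝓡 n))) 𝓘(ℝ, W) ∞
        (fun p : ℝ × ((ℝ × W) × N) => p.2.1.2) :=
      (contDiff_snd.contMDiff : ContMDiff 𝓘(ℝ, ℝ × W) 𝓘(ℝ, W) ∞ Prod.snd).comp h1
    refine h2.mul (ContMDiff.comp (I' := 𝓘(ℝ, ℝ × W).prod (𝓡 n)) (g := k)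
      (f := fun p : ℝ × ((ℝ × W) × N) => ((p.1 * p.2.1.1, p.2.1.2), p.2.2)) hk ?_)
    exact ((contMDiff_fst.mul h2).prodMk_space h3).prodMk (contMDiff_snd.comp contMDiff_snd)
  have h := hw.contMDiff hf
  refine h.congr fun z => ?_
  have := intervalIntegral.mul_integral_comp_mul_right (a := 0) (b := 1)
    (f := fun s => k ((s, z.1.2), z.2)) z.1.1
  rw [zero_mul, one_mul] at this
  rw [potential, ← this, intervalIntegral.integral_of_le zero_le_one,
    ← MeasureTheory.integral_const_mul]
  simp only [one_mul]

theorem dirDeriv_time_potential [FiniteDimensional ℝ W] (u : W) (z : (ℝ × W) × N) :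
    dirDeriv (1, 0) (F.potential u) z = F.pull (dirDeriv u F.ham) z := by
  have hk : SmoothFamily n (F.pull (dirDeriv u F.ham)) :=
    F.smooth_pull (F.smooth_ham.smooth_dirDeriv u)
  have hc : Continuous fun s : ℝ => F.pull (dirDeriv u F.ham) ((s, z.1.2), z.2) :=
    hk.continuous.comp (by fun_prop)
  exact ((F.smooth_potential u).hasDerivAt_time z.1.1 z.1.2 z.2).unique
    (intervalIntegral.integral_hasDerivAt_right (hc.intervalIntegrable _ _)
      (hc.stronglyMeasurableAtFilter _ _) hc.continuousAt)

variable [T2Space N] [FiniteDimensional ℝ W]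

/-- The derivative of a pullback in the direction of the parameter space. -/
theorem dirDeriv_pull {f : W × N → ℝ} (hf : SmoothFamily n f) (u : W) (z : (ℝ × W) × N) :
    dirDeriv (0, u) (F.pull f) z =
      F.pull (dirDeriv u f) z + Ψ.fbr (F.potential u) (F.pull f) z := by
  obtain ⟨⟨t, w⟩, y⟩ := z
  set P := F.pull f with hPdef
  have hP : SmoothFamily n P := F.smooth_pull hf
  set hamT : (ℝ × W) × N → ℝ := fun z => F.ham (z.1.2, z.2)
  have hhamT : SmoothFamily n hamT := F.smooth_ham.comp_snd
  set Q : (ℝ × W) × N → ℝ := fun z => P ((t, z.1.2), z.2)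
  have hQ : SmoothFamily n Q := (hP.freeze_time t).comp_snd
  have hU := F.smooth_potential u
  have hH := hP.smooth_dirDeriv ((0, u) : ℝ × W)
  have hd1 : ∀ s, HasDerivAt (fun s => dirDeriv (0, u) P ((t + (-1) * s, w),
      F.flow (0 - (-1) * s) w y)) (-Ψ.fbr (F.pull (dirDeriv u F.ham)) Q ((s, w), y)) s := by
    intro s
    have h1 := F.hasDerivAt_along hH t 0 w y s (-1)
    convert h1 using 1
    rw [hP.dirDeriv_comm]
    have h2 : dirDeriv (1, 0) P = Ψ.fbr hamT P := funext (F.dirDeriv_time_pull hf)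
    rw [h2, hhamT.dirDeriv_fbr Ψ hP]
    have h3 : dirDeriv (0, u) hamT = fun z => dirDeriv u F.ham (z.1.2, z.2) :=
      funext fun z => F.smooth_ham.dirDeriv_comp_snd 0 u z
    have h4 := F.br_comp_flow ((F.smooth_ham.smooth_dirDeriv u).slice w)
      (hP.slice (t + -1 * s, w)) (0 - -1 * s) w y
    rw [h3]
    have h5 : Ψ.fbr (fun z => dirDeriv u F.ham (z.1.2, z.2)) P
        ((t + -1 * s, w), F.flow (0 - -1 * s) w y) =
        Ψ.fbr (F.pull (dirDeriv u F.ham)) Q ((s, w), y) := by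
      refine h4.symm.trans ?_
      have e1 : (0 : ℝ) - -1 * s = s := by ring
      have e2 : ∀ y, P ((t + -1 * s, w), F.flow s w y) = Q ((s, w), y) := by
        intro y
        simp only [Q, P, pull]
        rw [← F.flow_add]
        congr 3
        ring
      simp only [e1, e2]
      rfl
    rw [h5]
    have h6 : Ψ.fbr hamT (dirDeriv (0, u) P) ((t + -1 * s, w), F.flow (0 - -1 * s) w y) =
      Ψ.br (fun y => F.ham (w, y)) (fun y => dirDeriv (0, u) P ((t + -1 * s, w), y))
        (F.flow (0 - -1 * s) w y) := rfl
    rw [h6]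
    ring
  have hd2 : ∀ s, HasDerivAt (fun s => Ψ.fbr (F.potential u) Q ((s, w), y))
      (Ψ.fbr (F.pull (dirDeriv u F.ham)) Q ((s, w), y)) s := by
    intro s
    have h1 := (hU.smooth_fbr Ψ hQ).hasDerivAt_time s w y
    rw [hU.dirDeriv_fbr Ψ hQ] at h1
    have h2 : dirDeriv (1, 0) Q = fun _ => 0 := by
      funext z
      have := (hP.freeze_time t).dirDeriv_comp_snd 1 0 z
      refine this.trans ?_
      simp [dirDeriv]
    have h3 : dirDeriv (1, 0) (F.potential u) = F.pull (dirDeriv u F.ham) :=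
      funext (F.dirDeriv_time_potential u)
    have h4 : Ψ.fbr (F.potential u) (fun _ => 0) ((s, w), y) = 0 := Ψ.br_const_right _ 0 y
    rw [h2, h3, h4, add_zero] at h1
    exact h1
  have hd : ∀ s, HasDerivAt (fun s => dirDeriv (0, u) P ((t + (-1) * s, w),
      F.flow (0 - (-1) * s) w y) + Ψ.fbr (F.potential u) Q ((s, w), y)) 0 s := by
    intro s
    have := (hd1 s).add (hd2 s)
    rwa [neg_add_cancel] at this
  have hconst := is_const_of_deriv_eq_zero (fun s => (hd s).differentiableAt)
    (fun s => (hd s).deriv) 0 t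
  have e0 : Ψ.fbr (F.potential u) Q ((0, w), y) = 0 := by
    have : (fun y => F.potential u (((0 : ℝ), w), y)) = fun _ => 0 :=
      funext fun y => F.potential_zero u w y
    simp only [PoissonTensor.fbr, this]
    rw [Ψ.br_skew, Ψ.br_const_right, neg_zero]
  have e1 : dirDeriv (0, u) P ((0, w), F.flow t w y) = F.pull (dirDeriv u f) ((t, w), y) := by
    rw [← hP.dirDeriv_freeze]
    have : (fun z : W × N => P ((0, z.1), z.2)) = f := by
      funext z
      simp only [P, pull, F.flow_zero]
    rw [this]
    rfl
  simp only [e0, mul_zero, add_zero, sub_zero, F.flow_zero] at hconst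
  rw [hconst]
  have e2 : t + -1 * t = 0 := by ring
  have e3 : 0 - -1 * t = t := by ring
  rw [e2, e3, e1]
  rfl

/-- The zero curvature equation for the potentials of a family of Hamiltonian flows. -/
theorem zero_curvature (u v : W) (z : (ℝ × W) × N) :
    dirDeriv (0, u) (F.potential v) z - dirDeriv (0, v) (F.potential u) z =
      Ψ.fbr (F.potential u) (F.potential v) z := by
  obtain ⟨⟨t, w⟩, y⟩ := z
  have hU := fun u => F.smooth_potential u
  have hDU : ∀ u v, SmoothFamily n (dirDeriv ((0, u) : ℝ × W) (F.potential v)) := fun u v =>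
    (hU v).smooth_dirDeriv _
  have hB := (hU u).smooth_fbr Ψ (hU v)
  have htime : ∀ u, dirDeriv (1, 0) (F.potential u) = F.pull (dirDeriv u F.ham) := fun u =>
    funext (F.dirDeriv_time_potential u)
  have hDt : ∀ u v z, dirDeriv (1, 0) (dirDeriv ((0, u) : ℝ × W) (F.potential v)) z =
      F.pull (dirDeriv u (dirDeriv v F.ham)) z +
        Ψ.fbr (F.potential u) (F.pull (dirDeriv v F.ham)) z := by
    intro u v z
    rw [(hU v).dirDeriv_comm, htime, F.dirDeriv_pull (F.smooth_ham.smooth_dirDeriv v)]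
  have hd : ∀ t, HasDerivAt (fun t => (dirDeriv (0, u) (F.potential v) ((t, w), y) -
      dirDeriv (0, v) (F.potential u) ((t, w), y)) -
      Ψ.fbr (F.potential u) (F.potential v) ((t, w), y)) 0 t := by
    intro t
    have h1 := (((hDU u v).hasDerivAt_time t w y).sub ((hDU v u).hasDerivAt_time t w y)).sub
      (hB.hasDerivAt_time t w y)
    refine h1.congr_deriv ?_
    rw [hDt, hDt, (hU u).dirDeriv_fbr Ψ (hU v), htime, htime]
    have h2 : F.pull (dirDeriv u (dirDeriv v F.ham)) = F.pull (dirDeriv v (dirDeriv u F.ham)) := by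
      congr 1
      exact funext fun z => F.smooth_ham.dirDeriv_comm u v z
    have h3 : Ψ.fbr (F.potential v) (F.pull (dirDeriv u F.ham)) ((t, w), y) =
      - Ψ.fbr (F.pull (dirDeriv u F.ham)) (F.potential v) ((t, w), y) := Ψ.br_skew _ _ _
    rw [h2, h3]
    ring
  have hconst := is_const_of_deriv_eq_zero (fun s => (hd s).differentiableAt)
    (fun s => (hd s).deriv) t 0
  have h0 : ∀ u v, dirDeriv (0, u) (F.potential v) (((0 : ℝ), w), y) = 0 := by
    intro u v
    rw [← (hU v).dirDeriv_freeze]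
    simp only [potential_zero, dirDeriv]
    simp
  have h1 : Ψ.fbr (F.potential u) (F.potential v) (((0 : ℝ), w), y) = 0 := by
    simp only [PoissonTensor.fbr, potential_zero]
    exact Ψ.br_const_right _ _ _
  simp only [h0, h1] at hconst
  linarith

end HamiltonianFlow

end Flows

section Twists

variable {n : ℕ} {N : Type*} [TopologicalSpace N] [ChartedSpace (EuclideanSpace ℝ (Fin n)) N]
  {W : Type} [NormedAddCommGroup W] [NormedSpace ℝ W] {Ψ : PoissonTensor (𝓡 n) N}

theorem dN_add {f h : N → ℝ} {y : N} (hf : MDifferentiableAt (𝓡 n) 𝓘(ℝ, ℝ) f y)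
    (hh : MDifferentiableAt (𝓡 n) 𝓘(ℝ, ℝ) h y) :
    dN n (fun y => f y + h y) y = dN n f y + dN n h y :=
  (hf.hasMFDerivAt_dN.add hh.hasMFDerivAt_dN).dN_eq

theorem dN_sub {f h : N → ℝ} {y : N} (hf : MDifferentiableAt (𝓡 n) 𝓘(ℝ, ℝ) f y)
    (hh : MDifferentiableAt (𝓡 n) 𝓘(ℝ, ℝ) h y) :
    dN n (fun y => f y - h y) y = dN n f y - dN n h y :=
  (hf.hasMFDerivAt_dN.sub hh.hasMFDerivAt_dN).dN_eq

namespace PoissonTensor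

omit [NormedAddCommGroup W] [NormedSpace ℝ W] in
theorem fbr_skew (f h : W × N → ℝ) (z : W × N) : Ψ.fbr f h z = -Ψ.fbr h f z := Ψ.br_skew _ _ _

theorem fbr_add_right {f g : W × N → ℝ} (hf : SmoothFamily n f) (hg : SmoothFamily n g)
    (h : W × N → ℝ) (z : W × N) :
    Ψ.fbr h (fun z => f z + g z) z = Ψ.fbr h f z + Ψ.fbr h g z := by
  simp only [fbr, br, form_apply, dN_add (hf.slice_mdifferentiableAt z.1 z.2)
    (hg.slice_mdifferentiableAt z.1 z.2)]
  rfl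

theorem fbr_sub_right {f g : W × N → ℝ} (hf : SmoothFamily n f) (hg : SmoothFamily n g)
    (h : W × N → ℝ) (z : W × N) :
    Ψ.fbr h (fun z => f z - g z) z = Ψ.fbr h f z - Ψ.fbr h g z := by
  simp only [fbr, br, form_apply, dN_sub (hf.slice_mdifferentiableAt z.1 z.2)
    (hg.slice_mdifferentiableAt z.1 z.2)]
  rfl

theorem fbr_add_left {f g : W × N → ℝ} (hf : SmoothFamily n f) (hg : SmoothFamily n g)
    (h : W × N → ℝ) (z : W × N) :
    Ψ.fbr (fun z => f z + g z) h z = Ψ.fbr f h z + Ψ.fbr g h z := by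
  rw [fbr_skew, fbr_add_right hf hg, fbr_skew f h, fbr_skew g h]
  ring

theorem fbr_sub_left {f g : W × N → ℝ} (hf : SmoothFamily n f) (hg : SmoothFamily n g)
    (h : W × N → ℝ) (z : W × N) :
    Ψ.fbr (fun z => f z - g z) h z = Ψ.fbr f h z - Ψ.fbr g h z := by
  rw [fbr_skew, fbr_sub_right hf hg, fbr_skew f h, fbr_skew g h]
  ring

variable (Ψ) in
/-- Families of Casimir functions. -/
def IsCasimir (c : W × N → ℝ) : Prop :=
  ∀ (w : W) (y : N) (α : EuclideanSpace ℝ (Fin n) →L[ℝ] ℝ),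
    Ψ.form y α (dN n (fun y => c (w, y)) y) = 0

omit [NormedAddCommGroup W] [NormedSpace ℝ W] in
theorem IsCasimir.fbr_right {c : W × N → ℝ} (hc : Ψ.IsCasimir c) (f : W × N → ℝ) (z : W × N) :
    Ψ.fbr f c z = 0 := hc _ _ _

omit [NormedAddCommGroup W] [NormedSpace ℝ W] in
theorem IsCasimir.fbr_left {c : W × N → ℝ} (hc : Ψ.IsCasimir c) (f : W × N → ℝ) (z : W × N) :
    Ψ.fbr c f z = 0 := by
  rw [fbr_skew, hc.fbr_right, neg_zero]

end PoissonTensor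

/-- The pullback of a family of functions under a family of maps. -/
def fpull (φ : W → N → N) (f : W × N → ℝ) (z : W × N) : ℝ := f (z.1, φ z.1 z.2)

theorem SmoothFamily.smooth_fpull {φ : W → N → N}
    (hφ : ContMDiff (𝓘(ℝ, W).prod (𝓡 n)) (𝓡 n) ∞ (fun z : W × N => φ z.1 z.2))
    {f : W × N → ℝ} (hf : SmoothFamily n f) : SmoothFamily n (fpull φ f) :=
  ContMDiff.comp (I' := 𝓘(ℝ, W).prod (𝓡 n)) hf (contMDiff_fst.prodMk hφ)

/-- A family of Poisson maps `φ` whose derivatives in the directions `u` of the parameter space are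
Hamiltonian, with a flat family of potentials `U u`. -/
structure IsTwist (Ψ : PoissonTensor (𝓡 n) N) (φ : W → N → N) (U : W → W × N → ℝ) : Prop where
  smooth_map : ContMDiff (𝓘(ℝ, W).prod (𝓡 n)) (𝓡 n) ∞ (fun z : W × N => φ z.1 z.2)
  smooth_pot : ∀ u, SmoothFamily n (U u)
  deriv : ∀ {f : W × N → ℝ}, SmoothFamily n f → ∀ u z,
    dirDeriv u (fpull φ f) z = fpull φ (dirDeriv u f) z + Ψ.fbr (U u) (fpull φ f) z
  flat : ∀ u v z, dirDeriv u (U v) z - dirDeriv v (U u) z = Ψ.fbr (U u) (U v) z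
  br : ∀ {f h : W × N → ℝ}, SmoothFamily n f → SmoothFamily n h → ∀ z,
    Ψ.fbr (fpull φ f) (fpull φ h) z = fpull φ (Ψ.fbr f h) z

theorem IsTwist.comp {φ ψ : W → N → N} {U V : W → W × N → ℝ} (hφ : IsTwist Ψ φ U)
    (hψ : IsTwist Ψ ψ V) :
    IsTwist Ψ (fun w y => ψ w (φ w y)) (fun u z => U u z + fpull φ (V u) z) where
  smooth_map := ContMDiff.comp (I' := 𝓘(ℝ, W).prod (𝓡 n)) hψ.smooth_map
    (contMDiff_fst.prodMk hφ.smooth_map)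
  smooth_pot u := (hφ.smooth_pot u).add ((hψ.smooth_pot u).smooth_fpull hφ.smooth_map)
  deriv := by
    intro f hf u z
    have h1 := hφ.deriv (hf.smooth_fpull hψ.smooth_map) u z
    have h2 : dirDeriv u (fpull ψ f) = _ := funext (hψ.deriv hf u)
    have h3 := hφ.br (hψ.smooth_pot u) (hf.smooth_fpull hψ.smooth_map) z
    rw [h2] at h1
    rw [PoissonTensor.fbr_add_left (hφ.smooth_pot u)
      ((hψ.smooth_pot u).smooth_fpull hφ.smooth_map)]
    refine h1.trans ?_
    have h4 : Ψ.fbr (fpull φ (V u)) (fpull (fun w y => ψ w (φ w y)) f) z = _ := h3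
    have h5 : fpull (fun w y => ψ w (φ w y)) f = fpull φ (fpull ψ f) := rfl
    rw [h4, h5]
    simp only [fpull]
    ring
  flat := by
    intro u v z
    have hV := fun u => (hψ.smooth_pot u).smooth_fpull hφ.smooth_map
    rw [(hφ.smooth_pot v).dirDeriv_add (hV v), (hφ.smooth_pot u).dirDeriv_add (hV u),
      hφ.deriv (hψ.smooth_pot v), hφ.deriv (hψ.smooth_pot u),
      PoissonTensor.fbr_add_left (hφ.smooth_pot u) (hV u),
      PoissonTensor.fbr_add_right (hφ.smooth_pot v) (hV v),
      PoissonTensor.fbr_add_right (hφ.smooth_pot v) (hV v), hφ.br (hψ.smooth_pot u)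
      (hψ.smooth_pot v), PoissonTensor.fbr_skew (fpull φ (V u)) (U v)]
    have h1 := hφ.flat u v z
    have h2 := hψ.flat u v (z.1, φ z.1 z.2)
    simp only [fpull] at h1 h2 ⊢
    linarith
  br := by
    intro f h hf hh z
    exact (hφ.br (hf.smooth_fpull hψ.smooth_map) (hh.smooth_fpull hψ.smooth_map) z).trans
      (hψ.br hf hh _)

theorem IsTwist.congr {φ ψ : W → N → N} {U V : W → W × N → ℝ} (h : IsTwist Ψ φ U) (hφ : ψ = φ)
    (hU : V = U) : IsTwist Ψ ψ V := by
  subst hφ hU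
  exact h

/-- The potentials of a twist are unique up to a closed family of Casimir functions. -/
theorem IsTwist.isCasimir_sub [IsManifold (𝓡 n) ∞ N] [T2Space N] {φ φ' : W → N → N}
    {U V : W → W × N → ℝ} (hU : IsTwist Ψ φ U) (hV : IsTwist Ψ φ V)
    (hφ' : ContMDiff (𝓘(ℝ, W).prod (𝓡 n)) (𝓡 n) ∞ (fun z : W × N => φ' z.1 z.2))
    (hinv : ∀ w y, φ' w (φ w y) = y) (u : W) :
    Ψ.IsCasimir (fun z => U u z - V u z) := by
  intro w y α
  obtain ⟨f, hf, rfl⟩ := exists_dN_eq y α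
  have hf' := (SmoothFamily.of_function (W := W) hf).smooth_fpull hφ'
  have h1 := hU.deriv hf' u (w, y)
  have h2 := hV.deriv hf' u (w, y)
  have h3 : fpull φ (fpull φ' fun z => f z.2) = fun z : W × N => f z.2 := by
    funext z
    simp only [fpull, hinv]
  rw [h3] at h1 h2
  have h4 := PoissonTensor.fbr_sub_left (Ψ := Ψ) (hU.smooth_pot u) (hV.smooth_pot u)
    (fun z => f z.2) (w, y)
  rw [PoissonTensor.fbr_skew] at h4
  have h5 : Ψ.fbr (fun z => f z.2) (fun z => U u z - V u z) (w, y) = 0 := by linarith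
  exact h5

theorem IsTwist.closed_sub [IsManifold (𝓡 n) ∞ N] [T2Space N] {φ : W → N → N}
    {U V : W → W × N → ℝ} (hU : IsTwist Ψ φ U) (hV : IsTwist Ψ φ V)
    (hc : ∀ u, Ψ.IsCasimir (fun z => U u z - V u z)) (u v : W) (z : W × N) :
    dirDeriv u (fun z => U v z - V v z) z = dirDeriv v (fun z => U u z - V u z) z := by
  have h1 := hU.flat u v z
  have h2 := hV.flat u v z
  rw [(hU.smooth_pot v).dirDeriv_sub (hV.smooth_pot v),
    (hU.smooth_pot u).dirDeriv_sub (hV.smooth_pot u)]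
  have h3 := (hc u).fbr_left (U v) z
  have h4 := (hc v).fbr_right (V u) z
  rw [PoissonTensor.fbr_sub_left (hU.smooth_pot u) (hV.smooth_pot u)] at h3
  rw [PoissonTensor.fbr_sub_right (hU.smooth_pot v) (hV.smooth_pot v)] at h4
  linarith

/-- The covariant derivative `∂_u f + {A_u, f}`. -/
def PoissonTensor.hor (Ψ : PoissonTensor (𝓡 n) N) (A : W → W × N → ℝ) (u : W) (f : W × N → ℝ)
    (z : W × N) : ℝ :=
  dirDeriv u f z + Ψ.fbr (A u) f z

/-- The curvature `∂_u A_v - ∂_v A_u + {A_u, A_v}`. -/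
def PoissonTensor.curv (Ψ : PoissonTensor (𝓡 n) N) (A : W → W × N → ℝ) (u v : W) (z : W × N) : ℝ :=
  dirDeriv u (A v) z - dirDeriv v (A u) z + Ψ.fbr (A u) (A v) z

section Gauge

variable {φ : W → N → N} {U A : W → W × N → ℝ} (hφ : IsTwist Ψ φ U)
  (hA : ∀ u, SmoothFamily n (A u))
  (hK : ∀ u, Ψ.IsCasimir (fun z => A u z + U u z - fpull φ (A u) z))

include hφ hA hK

theorem IsTwist.fbr_gauge (u : W) (f : W × N → ℝ) (z : W × N) :
    Ψ.fbr (A u) f z + Ψ.fbr (U u) f z = Ψ.fbr (fpull φ (A u)) f z := by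
  have h := (hK u).fbr_left f z
  rw [PoissonTensor.fbr_sub_left ((hA u).add (hφ.smooth_pot u))
    ((hA u).smooth_fpull hφ.smooth_map), PoissonTensor.fbr_add_left (hA u) (hφ.smooth_pot u)] at h
  linarith

theorem IsTwist.hor_fpull {f : W × N → ℝ} (hf : SmoothFamily n f) (u : W) (z : W × N) :
    Ψ.hor A u (fpull φ f) z = fpull φ (Ψ.hor A u f) z := by
  have h1 := hφ.fbr_gauge hA hK u (fpull φ f) z
  rw [hφ.br (hA u) hf] at h1
  rw [PoissonTensor.hor, hφ.deriv hf]
  simp only [fpull, PoissonTensor.hor] at h1 ⊢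
  linarith

theorem IsTwist.curv_eq (hcl : ∀ u v z, dirDeriv u (fun z => A v z + U v z - fpull φ (A v) z) z =
      dirDeriv v (fun z => A u z + U u z - fpull φ (A u) z) z) (u v : W) (z : W × N) :
    Ψ.curv A u v (z.1, φ z.1 z.2) = Ψ.curv A u v z := by
  have hP := fun u => (hA u).smooth_fpull hφ.smooth_map
  have h0 := hcl u v z
  rw [((hA v).add (hφ.smooth_pot v)).dirDeriv_sub (hP v), (hA v).dirDeriv_add (hφ.smooth_pot v),
    ((hA u).add (hφ.smooth_pot u)).dirDeriv_sub (hP u), (hA u).dirDeriv_add (hφ.smooth_pot u),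
    hφ.deriv (hA v), hφ.deriv (hA u)] at h0
  have h1 := hφ.flat u v z
  have h2 := hφ.fbr_gauge hA hK u (A v) z
  have h3 := hφ.fbr_gauge hA hK v (fpull φ (A u)) z
  have h4 := hφ.fbr_gauge hA hK v (U u) z
  have h5 := hφ.br (hA u) (hA v) z
  have h6 := PoissonTensor.fbr_skew (Ψ := Ψ) (A v) (fpull φ (A u)) z
  have h7 := PoissonTensor.fbr_skew (Ψ := Ψ) (fpull φ (A v)) (fpull φ (A u)) z
  have h8 := PoissonTensor.fbr_skew (Ψ := Ψ) (A v) (U u) z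
  have h9 := PoissonTensor.fbr_skew (Ψ := Ψ) (U v) (U u) z
  have h10 := PoissonTensor.fbr_skew (Ψ := Ψ) (fpull φ (A v)) (U u) z
  simp only [fpull, PoissonTensor.curv] at *
  linarith

end Gauge

variable [IsManifold (𝓡 n) ∞ N] [T2Space N] [FiniteDimensional ℝ W]

theorem HamiltonianFlow.isTwist (F : HamiltonianFlow Ψ W) (t : ℝ) :
    IsTwist Ψ (F.flow t) (fun u z => F.potential u ((t, z.1), z.2)) where
  smooth_map := by
    refine ContMDiff.comp (I' := 𝓘(ℝ, ℝ × W).prod (𝓡 n)) F.smooth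
      (f := fun z : W × N => ((t, z.1), z.2)) ?_
    have h1 : ContMDiff 𝓘(ℝ, W) 𝓘(ℝ, ℝ × W) ∞ (fun w : W => (t, w)) :=
      (contDiff_const.prodMk contDiff_id).contMDiff
    exact (h1.comp contMDiff_fst).prodMk contMDiff_snd
  smooth_pot u := (F.smooth_potential u).freeze_time t
  deriv := by
    intro f hf u z
    exact ((F.smooth_pull hf).dirDeriv_freeze t u z.1 z.2).trans
      (F.dirDeriv_pull hf u ((t, z.1), z.2))
  flat := by
    intro u v z
    rw [(F.smooth_potential v).dirDeriv_freeze, (F.smooth_potential u).dirDeriv_freeze]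
    exact F.zero_curvature u v ((t, z.1), z.2)
  br := by
    intro f h hf hh z
    exact F.br_comp_flow (hf.slice z.1) (hh.slice z.1) t z.1 z.2

end Twists

section Averages

variable {n : ℕ} {N : Type*} [TopologicalSpace N] [ChartedSpace (EuclideanSpace ℝ (Fin n)) N]
  {W : Type} [NormedAddCommGroup W] [NormedSpace ℝ W]
  {G : Type*} [MeasurableSpace G] {μ : Measure G}

variable (n) in
/-- The family of functions `avg` is the average of the families `fam g`, compatibly with
first derivatives. -/
structure IsAverage (μ : Measure G) (fam : G → W × N → ℝ) (avg : W × N → ℝ) : Prop where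
  smooth : SmoothFamily n avg
  integrable : ∀ z, Integrable (fun g => fam g z) μ
  eq : ∀ z, avg z = ∫ g, fam g z ∂μ
  integrable_dirDeriv : ∀ u z, Integrable (fun g => dirDeriv u (fam g) z) μ
  dirDeriv_eq : ∀ u z, dirDeriv u avg z = ∫ g, dirDeriv u (fam g) z ∂μ
  integrable_dN : ∀ w y (v : EuclideanSpace ℝ (Fin n)),
    Integrable (fun g => dN n (fun y => fam g (w, y)) y v) μ
  dN_eq : ∀ w y (v : EuclideanSpace ℝ (Fin n)),
    dN n (fun y => avg (w, y)) y v = ∫ g, dN n (fun y => fam g (w, y)) y v ∂μ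

theorem IsAverage.isCasimir {Ψ : PoissonTensor (𝓡 n) N} {fam : G → W × N → ℝ} {avg : W × N → ℝ}
    (h : IsAverage n μ fam avg) (hc : ∀ᵐ g ∂μ, Ψ.IsCasimir (fam g)) : Ψ.IsCasimir avg := by
  intro w y α
  rw [Ψ.form_apply]
  refine (h.dN_eq w y _).trans (integral_eq_zero_of_ae ?_)
  filter_upwards [hc] with g hg
  exact hg w y α

theorem IsAverage.closed {fam fam' : G → W × N → ℝ} {avg avg' : W × N → ℝ}
    (h : IsAverage n μ fam avg) (h' : IsAverage n μ fam' avg') {u v : W} {z : W × N}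
    (hc : ∀ᵐ g ∂μ, dirDeriv u (fam g) z = dirDeriv v (fam' g) z) :
    dirDeriv u avg z = dirDeriv v avg' z := by
  rw [h.dirDeriv_eq, h'.dirDeriv_eq]
  exact integral_congr_ae hc

theorem IsAverage.add {fam fam' : G → W × N → ℝ} {avg avg' : W × N → ℝ}
    (h : IsAverage n μ fam avg) (h' : IsAverage n μ fam' avg')
    (hs : ∀ g, SmoothFamily n (fam g)) (hs' : ∀ g, SmoothFamily n (fam' g)) :
    IsAverage n μ (fun g z => fam g z + fam' g z) (fun z => avg z + avg' z) where
  smooth := h.smooth.add h'.smooth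
  integrable z := (h.integrable z).add (h'.integrable z)
  eq z := by rw [h.eq, h'.eq, integral_add (h.integrable z) (h'.integrable z)]
  integrable_dirDeriv u z := by
    simp only [(hs _).dirDeriv_add (hs' _)]
    exact (h.integrable_dirDeriv u z).add (h'.integrable_dirDeriv u z)
  dirDeriv_eq u z := by
    simp only [(hs _).dirDeriv_add (hs' _)]
    rw [h.smooth.dirDeriv_add h'.smooth, h.dirDeriv_eq, h'.dirDeriv_eq,
      integral_add (h.integrable_dirDeriv u z) (h'.integrable_dirDeriv u z)]
  integrable_dN w y v := by
    simp only [dN_add ((hs _).slice_mdifferentiableAt w y) ((hs' _).slice_mdifferentiableAt w y)]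
    exact (h.integrable_dN w y v).add (h'.integrable_dN w y v)
  dN_eq w y v := by
    simp only [dN_add ((hs _).slice_mdifferentiableAt w y) ((hs' _).slice_mdifferentiableAt w y)]
    rw [dN_add (h.smooth.slice_mdifferentiableAt w y) (h'.smooth.slice_mdifferentiableAt w y)]
    exact (congrArg₂ (· + ·) (h.dN_eq w y v) (h'.dN_eq w y v)).trans
      (integral_add (h.integrable_dN w y v) (h'.integrable_dN w y v)).symm

theorem IsAverage.sub {fam fam' : G → W × N → ℝ} {avg avg' : W × N → ℝ}
    (h : IsAverage n μ fam avg) (h' : IsAverage n μ fam' avg')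
    (hs : ∀ g, SmoothFamily n (fam g)) (hs' : ∀ g, SmoothFamily n (fam' g)) :
    IsAverage n μ (fun g z => fam g z - fam' g z) (fun z => avg z - avg' z) where
  smooth := h.smooth.sub h'.smooth
  integrable z := (h.integrable z).sub (h'.integrable z)
  eq z := by rw [h.eq, h'.eq, integral_sub (h.integrable z) (h'.integrable z)]
  integrable_dirDeriv u z := by
    simp only [(hs _).dirDeriv_sub (hs' _)]
    exact (h.integrable_dirDeriv u z).sub (h'.integrable_dirDeriv u z)
  dirDeriv_eq u z := by
    simp only [(hs _).dirDeriv_sub (hs' _)]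
    rw [h.smooth.dirDeriv_sub h'.smooth, h.dirDeriv_eq, h'.dirDeriv_eq,
      integral_sub (h.integrable_dirDeriv u z) (h'.integrable_dirDeriv u z)]
  integrable_dN w y v := by
    simp only [dN_sub ((hs _).slice_mdifferentiableAt w y) ((hs' _).slice_mdifferentiableAt w y)]
    exact (h.integrable_dN w y v).sub (h'.integrable_dN w y v)
  dN_eq w y v := by
    simp only [dN_sub ((hs _).slice_mdifferentiableAt w y) ((hs' _).slice_mdifferentiableAt w y)]
    rw [dN_sub (h.smooth.slice_mdifferentiableAt w y) (h'.smooth.slice_mdifferentiableAt w y)]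
    exact (congrArg₂ (· - ·) (h.dN_eq w y v) (h'.dN_eq w y v)).trans
      (integral_sub (h.integrable_dN w y v) (h'.integrable_dN w y v)).symm

theorem IsAverage.const [IsProbabilityMeasure μ] {f : W × N → ℝ} (hf : SmoothFamily n f) :
    IsAverage n μ (fun _ => f) f where
  smooth := hf
  integrable _ := integrable_const _
  eq _ := by simp
  integrable_dirDeriv _ _ := integrable_const _
  dirDeriv_eq _ _ := by simp
  integrable_dN _ _ _ := integrable_const _
  dN_eq _ _ _ := by simp

theorem IsAverage.comp_measurePreserving {fam : G → W × N → ℝ} {avg : W × N → ℝ}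
    (h : IsAverage n μ fam avg) (e : G ≃ᵐ G) (he : MeasurePreserving e μ μ) :
    IsAverage n μ (fun g => fam (e g)) avg where
  smooth := h.smooth
  integrable z := he.integrable_comp_of_integrable (h.integrable z)
  eq z := (h.eq z).trans (he.integral_comp' (fun g => fam g z)).symm
  integrable_dirDeriv u z := he.integrable_comp_of_integrable (h.integrable_dirDeriv u z)
  dirDeriv_eq u z := (h.dirDeriv_eq u z).trans
    (he.integral_comp' (fun g => dirDeriv u (fam g) z)).symm
  integrable_dN w y v := he.integrable_comp_of_integrable (h.integrable_dN w y v)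
  dN_eq w y v := (h.dN_eq w y v).trans
    (he.integral_comp' (fun g => dN n (fun y => fam g (w, y)) y v)).symm

section Construction

variable [IsFiniteMeasure μ] {X : Type*} [TopologicalSpace X]
  {E₀ : Type*} [NormedAddCommGroup E₀] [NormedSpace ℝ E₀] {H₀ : Type*} [TopologicalSpace H₀]
  {I₀ : ModelWithCorners ℝ E₀ H₀} [ChartedSpace H₀ X] [IsManifold I₀ ∞ X]
  {ξ : G → ℝ → X}

/-- A family of curves in `X` whose values at times in `[0, 1]` stay in a compact set. -/
structure IsCompactCurveFamily (μ : Measure G) (ξ : G → ℝ → X) : Prop where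
  aesm : AEStronglyMeasurable (fun τ : G × ℝ => ξ τ.1 τ.2) (μ.prod (volume.restrict (Set.Ioc 0 1)))
  continuous : ∀ g, Continuous (ξ g)
  compact : ∃ K : Set X, IsCompact K ∧ ∀ᵐ g ∂μ, ∀ s ∈ Set.Icc (0 : ℝ) 1, ξ g s ∈ K

omit [IsFiniteMeasure μ] in
theorem IsCompactCurveFamily.weight (hξ : IsCompactCurveFamily μ ξ) :
    IsCompactWeight (μ.prod (volume.restrict (Set.Ioc (0 : ℝ) 1)))
      (fun τ : G × ℝ => ξ τ.1 τ.2) (fun _ => 1) := by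
  refine ⟨hξ.aesm, aestronglyMeasurable_const, ⟨1, by simp⟩, ?_⟩
  obtain ⟨K, hK, h⟩ := hξ.compact
  refine ⟨K, hK, ?_⟩
  have h1 := Measure.quasiMeasurePreserving_fst (μ := μ)
    (ν := volume.restrict (Set.Ioc (0 : ℝ) 1)) |>.ae h
  have h2 := Measure.quasiMeasurePreserving_snd (μ := μ)
    (ν := volume.restrict (Set.Ioc (0 : ℝ) 1)) |>.ae (ae_restrict_mem measurableSet_Ioc)
  filter_upwards [h1, h2] with τ h3 h4
  exact h3 _ (Set.Ioc_subset_Icc_self h4)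

omit [IsFiniteMeasure μ] in
theorem IsCompactCurveFamily.weight_curve (hξ : IsCompactCurveFamily μ ξ) (g : G) :
    IsCompactWeight (volume.restrict (Set.Ioc (0 : ℝ) 1)) (ξ g) (fun _ => 1) := by
  refine ⟨?_, aestronglyMeasurable_const, ⟨1, by simp⟩, ξ g '' Set.Icc 0 1,
    isCompact_Icc.image (hξ.continuous g), ?_⟩
  · have : AEStronglyMeasurable (fun s : ℝ => s) (volume.restrict (Set.Ioc (0 : ℝ) 1)) :=
      continuous_id.aestronglyMeasurable
    exact (hξ.continuous g).comp_aestronglyMeasurable this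
  · filter_upwards [ae_restrict_mem measurableSet_Ioc] with s hs
    exact Set.mem_image_of_mem _ (Set.Ioc_subset_Icc_self hs)

variable {E : Type} [NormedAddCommGroup E] [NormedSpace ℝ E] [FiniteDimensional ℝ E]
  {H : Type*} [TopologicalSpace H] {I : ModelWithCorners ℝ E H} [I.Boundaryless]
  {Z : Type*} [TopologicalSpace Z] [ChartedSpace H Z] [IsManifold I ∞ Z]
  {f : X × Z → ℝ}

theorem IsCompactCurveFamily.mvfderiv_eq (hξ : IsCompactCurveFamily μ ξ)
    (hf : ContMDiff (I₀.prod I) 𝓘(ℝ, ℝ) ∞ f) (z₀ : Z) (v : E) :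
    Integrable (fun g => mvfderiv I (fun z => ∫ s in Set.Ioc (0 : ℝ) 1, f (ξ g s, z)) z₀ v) μ ∧
    mvfderiv I (fun z => ∫ τ, f (ξ τ.1 τ.2, z) ∂(μ.prod (volume.restrict (Set.Ioc (0 : ℝ) 1)))) z₀ v
      = ∫ g, mvfderiv I (fun z => ∫ s in Set.Ioc (0 : ℝ) 1, f (ξ g s, z)) z₀ v ∂μ := by
  obtain ⟨h1, h2⟩ := hξ.weight.mvfderiv_eq hf z₀ v
  have h3 := fun g => ((hξ.weight_curve g).mvfderiv_eq hf z₀ v).1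
  simp only [one_mul] at h1 h2 h3
  simp only [h3, h1]
  exact ⟨h2.integral_prod_left, integral_prod _ h2⟩

variable [FiniteDimensional ℝ W] [IsManifold (𝓡 n) ∞ N]

theorem IsCompactCurveFamily.isAverage (hξ : IsCompactCurveFamily μ ξ) {f : X × (W × N) → ℝ}
    (hf : ContMDiff (I₀.prod (𝓘(ℝ, W).prod (𝓡 n))) 𝓘(ℝ, ℝ) ∞ f) :
    IsAverage n μ (fun g z => ∫ s in Set.Ioc (0 : ℝ) 1, f (ξ g s, z))
      (fun z => ∫ τ, f (ξ τ.1 τ.2, z) ∂(μ.prod (volume.restrict (Set.Ioc (0 : ℝ) 1)))) := by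
  have hW : ∀ y : N, ContMDiff (I₀.prod 𝓘(ℝ, W)) 𝓘(ℝ, ℝ) ∞
      (fun p : X × W => f (p.1, (p.2, y))) := fun y =>
    ContMDiff.comp (I' := I₀.prod (𝓘(ℝ, W).prod (𝓡 n))) hf
      (contMDiff_fst.prodMk (contMDiff_snd.prodMk contMDiff_const))
  have hN : ∀ w : W, ContMDiff (I₀.prod (𝓡 n)) 𝓘(ℝ, ℝ) ∞
      (fun p : X × N => f (p.1, (w, p.2))) := fun w =>
    ContMDiff.comp (I' := I₀.prod (𝓘(ℝ, W).prod (𝓡 n))) hf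
      (contMDiff_fst.prodMk (contMDiff_const.prodMk contMDiff_snd))
  have hd : ∀ (u : W) (f : W × N → ℝ) (z : W × N),
      dirDeriv u f z = mvfderiv 𝓘(ℝ, W) (fun w => f (w, z.2)) z.1 u := by
    intro u f z
    rw [mvfderiv, mfderiv_eq_fderiv]
    rfl
  have hint : ∀ z, Integrable (fun τ : G × ℝ => f (ξ τ.1 τ.2, z))
      (μ.prod (volume.restrict (Set.Ioc (0 : ℝ) 1))) := by
    intro z
    have := hξ.weight.integrable (f := fun x => f (x, z))
      (hf.continuous.comp (Continuous.prodMk continuous_id continuous_const))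
    simpa only [one_smul] using this
  refine ⟨?_, fun z => (hint z).integral_prod_left, fun z => integral_prod _ (hint z), ?_, ?_,
    fun w y v => (hξ.mvfderiv_eq (hN w) y v).1, fun w y v => (hξ.mvfderiv_eq (hN w) y v).2⟩
  · have := hξ.weight.contMDiff hf
    simpa only [one_mul] using this
  · intro u z
    simp only [hd]
    exact (hξ.mvfderiv_eq (hW z.2) z.1 u).1
  · intro u z
    simp only [hd]
    exact (hξ.mvfderiv_eq (hW z.2) z.1 u).2

end Construction

end Averages

section CompactGroups

theorem measurePreserving_mulRight_of_compactSpace {G : Type*} [TopologicalSpace G] [Group G]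
    [IsTopologicalGroup G] [CompactSpace G] [MeasurableSpace G] [BorelSpace G] (μ : Measure G)
    [μ.IsHaarMeasure] [IsProbabilityMeasure μ] (h : G) :
    MeasurePreserving (fun g => g * h) μ μ := by
  have hm : Measurable (fun g : G => g * h) := (continuous_mul_const h).measurable
  have : IsProbabilityMeasure (μ.map (fun g => g * h)) :=
    Measure.isProbabilityMeasure_map hm.aemeasurable
  exact ⟨hm, Measure.isHaarMeasure_eq_of_isProbabilityMeasure _ _⟩

theorem IsCompactCurveFamily.of_continuous {G X Y : Type*} [MeasurableSpace G] {μ : Measure G}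
    [IsFiniteMeasure μ] [TopologicalSpace X] [TopologicalSpace Y] {F : ℝ × Y → X}
    (hF : Continuous F) {L : G → Y} (hL : AEStronglyMeasurable L μ)
    (hK : ∃ K : Set Y, IsCompact K ∧ ∀ᵐ g ∂μ, L g ∈ K) :
    IsCompactCurveFamily μ (fun g s => F (s, L g)) := by
  refine ⟨?_, fun g => hF.comp (Continuous.prodMk continuous_id continuous_const), ?_⟩
  · have h1 : AEStronglyMeasurable (fun τ : G × ℝ => τ.2)
        (μ.prod (volume.restrict (Set.Ioc (0 : ℝ) 1))) :=
      (continuous_id.aestronglyMeasurable (μ := volume.restrict (Set.Ioc (0 : ℝ) 1))).comp_snd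
    exact hF.comp_aestronglyMeasurable (h1.prodMk hL.comp_fst)
  · obtain ⟨K, hK, hLK⟩ := hK
    refine ⟨_, (isCompact_Icc (a := (0 : ℝ)) (b := 1) |>.prod hK).image hF, ?_⟩
    filter_upwards [hLK] with g hg s hs
    exact Set.mem_image_of_mem _ (Set.mk_mem_prod hs hg)

variable {k : ℕ} {G : Type*} [TopologicalSpace G] [ChartedSpace (EuclideanSpace ℝ (Fin k)) G]
  [Group G] [LieGroup (𝓡 k) ∞ G] [T2Space G] [MeasurableSpace G] [BorelSpace G] {μ : Measure G}
  {ℓ : G → GroupLieAlgebra (𝓡 k) G}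

omit [BorelSpace G] in
theorem IsLogarithm.lieExp_surjective [μ.IsOpenPosMeasure] (hℓ : IsLogarithm μ ℓ) :
    Function.Surjective (lieExp : GroupLieAlgebra (𝓡 k) G → G) := by
  obtain ⟨K, hK, hℓK⟩ := hℓ.bounded
  have hcl : IsClosed (lieExp '' K : Set G) := (hK.image continuous_lieExp).isClosed
  have hae : ∀ᵐ g ∂μ, g ∈ (lieExp '' K : Set G) := by
    filter_upwards [hℓK, hℓ.exp_eq] with g h1 h2
    exact ⟨_, h1, h2⟩
  have huniv : (lieExp '' K : Set G) = Set.univ := by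
    have := hcl.isOpen_compl.eq_empty_of_measure_zero (μ := μ) hae
    rwa [Set.compl_empty_iff] at this
  intro g
  obtain ⟨a, -, ha⟩ : g ∈ (lieExp '' K : Set G) := huniv ▸ Set.mem_univ g
  exact ⟨a, ha⟩

omit [BorelSpace G] in
theorem IsLogarithm.isCompactCurveFamily [IsFiniteMeasure μ] (hℓ : IsLogarithm μ ℓ) :
    IsCompactCurveFamily μ
      (fun g (s : ℝ) => ((lieExp (s • ℓ g), ℓ g) : G × EuclideanSpace ℝ (Fin k))) := by
  have h1 : Continuous (fun p : ℝ × EuclideanSpace ℝ (Fin k) => p.1 • p.2) := by fun_prop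
  have hc : Continuous (fun p : ℝ × EuclideanSpace ℝ (Fin k) =>
      ((lieExp (k := k) (G := G) (p.1 • p.2), p.2) : G × EuclideanSpace ℝ (Fin k))) :=
    Continuous.prodMk ((continuous_lieExp (k := k) (G := G)).comp h1) continuous_snd
  exact IsCompactCurveFamily.of_continuous hc hℓ.measurable hℓ.bounded

end CompactGroups

section Actions

variable {k m n : ℕ} {G : Type*} [TopologicalSpace G] [ChartedSpace (EuclideanSpace ℝ (Fin k)) G]
  [Group G] [LieGroup (𝓡 k) ∞ G] [T2Space G]
  {N : Type*} [TopologicalSpace N] [ChartedSpace (EuclideanSpace ℝ (Fin n)) N]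
  {Ψ : PoissonTensor (𝓡 n) N}
  {Φ : FiberwiseAction (k := k) (m := m) (n := n) G (EuclideanSpace ℝ (Fin m)) N}
  {J : EuclideanSpace ℝ (Fin m) × N → Module.Dual ℝ (GroupLieAlgebra (𝓡 k) G)}

omit [LieGroup (𝓡 k) ∞ G] [T2Space G] in
theorem FiberwiseAction.smooth_act {Q : Type*} [TopologicalSpace Q]
    [ChartedSpace (EuclideanSpace ℝ (Fin m)) Q]
    (Φ : FiberwiseAction (k := k) (m := m) (n := n) G Q N) (g : G) :
    ContMDiff ((𝓡 m).prod (𝓡 n)) (𝓡 n) ∞ (fun z : Q × N => Φ.act g z.1 z.2) :=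
  ContMDiff.comp (I' := (𝓡 k).prod ((𝓡 m).prod (𝓡 n))) Φ.smooth
    (contMDiff_const.prodMk contMDiff_id)

/-- The flows of one-parameter subgroups. -/
def IsFiberwiseMomentumMap.hamiltonianFlow (hJ : IsFiberwiseMomentumMap Ψ Φ J)
    (a : GroupLieAlgebra (𝓡 k) G) : HamiltonianFlow Ψ (EuclideanSpace ℝ (Fin m)) where
  flow t w y := Φ.act (lieExp (t • a)) w y
  ham z := J z a
  smooth := by
    refine ContMDiff.comp (I' := (𝓡 k).prod ((𝓡 m).prod (𝓡 n))) Φ.smooth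
      (f := fun z : (ℝ × EuclideanSpace ℝ (Fin m)) × N => (lieExp (z.1.1 • a), z.1.2, z.2)) ?_
    have h1 : ContMDiff 𝓘(ℝ, ℝ × EuclideanSpace ℝ (Fin m)) 𝓘(ℝ, ℝ) ∞ Prod.fst :=
      contDiff_fst.contMDiff
    have h2 : ContMDiff 𝓘(ℝ, ℝ × EuclideanSpace ℝ (Fin m)) (𝓡 m) ∞ Prod.snd :=
      contDiff_snd.contMDiff
    exact ((contMDiff_lieExp_smul a).comp (h1.comp contMDiff_fst)).prodMk
      ((h2.comp contMDiff_fst).prodMk contMDiff_snd)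
  smooth_ham := hJ.1 a
  flow_zero w y := by rw [zero_smul, lieExp_zero, Φ.one_act]
  flow_add s t w y := by rw [lieExp_add_smul, Φ.mul_act]
  generator w y f hf := by
    have h0 : Φ.act (lieExp ((0 : ℝ) • a)) w y = y := by rw [zero_smul, lieExp_zero, Φ.one_act]
    have hc : ContMDiff 𝓘(ℝ, ℝ) (𝓡 n) ∞ (fun t : ℝ => Φ.act (lieExp (t • a)) w y) :=
      ContMDiff.comp (I' := (𝓡 k).prod ((𝓡 m).prod (𝓡 n))) Φ.smooth
        (f := fun t : ℝ => (lieExp (t • a), w, y)) ((contMDiff_lieExp_smul a).prodMk contMDiff_const)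
    have h1 := ((hf.mdifferentiable (by simp)
      (Φ.act (lieExp ((0 : ℝ) • a)) w y)).hasMFDerivAt_dN).comp (0 : ℝ)
      (hc.mdifferentiable (by simp) 0).hasMFDerivAt
    set D : ℝ →L[ℝ] EuclideanSpace ℝ (Fin n) :=
      mfderiv 𝓘(ℝ, ℝ) (𝓡 n) (fun t : ℝ => Φ.act (lieExp (t • a)) w y) 0
    have h2 : HasFDerivAt (fun t : ℝ => f (Φ.act (lieExp (t • a)) w y))
        ((dN n f (Φ.act (lieExp ((0 : ℝ) • a)) w y)).comp D) 0 :=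
      hasMFDerivAt_iff_hasFDerivAt.1 h1
    refine h2.hasDerivAt.congr_deriv ?_
    have h3 := (hJ.2 w a).2 y
    have h4 : D 1 = Ψ.sharp y (dN n (fun y => J (w, y) a) y) := h3
    have h5 : dN n f (Φ.act (lieExp ((0 : ℝ) • a)) w y) = dN n f y := by rw [h0]
    exact (congrArg₂ (fun (L : EuclideanSpace ℝ (Fin n) →L[ℝ] ℝ) v => L v) h5 h4)

variable (hJ : IsFiberwiseMomentumMap Ψ Φ J)

variable [IsManifold (𝓡 n) ∞ N] [T2Space N]

include hJ in
omit [LieGroup (𝓡 k) ∞ G] [T2Space G] [T2Space N] in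
theorem IsFiberwiseMomentumMap.smooth_integrand (u : EuclideanSpace ℝ (Fin m)) :
    ContMDiff (((𝓡 k).prod 𝓘(ℝ, EuclideanSpace ℝ (Fin k))).prod ((𝓡 m).prod (𝓡 n))) 𝓘(ℝ, ℝ) ∞
      (fun p : (G × EuclideanSpace ℝ (Fin k)) × (EuclideanSpace ℝ (Fin m) × N) =>
        dirDeriv u (fun z => J z p.1.2) (p.2.1, Φ.act p.1.1 p.2.1 p.2.2)) := by
  set e : Fin k → GroupLieAlgebra (𝓡 k) G := fun b =>
    (EuclideanSpace.single b (1 : ℝ) : EuclideanSpace ℝ (Fin k))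
  have hsum : ∀ (a : EuclideanSpace ℝ (Fin k)) (z : EuclideanSpace ℝ (Fin m) × N),
      J z a = ∑ b, a b * J z (e b) := by
    intro a z
    have h1 : a = ∑ b, a b • EuclideanSpace.single b (1 : ℝ) := by
      ext j
      simp [Finset.sum_apply, Pi.single_apply]
    have h2 : ∀ L : EuclideanSpace ℝ (Fin k) →ₗ[ℝ] ℝ,
        L a = ∑ b, a b * L (EuclideanSpace.single b (1 : ℝ)) := by
      intro L
      conv_lhs => rw [h1]
      simp only [map_sum, map_smul, smul_eq_mul]
    exact h2 (J z)
  have hdir : ∀ (a : EuclideanSpace ℝ (Fin k)) (z : EuclideanSpace ℝ (Fin m) × N),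
      dirDeriv u (fun z => J z a) z = ∑ b, a b * dirDeriv u (fun z => J z (e b)) z := by
    intro a z
    have hs : ∀ b, SmoothFamily n (fun z => J z (e b)) := fun b => hJ.1 (e b)
    have h1 : HasFDerivAt (fun w => ∑ b, a b * J (w, z.2) (e b))
        (∑ b, a b • fderiv ℝ (fun w => J (w, z.2) (e b)) z.1) z.1 :=
      HasFDerivAt.fun_sum fun b _ => ((hs b).differentiableAt z.1 z.2).hasFDerivAt.const_mul (a b)
    have h2 : (fun w => J (w, z.2) a) = fun w => ∑ b, a b * J (w, z.2) (e b) :=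
      funext fun w => hsum a _
    simp only [dirDeriv, h2, h1.fderiv]
    simp
  simp only [hdir]
  refine contMDiff_finsetSum fun b _ => ?_
  have hb : SmoothFamily n (fun z => J z (e b)) := hJ.1 (e b)
  refine ContMDiff.mul ?_ ?_
  · have h1 : ContMDiff 𝓘(ℝ, EuclideanSpace ℝ (Fin k)) 𝓘(ℝ, ℝ) ∞
        (fun a : EuclideanSpace ℝ (Fin k) => a b) :=
      (EuclideanSpace.proj b : EuclideanSpace ℝ (Fin k) →L[ℝ] ℝ).contDiff.contMDiff
    exact h1.comp (contMDiff_snd.comp contMDiff_fst)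
  · refine ContMDiff.comp (I' := (𝓡 m).prod (𝓡 n)) (hb.smooth_dirDeriv u) ?_
    refine (contMDiff_fst.comp contMDiff_snd).prodMk ?_
    exact ContMDiff.comp (I' := (𝓡 k).prod ((𝓡 m).prod (𝓡 n))) Φ.smooth
      ((contMDiff_fst.comp contMDiff_fst).prodMk contMDiff_snd)

omit [IsManifold (𝓡 n) ∞ N] [T2Space N] in
theorem IsFiberwiseMomentumMap.potential_eq (a : GroupLieAlgebra (𝓡 k) G)
    (u : EuclideanSpace ℝ (Fin m)) (z : EuclideanSpace ℝ (Fin m) × N) :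
    (hJ.hamiltonianFlow a).potential u ((1, z.1), z.2) =
      ∫ s in Set.Ioc (0 : ℝ) 1, dirDeriv u (fun z => J z a) (z.1, Φ.act (lieExp (s • a)) z.1 z.2) :=
  intervalIntegral.integral_of_le zero_le_one

variable [MeasurableSpace G] [BorelSpace G] {μ : Measure G} [IsProbabilityMeasure μ]
  {ℓ : G → GroupLieAlgebra (𝓡 k) G} (hℓ : IsLogarithm μ ℓ)

variable (μ ℓ) in
/-- The average of the potentials of the time-one maps of the logarithms. -/
def IsFiberwiseMomentumMap.avgPotential (u : EuclideanSpace ℝ (Fin m))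
    (z : EuclideanSpace ℝ (Fin m) × N) : ℝ :=
  ∫ g, (hJ.hamiltonianFlow (ℓ g)).potential u ((1, z.1), z.2) ∂μ

include hℓ

omit [T2Space N] [BorelSpace G] in
theorem IsFiberwiseMomentumMap.isAverage (u : EuclideanSpace ℝ (Fin m)) :
    IsAverage n μ (fun g z => (hJ.hamiltonianFlow (ℓ g)).potential u ((1, z.1), z.2))
      (hJ.avgPotential μ ℓ u) := by
  have : IsManifold (𝓡 k) ∞ G := ContMDiffMul.toIsManifold
  have h := hℓ.isCompactCurveFamily.isAverage (hJ.smooth_integrand u)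
  have h1 : (fun g (z : EuclideanSpace ℝ (Fin m) × N) => (hJ.hamiltonianFlow (ℓ g)).potential u ((1, z.1), z.2)) =
      fun g (z : EuclideanSpace ℝ (Fin m) × N) => ∫ s in Set.Ioc (0 : ℝ) 1,
        dirDeriv u (fun z => J z (ℓ g)) (z.1, Φ.act (lieExp (s • ℓ g)) z.1 z.2) :=
    funext fun g => funext fun z => hJ.potential_eq (ℓ g) u z
  have h2 : hJ.avgPotential μ ℓ u = _ := funext fun z =>
    (integral_congr_ae (ae_of_all μ fun g => hJ.potential_eq (ℓ g) u z)).trans (h.eq z).symm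
  rw [h1, h2]
  exact h

omit [T2Space N] [BorelSpace G] in
theorem IsFiberwiseMomentumMap.isAverage_fpull (u : EuclideanSpace ℝ (Fin m))
    {φ : EuclideanSpace ℝ (Fin m) → N → N}
    (hφ : ContMDiff (𝓘(ℝ, EuclideanSpace ℝ (Fin m)).prod (𝓡 n)) (𝓡 n) ∞
      (fun z : EuclideanSpace ℝ (Fin m) × N => φ z.1 z.2)) :
    IsAverage n μ
      (fun g => fpull φ fun z => (hJ.hamiltonianFlow (ℓ g)).potential u ((1, z.1), z.2))
      (fpull φ (hJ.avgPotential μ ℓ u)) := by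
  have : IsManifold (𝓡 k) ∞ G := ContMDiffMul.toIsManifold
  have hf : ContMDiff (((𝓡 k).prod 𝓘(ℝ, EuclideanSpace ℝ (Fin k))).prod ((𝓡 m).prod (𝓡 n)))
      𝓘(ℝ, ℝ) ∞ (fun p : (G × EuclideanSpace ℝ (Fin k)) × (EuclideanSpace ℝ (Fin m) × N) =>
        dirDeriv u (fun z => J z p.1.2) (p.2.1, Φ.act p.1.1 p.2.1 (φ p.2.1 p.2.2))) :=
    ContMDiff.comp (I' := ((𝓡 k).prod 𝓘(ℝ, EuclideanSpace ℝ (Fin k))).prod ((𝓡 m).prod (𝓡 n)))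
      (hJ.smooth_integrand u) (contMDiff_fst.prodMk
        ((contMDiff_fst.comp contMDiff_snd).prodMk (hφ.comp contMDiff_snd)))
  have h := hℓ.isCompactCurveFamily.isAverage hf
  have h1 : (fun g => fpull φ fun z => (hJ.hamiltonianFlow (ℓ g)).potential u ((1, z.1), z.2)) =
      fun g z => ∫ s in Set.Ioc (0 : ℝ) 1,
        dirDeriv u (fun z => J z (ℓ g)) (z.1, Φ.act (lieExp (s • ℓ g)) z.1 (φ z.1 z.2)) :=
    funext fun g => funext fun z => hJ.potential_eq (ℓ g) u (z.1, φ z.1 z.2)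
  have h2 : fpull φ (hJ.avgPotential μ ℓ u) = _ := funext fun z =>
    (integral_congr_ae (ae_of_all μ fun g =>
      hJ.potential_eq (ℓ g) u (z.1, φ z.1 z.2))).trans (h.eq z).symm
  rw [h1, h2]
  exact h

end Actions

section GaugeInvariance

variable {k m n : ℕ} {G : Type*} [TopologicalSpace G] [ChartedSpace (EuclideanSpace ℝ (Fin k)) G]
  [Group G] [LieGroup (𝓡 k) ∞ G] [T2Space G]
  {N : Type*} [TopologicalSpace N] [ChartedSpace (EuclideanSpace ℝ (Fin n)) N]
  [IsManifold (𝓡 n) ∞ N] [T2Space N]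
  {Ψ : PoissonTensor (𝓡 n) N}
  {Φ : FiberwiseAction (k := k) (m := m) (n := n) G (EuclideanSpace ℝ (Fin m)) N}
  {J : EuclideanSpace ℝ (Fin m) × N → Module.Dual ℝ (GroupLieAlgebra (𝓡 k) G)}
  (hJ : IsFiberwiseMomentumMap Ψ Φ J)

omit [IsManifold (𝓡 n) ∞ N] [T2Space N] in
/-- Casimir functions are constant along Hamiltonian flows. -/
theorem HamiltonianFlow.casimir_flow {W : Type} [NormedAddCommGroup W] [NormedSpace ℝ W]
    (F : HamiltonianFlow Ψ W) {c : W × N → ℝ} (hc : SmoothFamily n c) (hcas : Ψ.IsCasimir c)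
    (t : ℝ) (w : W) (y : N) : c (w, F.flow t w y) = c (w, y) := by
  have hd : ∀ t, HasDerivAt (fun t => c (w, F.flow t w y)) 0 t := by
    intro t
    have h := F.hasDerivAt_flow (hc.slice w) t w y
    rwa [show Ψ.br (fun y => F.ham (w, y)) (fun y => c (w, y)) (F.flow t w y) = 0 from
      hcas _ _ _] at h
  have h := is_const_of_deriv_eq_zero (fun s => (hd s).differentiableAt)
    (fun s => (hd s).deriv) t 0
  rwa [F.flow_zero] at h

variable [MeasurableSpace G] [BorelSpace G] {μ : Measure G} [IsProbabilityMeasure μ]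
  {ℓ : G → GroupLieAlgebra (𝓡 k) G} (hℓ : IsLogarithm μ ℓ)
  {C : EuclideanSpace ℝ (Fin m) → EuclideanSpace ℝ (Fin m) × N → ℝ}
  (hC : ∀ u, SmoothFamily n (C u)) (hCc : ∀ u, Ψ.IsCasimir (C u))

variable (μ ℓ C) in
/-- The family of components of the averaged form. -/
def IsFiberwiseMomentumMap.gauge (u : EuclideanSpace ℝ (Fin m))
    (z : EuclideanSpace ℝ (Fin m) × N) : ℝ :=
  C u z - hJ.avgPotential μ ℓ u z

include hℓ hC in
omit [T2Space N] [BorelSpace G] in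
theorem IsFiberwiseMomentumMap.smooth_gauge (u : EuclideanSpace ℝ (Fin m)) :
    SmoothFamily n (hJ.gauge μ ℓ C u) :=
  (hC u).sub (hJ.isAverage hℓ u).smooth

omit [MeasurableSpace G] [BorelSpace G] in
theorem IsFiberwiseMomentumMap.isTwist_act (b : GroupLieAlgebra (𝓡 k) G) (t : ℝ) {h : G}
    (hh : lieExp (t • b) = h) :
    IsTwist Ψ (Φ.act h) (fun u z => (hJ.hamiltonianFlow b).potential u ((t, z.1), z.2)) := by
  subst hh
  exact (hJ.hamiltonianFlow b).isTwist t

variable [CompactSpace G] [μ.IsHaarMeasure]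

include hℓ in
theorem IsFiberwiseMomentumMap.averaged_cocycle (b : GroupLieAlgebra (𝓡 k) G) (t : ℝ) {h : G}
    (hh : lieExp (t • b) = h) :
    (∀ u, Ψ.IsCasimir (fun z => (hJ.hamiltonianFlow b).potential u ((t, z.1), z.2) +
      fpull (Φ.act h) (hJ.avgPotential μ ℓ u) z - hJ.avgPotential μ ℓ u z)) ∧
    ∀ u v z, dirDeriv u (fun z => (hJ.hamiltonianFlow b).potential v ((t, z.1), z.2) +
      fpull (Φ.act h) (hJ.avgPotential μ ℓ v) z - hJ.avgPotential μ ℓ v z) z =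
      dirDeriv v (fun z => (hJ.hamiltonianFlow b).potential u ((t, z.1), z.2) +
      fpull (Φ.act h) (hJ.avgPotential μ ℓ u) z - hJ.avgPotential μ ℓ u z) z := by
  have : IsTopologicalGroup G := topologicalGroup_of_lieGroup (𝓡 k) ∞
  have htw := hJ.isTwist_act b t hh
  have hpres : MeasurePreserving (MeasurableEquiv.mulRight h) μ μ :=
    measurePreserving_mulRight_of_compactSpace μ h
  have hV : ∀ g u, SmoothFamily n (fun z : EuclideanSpace ℝ (Fin m) × N =>
      (hJ.hamiltonianFlow (ℓ g)).potential u ((1, z.1), z.2)) := fun g u =>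
    ((hJ.hamiltonianFlow (ℓ g)).isTwist 1).smooth_pot u
  have havg : ∀ u, IsAverage n μ (fun g z =>
      ((hJ.hamiltonianFlow b).potential u ((t, z.1), z.2) + fpull (Φ.act h)
        (fun z => (hJ.hamiltonianFlow (ℓ g)).potential u ((1, z.1), z.2)) z) -
        (hJ.hamiltonianFlow (ℓ (g * h))).potential u ((1, z.1), z.2))
      (fun z => (hJ.hamiltonianFlow b).potential u ((t, z.1), z.2) +
        fpull (Φ.act h) (hJ.avgPotential μ ℓ u) z - hJ.avgPotential μ ℓ u z) := by
    intro u
    refine IsAverage.sub (IsAverage.add (IsAverage.const (htw.smooth_pot u))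
      (hJ.isAverage_fpull hℓ u htw.smooth_map) (fun _ => htw.smooth_pot u)
      (fun g => (hV g u).smooth_fpull htw.smooth_map)) ?_ ?_ (fun g => hV _ u)
    · exact (hJ.isAverage hℓ u).comp_measurePreserving (MeasurableEquiv.mulRight h) hpres
    · exact fun g => (htw.smooth_pot u).add ((hV g u).smooth_fpull htw.smooth_map)
  have htwists : ∀ᵐ g ∂μ,
      IsTwist Ψ (Φ.act (g * h)) (fun u z => (hJ.hamiltonianFlow b).potential u ((t, z.1), z.2) +
        fpull (Φ.act h) (fun z => (hJ.hamiltonianFlow (ℓ g)).potential u ((1, z.1), z.2)) z) ∧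
      IsTwist Ψ (Φ.act (g * h))
        (fun u z => (hJ.hamiltonianFlow (ℓ (g * h))).potential u ((1, z.1), z.2)) := by
    have h2 : ∀ᵐ g ∂μ, lieExp (ℓ (g * h)) = g * h := hpres.quasiMeasurePreserving.ae hℓ.exp_eq
    filter_upwards [hℓ.exp_eq, h2] with g hg hgh
    refine ⟨(htw.comp (hJ.isTwist_act (ℓ g) 1 (h := g) (by rwa [one_smul]))).congr
      (funext fun w => funext fun y => Φ.mul_act g h w y) rfl,
      hJ.isTwist_act _ 1 (by rwa [one_smul])⟩
  have hcas : ∀ᵐ g ∂μ, ∀ u, Ψ.IsCasimir (fun z =>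
      ((hJ.hamiltonianFlow b).potential u ((t, z.1), z.2) + fpull (Φ.act h)
        (fun z => (hJ.hamiltonianFlow (ℓ g)).potential u ((1, z.1), z.2)) z) -
        (hJ.hamiltonianFlow (ℓ (g * h))).potential u ((1, z.1), z.2)) := by
    filter_upwards [htwists] with g hg u
    refine hg.1.isCasimir_sub hg.2 (φ' := Φ.act (g * h)⁻¹) (Φ.smooth_act _) (fun w y => ?_) u
    rw [← Φ.mul_act, inv_mul_cancel, Φ.one_act]
  refine ⟨fun u => (havg u).isCasimir (hcas.mono fun g hg => hg u), fun u v z => ?_⟩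
  refine (havg v).closed (havg u) ?_
  filter_upwards [htwists, hcas] with g hg hgc
  exact hg.1.closed_sub hg.2 hgc u v z

include hℓ hC hCc in
theorem IsFiberwiseMomentumMap.gauge_cocycle (b : GroupLieAlgebra (𝓡 k) G) (t : ℝ) {h : G}
    (hh : lieExp (t • b) = h) :
    (∀ u, Ψ.IsCasimir (fun z => hJ.gauge μ ℓ C u z +
      (hJ.hamiltonianFlow b).potential u ((t, z.1), z.2) -
      fpull (Φ.act h) (hJ.gauge μ ℓ C u) z)) ∧
    ∀ u v z, dirDeriv u (fun z => hJ.gauge μ ℓ C v z +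
      (hJ.hamiltonianFlow b).potential v ((t, z.1), z.2) -
      fpull (Φ.act h) (hJ.gauge μ ℓ C v) z) z =
      dirDeriv v (fun z => hJ.gauge μ ℓ C u z +
      (hJ.hamiltonianFlow b).potential u ((t, z.1), z.2) -
      fpull (Φ.act h) (hJ.gauge μ ℓ C u) z) z := by
  have h1 : ∀ u, (fun z => hJ.gauge μ ℓ C u z +
      (hJ.hamiltonianFlow b).potential u ((t, z.1), z.2) -
      fpull (Φ.act h) (hJ.gauge μ ℓ C u) z) =
      fun z => (hJ.hamiltonianFlow b).potential u ((t, z.1), z.2) +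
      fpull (Φ.act h) (hJ.avgPotential μ ℓ u) z - hJ.avgPotential μ ℓ u z := by
    intro u
    funext z
    have h2 := (hJ.hamiltonianFlow b).casimir_flow (hC u) (hCc u) t z.1 z.2
    have h3 : (hJ.hamiltonianFlow b).flow t z.1 z.2 = Φ.act h z.1 z.2 := by
      rw [← hh]
      rfl
    rw [h3] at h2
    simp only [gauge, fpull, h2]
    ring
  simp only [h1]
  exact hJ.averaged_cocycle hℓ b t hh

include hℓ hC hCc in
/-- The action preserves the covariant derivative of the averaged form, its curvature and the
bracket. -/
theorem IsFiberwiseMomentumMap.gauge_invariant (h : G) :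
    (∀ {f : EuclideanSpace ℝ (Fin m) × N → ℝ}, SmoothFamily n f → ∀ u z,
      Ψ.hor (hJ.gauge μ ℓ C) u (fpull (Φ.act h) f) z =
        fpull (Φ.act h) (Ψ.hor (hJ.gauge μ ℓ C) u f) z) ∧
    (∀ u v z, Ψ.curv (hJ.gauge μ ℓ C) u v (z.1, Φ.act h z.1 z.2) =
      Ψ.curv (hJ.gauge μ ℓ C) u v z) ∧
    ∀ {f f' : EuclideanSpace ℝ (Fin m) × N → ℝ}, SmoothFamily n f → SmoothFamily n f' → ∀ z,
      Ψ.fbr (fpull (Φ.act h) f) (fpull (Φ.act h) f') z = fpull (Φ.act h) (Ψ.fbr f f') z := by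
  obtain ⟨b, hb⟩ := hℓ.lieExp_surjective h
  rw [← one_smul ℝ b] at hb
  have htw := hJ.isTwist_act b 1 hb
  have hA := hJ.smooth_gauge hℓ hC
  obtain ⟨h1, h2⟩ := hJ.gauge_cocycle hℓ hC hCc b 1 hb
  exact ⟨fun hf u z => htw.hor_fpull hA h1 hf u z, fun u v z => htw.curv_eq hA h1 h2 u v z,
    fun hf hf' z => htw.br hf hf' z⟩

include hℓ hC hCc in
theorem IsFiberwiseMomentumMap.isCasimir_hor (a : GroupLieAlgebra (𝓡 k) G)
    (u : EuclideanSpace ℝ (Fin m)) :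
    Ψ.IsCasimir (Ψ.hor (hJ.gauge μ ℓ C) u (fun z => J z a)) := by
  set F := hJ.hamiltonianFlow a with hF
  set A := hJ.gauge μ ℓ C with hAdef
  have hA : SmoothFamily n (A u) := hJ.smooth_gauge hℓ hC u
  set K : (ℝ × EuclideanSpace ℝ (Fin m)) × N → ℝ := fun z =>
    A u (z.1.2, z.2) + F.potential u z - F.pull (A u) z
  have hK : SmoothFamily n K :=
    (hA.comp_snd.add (F.smooth_potential u)).sub (F.smooth_pull hA)
  have hKc : Ψ.IsCasimir K := fun w y α =>
    (hJ.gauge_cocycle hℓ hC hCc a w.1 rfl).1 u w.2 y α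
  have hd : ∀ (w : EuclideanSpace ℝ (Fin m)) (y : N), dirDeriv (1, 0) K ((0, w), y) =
      Ψ.hor A u (fun z => J z a) (w, y) := by
    intro w y
    rw [(hA.comp_snd.add (F.smooth_potential u)).dirDeriv_sub (F.smooth_pull hA),
      hA.comp_snd.dirDeriv_add (F.smooth_potential u), hA.dirDeriv_comp_snd,
      F.dirDeriv_time_potential, F.dirDeriv_time_pull hA]
    have h1 : dirDeriv (0 : EuclideanSpace ℝ (Fin m)) (A u) (w, y) = 0 := by simp [dirDeriv]
    have h2 : Ψ.fbr (fun z : (ℝ × EuclideanSpace ℝ (Fin m)) × N => F.ham (z.1.2, z.2))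
        (F.pull (A u)) ((0, w), y) = -Ψ.fbr (A u) (fun z => J z a) (w, y) := by
      have h3 : (fun y => F.pull (A u) (((0 : ℝ), w), y)) = fun y => A u (w, y) := by
        funext y
        simp only [HamiltonianFlow.pull, F.flow_zero]
      rw [PoissonTensor.fbr_skew (A u), neg_neg]
      simp only [PoissonTensor.fbr, h3]
      rfl
    have h4 : F.pull (dirDeriv u F.ham) ((0, w), y) = dirDeriv u (fun z => J z a) (w, y) := by
      simp only [HamiltonianFlow.pull, F.flow_zero]
      rfl
    rw [h1, h2, h4, PoissonTensor.hor]
    ring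
  intro w y α
  obtain ⟨f, hf, rfl⟩ := exists_dN_eq y α
  have hf' := SmoothFamily.of_function (W := ℝ × EuclideanSpace ℝ (Fin m)) hf
  have h0 : Ψ.fbr (fun z : (ℝ × EuclideanSpace ℝ (Fin m)) × N => f z.2) K = fun _ => 0 :=
    funext fun z => hKc.fbr_right _ z
  have h1 := hf'.dirDeriv_fbr Ψ hK (1, 0) ((0, w), y)
  rw [h0, hKc.fbr_right, zero_add] at h1
  have h2 : Ψ.fbr (fun z : (ℝ × EuclideanSpace ℝ (Fin m)) × N => f z.2) (dirDeriv (1, 0) K)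
      ((0, w), y) = 0 := by
    rw [← h1]
    simp [dirDeriv]
  simp only [PoissonTensor.fbr, hd] at h2
  exact h2

include hℓ hC hCc in
/-- The components of the momentum map are covariantly constant if their derivatives have vanishing
averages. -/
theorem IsFiberwiseMomentumMap.hor_eq_zero (a : GroupLieAlgebra (𝓡 k) G)
    (u : EuclideanSpace ℝ (Fin m)) (z : EuclideanSpace ℝ (Fin m) × N)
    (hz : ∫ g, dirDeriv u (fun z => J z a) (z.1, Φ.act g z.1 z.2) ∂μ = 0) :
    Ψ.hor (hJ.gauge μ ℓ C) u (fun z => J z a) z = 0 := by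
  have : IsTopologicalGroup G := topologicalGroup_of_lieGroup (𝓡 k) ∞
  have : IsManifold (𝓡 k) ∞ G := ContMDiffMul.toIsManifold
  obtain ⟨w, y⟩ := z
  set A := hJ.gauge μ ℓ C with hAdef
  have hA : SmoothFamily n (A u) := hJ.smooth_gauge hℓ hC u
  have hJa : SmoothFamily n (fun z => J z a) := hJ.1 a
  have horb : Continuous fun g => (w, Φ.act g w y) := by
    refine Continuous.prodMk continuous_const ?_
    exact Φ.smooth.continuous.comp (f := fun g => (g, w, y))
      (Continuous.prodMk continuous_id continuous_const)
  have hint : ∀ {f : EuclideanSpace ℝ (Fin m) × N → ℝ}, SmoothFamily n f →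
      Integrable (fun g => f (w, Φ.act g w y)) μ := fun hf =>
    (hf.continuous.comp horb).integrable_of_hasCompactSupport (HasCompactSupport.of_compactSpace _)
  have hconst : ∀ g, Ψ.hor A u (fun z => J z a) (w, Φ.act g w y) =
      Ψ.hor A u (fun z => J z a) (w, y) := by
    intro g
    obtain ⟨b, rfl⟩ := hℓ.lieExp_surjective g
    have h := (hJ.hamiltonianFlow b).casimir_flow
      ((hJa.smooth_dirDeriv u).add (hA.smooth_fbr Ψ hJa)) (hJ.isCasimir_hor hℓ hC hCc a u) 1 w y
    have h2 : (hJ.hamiltonianFlow b).flow 1 w y = Φ.act (lieExp b) w y := by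
      have : (hJ.hamiltonianFlow b).flow 1 w y = Φ.act (lieExp ((1 : ℝ) • b)) w y := rfl
      rw [this, one_smul]
    rw [h2] at h
    exact h
  have hbr : ∫ g, Ψ.fbr (fun z => J z a) (A u) (w, Φ.act g w y) ∂μ = 0 := by
    set f : G × ℝ → ℝ := fun p => A u (w, Φ.act (lieExp (p.2 • a) * p.1) w y)
    have hf : ContMDiff ((𝓡 k).prod 𝓘(ℝ, ℝ)) 𝓘(ℝ, ℝ) ∞ f := by
      refine ContMDiff.comp (I' := (𝓡 m).prod (𝓡 n)) hA
        (f := fun p : G × ℝ => (w, Φ.act (lieExp (p.2 • a) * p.1) w y)) ?_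
      refine contMDiff_const.prodMk ?_
      refine ContMDiff.comp (I' := (𝓡 k).prod ((𝓡 m).prod (𝓡 n))) Φ.smooth
        (f := fun p : G × ℝ => (lieExp (p.2 • a) * p.1, w, y)) ?_
      exact (((contMDiff_lieExp_smul a).comp contMDiff_snd).mul contMDiff_fst).prodMk
        contMDiff_const
    have hw : IsCompactWeight μ (fun g : G => g) (fun _ => (1 : ℝ)) := by
      refine ⟨?_, aestronglyMeasurable_const, ⟨1, by simp⟩, Set.univ, isCompact_univ, by simp⟩
      exact (continuous_lieExp.comp_aestronglyMeasurable hℓ.measurable).congr hℓ.exp_eq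
    have h1 := (hw.mvfderiv_eq hf 0 1).1
    simp only [one_mul, mvfderiv, mfderiv_eq_fderiv] at h1
    have h2 : (fun s : ℝ => ∫ g, f (g, s) ∂μ) = fun _ => ∫ g, A u (w, Φ.act g w y) ∂μ :=
      funext fun s => integral_mul_left_eq_self (fun g => A u (w, Φ.act g w y)) (lieExp (s • a))
    have h3 : ∀ g, HasDerivAt (fun s : ℝ => f (g, s))
        (Ψ.fbr (fun z => J z a) (A u) (w, Φ.act g w y)) 0 := by
      intro g
      have := (hJ.hamiltonianFlow a).generator w (Φ.act g w y) _ (hA.slice w)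
      refine this.congr_of_eventuallyEq (Filter.Eventually.of_forall fun s => ?_)
      exact congrArg (fun y => A u (w, y)) (Φ.mul_act _ _ _ _)
    have h4 : ∀ g, fderiv ℝ (fun s : ℝ => f (g, s)) 0 1 =
        Ψ.fbr (fun z => J z a) (A u) (w, Φ.act g w y) := by
      intro g
      rw [(h3 g).hasFDerivAt.fderiv]
      simp
    have h5 : fderiv ℝ (fun s : ℝ => ∫ g, f (g, s) ∂μ) 0 1 =
      ∫ g, fderiv ℝ (fun s : ℝ => f (g, s)) 0 1 ∂μ := h1
    simp only [h4, h2] at h5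
    rw [← h5]
    simp
  have h1 : Ψ.hor A u (fun z => J z a) (w, y) =
      ∫ g, Ψ.hor A u (fun z => J z a) (w, Φ.act g w y) ∂μ := by
    simp only [hconst]
    simp
  rw [h1]
  have h2 : ∀ g, Ψ.hor A u (fun z => J z a) (w, Φ.act g w y) =
      dirDeriv u (fun z => J z a) (w, Φ.act g w y) -
        Ψ.fbr (fun z => J z a) (A u) (w, Φ.act g w y) := by
    intro g
    rw [PoissonTensor.hor, PoissonTensor.fbr_skew (A u)]
    ring
  simp only [h2]
  rw [integral_sub (hint (hJa.smooth_dirDeriv u)) (hint (hJa.smooth_fbr Ψ hA)), hbr, hz, sub_zero]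

end GaugeInvariance

section ChartExtension

variable {m : ℕ} {Q : Type*} [TopologicalSpace Q] [ChartedSpace (EuclideanSpace ℝ (Fin m)) Q]
  [IsManifold (𝓡 m) ∞ Q]

/-- The inverse of a chart agrees near the center with a globally defined smooth map. -/
theorem exists_chart_extension (q₀ : Q) : ∃ ρ : EuclideanSpace ℝ (Fin m) → Q,
    ContMDiff (𝓡 m) (𝓡 m) ∞ ρ ∧
      ρ =ᶠ[𝓝 (extChartAt (𝓡 m) q₀ q₀)] (extChartAt (𝓡 m) q₀).symm := by
  set χ := extChartAt (𝓡 m) q₀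
  set w₀ : EuclideanSpace ℝ (Fin m) := χ q₀
  obtain ⟨ε, hε, hεV⟩ := Metric.nhds_basis_closedBall.mem_iff.1
    ((isOpen_extChartAt_target (I := 𝓡 m) q₀).mem_nhds (mem_extChartAt_target q₀))
  let η : ContDiffBump w₀ := ⟨ε / 2, ε, half_pos hε, half_lt_self hε⟩
  set r : EuclideanSpace ℝ (Fin m) → EuclideanSpace ℝ (Fin m) := fun w => w₀ + η w • (w - w₀)
  have hr : ContDiff ℝ ∞ r :=
    contDiff_const.add ((η.contDiff).smul (contDiff_id.sub contDiff_const))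
  have hrt : ∀ w, r w ∈ χ.target := by
    intro w
    apply hεV
    rw [mem_closedBall_iff_norm, show r w - w₀ = η w • (w - w₀) by simp [r], norm_smul]
    by_cases hw : w ∈ Metric.closedBall w₀ ε
    · rw [mem_closedBall_iff_norm] at hw
      rw [Real.norm_of_nonneg η.nonneg]
      calc η w * ‖w - w₀‖ ≤ 1 * ‖w - w₀‖ :=
            mul_le_mul_of_nonneg_right η.le_one (norm_nonneg _)
        _ ≤ ε := by rwa [one_mul]
    · have : η w = 0 := η.zero_of_le_dist (by
        rw [Metric.mem_closedBall, not_le] at hw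
        exact hw.le)
      rw [this]
      simpa using hε.le
  refine ⟨fun w => χ.symm (r w), fun w => ?_, ?_⟩
  · have h1 : ContMDiffAt (𝓡 m) (𝓡 m) ∞ χ.symm (r w) := contMDiffAt_extChartAt_symm_of_mem (hrt w)
    exact h1.comp w hr.contMDiff.contMDiffAt
  · filter_upwards [η.eventuallyEq_one] with w hw
    have : r w = w := by simp [r, hw]
    rw [this]

/-- The differential of a map between manifolds modelled on Euclidean spaces, as a map of the model
spaces. -/
def modelDeriv (ρ : EuclideanSpace ℝ (Fin m) → Q) (w : EuclideanSpace ℝ (Fin m)) :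
    EuclideanSpace ℝ (Fin m) →L[ℝ] EuclideanSpace ℝ (Fin m) :=
  mfderiv (𝓡 m) (𝓡 m) ρ w

omit [IsManifold (𝓡 m) ∞ Q] in
theorem Filter.EventuallyEq.modelDeriv_eq_id {q₀ : Q} {ρ : EuclideanSpace ℝ (Fin m) → Q}
    (h : ρ =ᶠ[𝓝 (extChartAt (𝓡 m) q₀ q₀)] (extChartAt (𝓡 m) q₀).symm) :
    modelDeriv ρ (extChartAt (𝓡 m) q₀ q₀) = ContinuousLinearMap.id ℝ _ := by
  have h1 := h.mfderiv_eq (I := 𝓡 m) (I' := 𝓡 m)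
  have h2 := (hasMFDerivAt_extChartAt_symm_center (E := EuclideanSpace ℝ (Fin m)) q₀).mfderiv
  have h3 : modelDeriv ρ (extChartAt (𝓡 m) q₀ q₀) =
    modelDeriv (extChartAt (𝓡 m) q₀).symm (extChartAt (𝓡 m) q₀ q₀) := h1
  exact h3.trans h2

omit [IsManifold (𝓡 m) ∞ Q] in
theorem Filter.EventuallyEq.modelDeriv_single {q₀ : Q} {ρ : EuclideanSpace ℝ (Fin m) → Q}
    (h : ρ =ᶠ[𝓝 (extChartAt (𝓡 m) q₀ q₀)] (extChartAt (𝓡 m) q₀).symm) (j : Fin m) :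
    ∀ᶠ w in 𝓝 (extChartAt (𝓡 m) q₀ q₀),
      modelDeriv ρ w (EuclideanSpace.single j 1) = coordVec q₀ j (ρ w) := by
  have ht := (isOpen_extChartAt_target (I := 𝓡 m) q₀).mem_nhds (mem_extChartAt_target q₀)
  filter_upwards [h.eventuallyEq_nhds, ht] with w hw hwt
  have h1 : modelDeriv ρ w = modelDeriv (extChartAt (𝓡 m) q₀).symm w :=
    hw.mfderiv_eq (I := 𝓡 m) (I' := 𝓡 m)
  have h2 : extChartAt (𝓡 m) q₀ (ρ w) = w := by
    rw [hw.eq_of_nhds, PartialEquiv.right_inv _ hwt]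
  rw [h1]
  have h3 : coordVec q₀ j (ρ w) = modelDeriv (extChartAt (𝓡 m) q₀).symm
    (extChartAt (𝓡 m) q₀ (ρ w)) (EuclideanSpace.single j 1) := rfl
  rw [h3, h2]

variable {n : ℕ} {N : Type*} [TopologicalSpace N] [ChartedSpace (EuclideanSpace ℝ (Fin n)) N]

/-- The pullback of a function on `Q × N` to a product of a vector space and `N`. -/
def basePull (ρ : EuclideanSpace ℝ (Fin m) → Q) (f : Q × N → ℝ)
    (z : EuclideanSpace ℝ (Fin m) × N) : ℝ := f (ρ z.1, z.2)

variable {ρ : EuclideanSpace ℝ (Fin m) → Q} (hρ : ContMDiff (𝓡 m) (𝓡 m) ∞ ρ)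

include hρ

omit [IsManifold (𝓡 m) ∞ Q] in
theorem contMDiff_basePull {f : Q × N → ℝ} (hf : ContMDiff ((𝓡 m).prod (𝓡 n)) 𝓘(ℝ, ℝ) ∞ f) :
    SmoothFamily n (basePull ρ f) :=
  ContMDiff.comp (I' := (𝓡 m).prod (𝓡 n)) hf ((hρ.comp contMDiff_fst).prodMk contMDiff_snd)

omit [IsManifold (𝓡 m) ∞ Q] in
theorem dirDeriv_basePull {f : Q × N → ℝ} (hf : ContMDiff ((𝓡 m).prod (𝓡 n)) 𝓘(ℝ, ℝ) ∞ f)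
    (u : EuclideanSpace ℝ (Fin m)) (z : EuclideanSpace ℝ (Fin m) × N) :
    dirDeriv u (basePull ρ f) z = dQ f (ρ z.1, z.2) (modelDeriv ρ z.1 u) := by
  have h1 : ContMDiff (𝓡 m) 𝓘(ℝ, ℝ) ∞ (fun q => f (q, z.2)) :=
    hf.comp (contMDiff_id.prodMk contMDiff_const)
  have h2 := ((h1.mdifferentiable (by simp) (ρ z.1)).hasMFDerivAt_dN).comp z.1
    (hρ.mdifferentiable (by simp) z.1).hasMFDerivAt
  have h3 : HasFDerivAt (fun w => f (ρ w, z.2))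
    ((dQ f (ρ z.1, z.2)).comp (modelDeriv ρ z.1)) z.1 := hasMFDerivAt_iff_hasFDerivAt.1 h2
  exact congrArg (fun L : EuclideanSpace ℝ (Fin m) →L[ℝ] ℝ => L u) h3.fderiv

/-- The component of a horizontal form along a map into the base. -/
theorem contMDiff_form_modelDeriv {C : HorizontalForm (m := m) Q N}
    (hC : ContMDiff ((𝓡 m).prod (𝓡 n)) (cotangentModel m) ∞
      (fun x : Q × N => (⟨x.1, C x⟩ : Cotangent (m := m) Q))) (u : EuclideanSpace ℝ (Fin m)) :
    SmoothFamily n (fun z : EuclideanSpace ℝ (Fin m) × N =>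
      C (ρ z.1, z.2) (modelDeriv ρ z.1 u)) := by
  have h1 : ContMDiff ((𝓡 m).prod (𝓡 n)) (cotangentModel m) ∞
      (fun z : EuclideanSpace ℝ (Fin m) × N =>
        (⟨ρ z.1, C (ρ z.1, z.2)⟩ : Cotangent (m := m) Q)) :=
    hC.comp ((hρ.comp contMDiff_fst).prodMk contMDiff_snd)
  have h2 : ContMDiff (𝓡 m) (𝓡 m).tangent ∞ (fun w : EuclideanSpace ℝ (Fin m) =>
      (⟨w, u⟩ : TangentBundle (𝓡 m) (EuclideanSpace ℝ (Fin m)))) :=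
    contMDiff_vectorSpace_iff_contDiff.2 contDiff_const
  have h3 : ContMDiff (𝓡 m) (𝓡 m).tangent ∞ (fun w : EuclideanSpace ℝ (Fin m) =>
      (⟨ρ w, mfderiv (𝓡 m) (𝓡 m) ρ w u⟩ : TangentBundle (𝓡 m) Q)) :=
    (hρ.contMDiff_tangentMap (m := ∞) (by simp)).comp h2
  have h4 := ContMDiff.clm_bundle_apply (E₁ := (TangentSpace (𝓡 m) : Q → Type _))
    (E₂ := Bundle.Trivial Q ℝ) (b := fun z : EuclideanSpace ℝ (Fin m) × N => ρ z.1)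
    (ϕ := fun z => C (ρ z.1, z.2)) (v := fun z => mfderiv (𝓡 m) (𝓡 m) ρ z.1 u) h1
    (h3.comp contMDiff_fst)
  intro z
  exact ((contMDiffAt_totalSpace).1 (h4 z)).2

end ChartExtension

section Transport

theorem integrable_sum_smul {ι T F : Type*} [Fintype ι] [MeasurableSpace T] {ν : Measure T}
    [NormedAddCommGroup F] [NormedSpace ℝ F] {c : ι → T → ℝ} (hc : ∀ i, Integrable (c i) ν)
    (x : ι → F) : Integrable (fun τ => ∑ i, c i τ • x i) ν :=
  integrable_finsetSum _ fun i _ => (hc i).smul_const (x i)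

theorem integrable_clm_of_apply {d : ℕ} {T : Type*} [MeasurableSpace T] {ν : Measure T}
    {F : T → EuclideanSpace ℝ (Fin d) →L[ℝ] ℝ} (h : ∀ v, Integrable (fun τ => F τ v) ν) :
    Integrable F ν := by
  have h1 : F = fun τ => ∑ i, F τ (EuclideanSpace.single i 1) •
      (EuclideanSpace.proj i : EuclideanSpace ℝ (Fin d) →L[ℝ] ℝ) := by
    funext τ
    ext v
    rw [clm_apply_eq_sum]
    simp [mul_comm]
  rw [h1]
  exact integrable_sum_smul (c := fun i τ => F τ (EuclideanSpace.single i 1)) (fun i => h _) _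

variable {k m n : ℕ} {G : Type*} [TopologicalSpace G] [ChartedSpace (EuclideanSpace ℝ (Fin k)) G]
  [Group G]
  {Q : Type*} [TopologicalSpace Q] [ChartedSpace (EuclideanSpace ℝ (Fin m)) Q]
  {N : Type*} [TopologicalSpace N] [ChartedSpace (EuclideanSpace ℝ (Fin n)) N]
  {Ψ : PoissonTensor (𝓡 n) N}
  {Φ : FiberwiseAction (k := k) (m := m) (n := n) G Q N}
  {J : Q × N → Module.Dual ℝ (GroupLieAlgebra (𝓡 k) G)}
  {ρ : EuclideanSpace ℝ (Fin m) → Q}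

/-- The pullback of a fiberwise action under a map into the base. -/
def FiberwiseAction.pullback (Φ : FiberwiseAction (k := k) (m := m) (n := n) G Q N)
    (hρ : ContMDiff (𝓡 m) (𝓡 m) ∞ ρ) :
    FiberwiseAction (k := k) (m := m) (n := n) G (EuclideanSpace ℝ (Fin m)) N where
  act g w y := Φ.act g (ρ w) y
  one_act w y := Φ.one_act (ρ w) y
  mul_act g h w y := Φ.mul_act g h (ρ w) y
  smooth := ContMDiff.comp (I' := (𝓡 k).prod ((𝓡 m).prod (𝓡 n))) Φ.smooth
    (f := fun z : G × EuclideanSpace ℝ (Fin m) × N => (z.1, ρ z.2.1, z.2.2))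
    (contMDiff_fst.prodMk ((hρ.comp (contMDiff_fst.comp contMDiff_snd)).prodMk
      (contMDiff_snd.comp contMDiff_snd)))

theorem IsFiberwiseMomentumMap.pullback (hJ : IsFiberwiseMomentumMap Ψ Φ J)
    (hρ : ContMDiff (𝓡 m) (𝓡 m) ∞ ρ) :
    IsFiberwiseMomentumMap Ψ (Φ.pullback hρ) (fun z => J (ρ z.1, z.2)) :=
  ⟨fun a => contMDiff_basePull hρ (hJ.1 a), fun w => hJ.2 (ρ w)⟩

/-- The components of a horizontal form along a map into the base. -/
def HorizontalForm.components (ρ : EuclideanSpace ℝ (Fin m) → Q) (C : HorizontalForm (m := m) Q N)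
    (u : EuclideanSpace ℝ (Fin m)) (z : EuclideanSpace ℝ (Fin m) × N) : ℝ :=
  C (ρ z.1, z.2) (modelDeriv ρ z.1 u)

theorem isCasimir_components {C : HorizontalForm (m := m) Q N}
    (hC : ∀ (q : Q) (u : TangentSpace (𝓡 m) q) (y : N),
      hamiltonianField Ψ.sharp (fun y' => C (q, y') u) y = 0) (u : EuclideanSpace ℝ (Fin m)) :
    Ψ.IsCasimir (C.components ρ u) := by
  intro w y α
  rw [Ψ.form_skew, Ψ.form_apply]
  have h : (Ψ.sharp y (dN n (fun y => C.components ρ u (w, y)) y) : EuclideanSpace ℝ (Fin n)) = 0 :=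
    hC (ρ w) (modelDeriv ρ w u) y
  have h2 : α (Ψ.sharp y (dN n (fun y => C.components ρ u (w, y)) y)) = 0 :=
    (congrArg α h).trans (map_zero α)
  rw [h2, neg_zero]

variable [IsManifold (𝓡 m) ∞ Q]

omit [TopologicalSpace N] [IsManifold (𝓡 m) ∞ Q] in
theorem dQ_eq_dirDeriv {q₀ : Q} (h : ρ =ᶠ[𝓝 (extChartAt (𝓡 m) q₀ q₀)] (extChartAt (𝓡 m) q₀).symm)
    {f : Q × N → ℝ} {y : N}
    (hf : DifferentiableAt ℝ (fun w => f (ρ w, y)) (extChartAt (𝓡 m) q₀ q₀))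
    (v : EuclideanSpace ℝ (Fin m)) :
    dQ f (q₀, y) v = dirDeriv v (basePull ρ f) (extChartAt (𝓡 m) q₀ q₀, y) := by
  have h1 : HasMFDerivAt (𝓡 m) 𝓘(ℝ, ℝ) (fun w => f (ρ w, y)) (extChartAt (𝓡 m) q₀ q₀)
      (fderiv ℝ (fun w => f (ρ w, y)) (extChartAt (𝓡 m) q₀ q₀)) :=
    hf.hasFDerivAt.hasMFDerivAt
  have h2 := h1.comp q₀
    (hasMFDerivAt_extChartAt_center (E := EuclideanSpace ℝ (Fin m)) q₀)
  have h3 : HasMFDerivAt (𝓡 m) 𝓘(ℝ, ℝ) (fun q => f (q, y)) q₀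
      ((fderiv ℝ (fun w => f (ρ w, y)) (extChartAt (𝓡 m) q₀ q₀)).comp
        (ContinuousLinearMap.id ℝ (EuclideanSpace ℝ (Fin m)))) := by
    refine h2.congr_of_eventuallyEq ?_
    have h4 := (continuousAt_extChartAt (I := 𝓡 m) q₀).eventually h
    filter_upwards [h4, extChartAt_source_mem_nhds (I := 𝓡 m) q₀] with q hq hqs
    simp only [Function.comp_apply]
    rw [hq, PartialEquiv.left_inv _ hqs]
  have h5 : dQ f (q₀, y) = fderiv ℝ (fun w => f (ρ w, y)) (extChartAt (𝓡 m) q₀ q₀) := h3.dN_eq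
  rw [h5]
  rfl

variable [LieGroup (𝓡 k) ∞ G] [T2Space G] [IsManifold (𝓡 n) ∞ N] [T2Space N]

omit [T2Space N] [LieGroup (𝓡 k) ∞ G] [T2Space G] [IsManifold (𝓡 n) ∞ N]
  [IsManifold (𝓡 m) ∞ Q] in
theorem IsFiberwiseMomentumMap.dQ_eq_integrand (hJ : IsFiberwiseMomentumMap Ψ Φ J)
    (hρ : ContMDiff (𝓡 m) (𝓡 m) ∞ ρ) {q₀ : Q}
    (h : ρ =ᶠ[𝓝 (extChartAt (𝓡 m) q₀ q₀)] (extChartAt (𝓡 m) q₀).symm)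
    (a : GroupLieAlgebra (𝓡 k) G) (g : G) (y : N) (v : EuclideanSpace ℝ (Fin m)) :
    dQ (fun z => J z a) (q₀, Φ.act g q₀ y) v = dirDeriv v (fun z => J (ρ z.1, z.2) a)
      (extChartAt (𝓡 m) q₀ q₀, (Φ.pullback hρ).act g (extChartAt (𝓡 m) q₀ q₀) y) := by
  have h0 : ρ (extChartAt (𝓡 m) q₀ q₀) = q₀ := by
    rw [h.eq_of_nhds, extChartAt_to_inv]
  rw [dQ_eq_dirDeriv h ((contMDiff_basePull hρ (hJ.1 a)).differentiableAt _ _)]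
  simp only [FiberwiseAction.pullback, h0]
  rfl

variable [MeasurableSpace G] [BorelSpace G] {μ : Measure G} [IsProbabilityMeasure μ]
  {ℓ : G → GroupLieAlgebra (𝓡 k) G} (hℓ : IsLogarithm μ ℓ)

include hℓ

omit [T2Space N] [BorelSpace G] in
theorem averagedForm_apply (hJ : IsFiberwiseMomentumMap Ψ Φ J) (C : HorizontalForm (m := m) Q N)
    (q : Q) (y : N) (v : EuclideanSpace ℝ (Fin m)) :
    averagedForm μ Φ J ℓ C (q, y) v = C (q, y) v - ∫ g, (∫ t in Set.Ioc (0 : ℝ) 1,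
      dQ (m := m) (fun z => J z (ℓ g)) (q, Φ.act (lieExp (t • ℓ g)) q y) v) ∂μ := by
  obtain ⟨ρ, hρ, h⟩ := exists_chart_extension (m := m) q
  set F : G → ℝ → EuclideanSpace ℝ (Fin m) →L[ℝ] ℝ := fun g t =>
    dQ (m := m) (fun z => J z (ℓ g)) (q, Φ.act (lieExp (t • ℓ g)) q y)
  have hF : ∀ g t v, F g t v = dirDeriv v (fun z => J (ρ z.1, z.2) (ℓ g))
      (extChartAt (𝓡 m) q q, (Φ.pullback hρ).act (lieExp (t • ℓ g)) (extChartAt (𝓡 m) q q) y) :=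
    fun g t v => hJ.dQ_eq_integrand hρ h (ℓ g) _ y v
  have hint1 : ∀ g, Integrable (F g) (volume.restrict (Set.Ioc (0 : ℝ) 1)) := by
    refine fun g => integrable_clm_of_apply fun v => ?_
    simp only [hF]
    have hc : Continuous fun t : ℝ => dirDeriv v (fun z => J (ρ z.1, z.2) (ℓ g))
        (extChartAt (𝓡 m) q q,
          (Φ.pullback hρ).act (lieExp (t • ℓ g)) (extChartAt (𝓡 m) q q) y) := by
      have h1 : SmoothFamily n (fun z => J (ρ z.1, z.2) (ℓ g)) := (hJ.pullback hρ).1 (ℓ g)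
      refine (h1.smooth_dirDeriv v).continuous.comp
        (f := fun t : ℝ => (extChartAt (𝓡 m) q q,
          (Φ.pullback hρ).act (lieExp (t • ℓ g)) (extChartAt (𝓡 m) q q) y)) ?_
      refine Continuous.prodMk continuous_const ?_
      exact (((hJ.pullback hρ).hamiltonianFlow (ℓ g)).smooth_orbit _ y).continuous
    exact (hc.integrableOn_Icc (a := 0) (b := 1)).mono_set Set.Ioc_subset_Icc_self
  have hap1 : ∀ g v, (∫ t in Set.Ioc (0 : ℝ) 1, F g t) v = ∫ t in Set.Ioc (0 : ℝ) 1, F g t v :=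
    fun g v => ContinuousLinearMap.integral_apply (hint1 g) v
  have hint2 : Integrable (fun g => ∫ t in Set.Ioc (0 : ℝ) 1, F g t) μ := by
    refine integrable_clm_of_apply fun v => ?_
    simp only [hap1, hF]
    have h1 := ((hJ.pullback hρ).isAverage hℓ v).integrable (extChartAt (𝓡 m) q q, y)
    exact h1.congr (ae_of_all μ fun g =>
      (hJ.pullback hρ).potential_eq (ℓ g) v (extChartAt (𝓡 m) q q, y))
  have hap2 : (∫ g, (∫ t in Set.Ioc (0 : ℝ) 1, F g t) ∂μ) v =
      ∫ g, (∫ t in Set.Ioc (0 : ℝ) 1, F g t v) ∂μ := by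
    rw [ContinuousLinearMap.integral_apply hint2 v]
    simp only [hap1]
  have hA : averagedForm μ Φ J ℓ C (q, y) v =
      C (q, y) v - (∫ g, (∫ t in (0 : ℝ)..1, F g t) ∂μ) v := rfl
  rw [hA]
  simp only [intervalIntegral.integral_of_le zero_le_one]
  rw [hap2]

omit [T2Space N] [BorelSpace G] in
theorem components_averagedForm (hJ : IsFiberwiseMomentumMap Ψ Φ J)
    (C : HorizontalForm (m := m) Q N) (hρ : ContMDiff (𝓡 m) (𝓡 m) ∞ ρ) :
    HorizontalForm.components ρ (averagedForm μ Φ J ℓ C) =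
      (hJ.pullback hρ).gauge μ ℓ (C.components ρ) := by
  funext u z
  refine (averagedForm_apply hℓ hJ C (ρ z.1) z.2 (modelDeriv ρ z.1 u)).trans ?_
  simp only [IsFiberwiseMomentumMap.gauge, IsFiberwiseMomentumMap.avgPotential,
    (hJ.pullback hρ).potential_eq]
  have h1 : ∀ a g, dirDeriv u (fun z : EuclideanSpace ℝ (Fin m) × N => J (ρ z.1, z.2) a)
      (z.1, (Φ.pullback hρ).act g z.1 z.2) =
      dQ (m := m) (fun z => J z a) (ρ z.1, Φ.act g (ρ z.1) z.2) (modelDeriv ρ z.1 u) :=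
    fun a g => dirDeriv_basePull hρ (hJ.1 a) u _
  simp only [h1]
  rfl

end Transport

section LocalComponents

variable {m n : ℕ}
  {Q : Type*} [TopologicalSpace Q] [ChartedSpace (EuclideanSpace ℝ (Fin m)) Q]
  {N : Type*} [TopologicalSpace N] [ChartedSpace (EuclideanSpace ℝ (Fin n)) N]
  {A : HorizontalForm (m := m) Q N} {ρ : EuclideanSpace ℝ (Fin m) → Q} {q₀ : Q}
  (h : ρ =ᶠ[𝓝 (extChartAt (𝓡 m) q₀ q₀)] (extChartAt (𝓡 m) q₀).symm)

include h

omit [TopologicalSpace N] in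
theorem eventually_coeff_eq (j : Fin m) :
    ∀ᶠ w in 𝓝 (extChartAt (𝓡 m) q₀ q₀), ∀ y : N,
      coeff A q₀ j (ρ w, y) = A.components ρ (EuclideanSpace.single j 1) (w, y) := by
  filter_upwards [h.modelDeriv_single j] with w hw y
  exact (congrArg (fun v : EuclideanSpace ℝ (Fin m) => A (ρ w, y) v) hw).symm

omit [TopologicalSpace N] in
theorem coeff_center (j : Fin m) (y : N) : coeff A q₀ j (q₀, y) =
    A.components ρ (EuclideanSpace.single j 1) (extChartAt (𝓡 m) q₀ q₀, y) := by
  have h0 : ρ (extChartAt (𝓡 m) q₀ q₀) = q₀ := by rw [h.eq_of_nhds, extChartAt_to_inv]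
  rw [← (eventually_coeff_eq h j).self_of_nhds y, h0]

theorem dN_coeff_eq (j : Fin m) (y : N) : dN n (fun y => coeff A q₀ j (q₀, y)) y = dN n (fun y =>
    A.components ρ (EuclideanSpace.single j 1) (extChartAt (𝓡 m) q₀ q₀, y)) y := by
  have h1 : (fun y => coeff A q₀ j (q₀, y)) = fun y =>
      A.components ρ (EuclideanSpace.single j 1) (extChartAt (𝓡 m) q₀ q₀, y) :=
    funext fun y => coeff_center h j y
  exact congrArg (fun f => dN n f y) h1

theorem coordVec_center (j : Fin m) :
    (coordVec q₀ j q₀ : EuclideanSpace ℝ (Fin m)) = EuclideanSpace.single j 1 := by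
  have h0 : ρ (extChartAt (𝓡 m) q₀ q₀) = q₀ := by rw [h.eq_of_nhds, extChartAt_to_inv]
  have h1 := (h.modelDeriv_single j).self_of_nhds
  rw [h.modelDeriv_eq_id, h0] at h1
  exact h1.symm

theorem partialQ_eq (i : Fin m) {f : Q × N → ℝ} {F : EuclideanSpace ℝ (Fin m) × N → ℝ}
    (hF : SmoothFamily n F) {y : N}
    (hf : ∀ᶠ w in 𝓝 (extChartAt (𝓡 m) q₀ q₀), f (ρ w, y) = F (w, y)) :
    partialQ q₀ i f y = dirDeriv (EuclideanSpace.single i 1) F (extChartAt (𝓡 m) q₀ q₀, y) := by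
  have hf' : (fun w => f (ρ w, y)) =ᶠ[𝓝 (extChartAt (𝓡 m) q₀ q₀)] fun w => F (w, y) := hf
  have h1 : partialQ q₀ i f y = dQ f (q₀, y) (EuclideanSpace.single i 1) :=
    congrArg (dQ f (q₀, y)) (coordVec_center h i)
  rw [h1, dQ_eq_dirDeriv h ((hF.differentiableAt _ y).congr_of_eventuallyEq hf')]
  exact congrArg (fun L : EuclideanSpace ℝ (Fin m) →L[ℝ] ℝ => L (EuclideanSpace.single i 1))
    hf'.fderiv_eq

theorem curvature_eq (Ψ : PoissonTensor (𝓡 n) N) (hA : ∀ u, SmoothFamily n (A.components ρ u))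
    (i j : Fin m) (y : N) :
    curvature Ψ A i j q₀ y = Ψ.curv (A.components ρ) (EuclideanSpace.single i 1)
      (EuclideanSpace.single j 1) (extChartAt (𝓡 m) q₀ q₀, y) := by
  have h1 := partialQ_eq h i (f := coeff A q₀ j) (hA (EuclideanSpace.single j 1)) (y := y)
    ((eventually_coeff_eq h j).mono fun w hw => hw y)
  have h2 := partialQ_eq h j (f := coeff A q₀ i) (hA (EuclideanSpace.single i 1)) (y := y)
    ((eventually_coeff_eq h i).mono fun w hw => hw y)
  have h3 : curvature Ψ A i j q₀ y = partialQ q₀ i (coeff A q₀ j) y - partialQ q₀ j (coeff A q₀ i) y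
    + Ψ.form y (dN n (fun y => coeff A q₀ i (q₀, y)) y)
      (dN n (fun y => coeff A q₀ j (q₀, y)) y) := rfl
  rw [h3, h1, h2, dN_coeff_eq h i, dN_coeff_eq h j]
  rfl

variable [IsManifold (𝓡 m) ∞ Q]

/-- A horizontal form with smooth local components is smooth. -/
theorem contMDiffAt_of_components (hA : ∀ u, SmoothFamily n (A.components ρ u)) (y₀ : N) :
    ContMDiffAt ((𝓡 m).prod (𝓡 n)) (cotangentModel m) ∞
      (fun x : Q × N => (⟨x.1, A x⟩ : Cotangent (m := m) Q)) (q₀, y₀) := by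
  have : IsManifold (𝓡 m) 1 Q := IsManifold.of_le (n := ∞) (by exact mod_cast le_top)
  refine (contMDiffAt_hom_bundle (E₁ := (TangentSpace (𝓡 m) : Q → Type _))
    (E₂ := Bundle.Trivial Q ℝ) (fun x : Q × N => (⟨x.1, A x⟩ : Cotangent (m := m) Q))).2
    ⟨contMDiffAt_fst, ?_⟩
  have hs : ContMDiffAt ((𝓡 m).prod (𝓡 n)) 𝓘(ℝ, EuclideanSpace ℝ (Fin m) →L[ℝ] ℝ) ∞
      (fun x : Q × N => ∑ j, A.components ρ (EuclideanSpace.single j 1)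
        (extChartAt (𝓡 m) q₀ x.1, x.2) •
        (EuclideanSpace.proj j : EuclideanSpace ℝ (Fin m) →L[ℝ] ℝ)) (q₀, y₀) := by
    refine contMDiffAt_finsetSum fun j _ => ?_
    have hsm : ContMDiff 𝓘(ℝ, ℝ) 𝓘(ℝ, EuclideanSpace ℝ (Fin m) →L[ℝ] ℝ) ∞ (fun r : ℝ =>
        r • (EuclideanSpace.proj j : EuclideanSpace ℝ (Fin m) →L[ℝ] ℝ)) :=
      (contDiff_id.smul contDiff_const).contMDiff
    refine ContMDiffAt.comp (q₀, y₀) (I' := 𝓘(ℝ, ℝ)) (hsm _) (f := fun x : Q × N =>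
      A.components ρ (EuclideanSpace.single j 1) (extChartAt (𝓡 m) q₀ x.1, x.2)) ?_
    refine ContMDiffAt.comp (I' := (𝓡 m).prod (𝓡 n)) (q₀, y₀) (hA _ _)
      (f := fun x : Q × N => (extChartAt (𝓡 m) q₀ x.1, x.2)) ?_
    exact ((contMDiffAt_extChartAt (I := 𝓡 m) (x := q₀)).comp (q₀, y₀)
      contMDiffAt_fst).prodMk contMDiffAt_snd
  refine hs.congr_of_eventuallyEq ?_
  have h1 : ∀ᶠ q in 𝓝 q₀, ∀ j, ∀ y : N, coeff A q₀ j (q, y) =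
      A.components ρ (EuclideanSpace.single j 1) (extChartAt (𝓡 m) q₀ q, y) := by
    have h2 := (continuousAt_extChartAt (I := 𝓡 m) q₀).eventually
      (h.and (Filter.eventually_all.2 fun j => eventually_coeff_eq (A := A) h j))
    filter_upwards [h2, extChartAt_source_mem_nhds (I := 𝓡 m) q₀] with q hq hqs j y
    rw [← hq.2 j y, hq.1, PartialEquiv.left_inv _ hqs]
  have h2 : ∀ᶠ x : Q × N in 𝓝 (q₀, y₀), x.1 ∈ (chartAt (EuclideanSpace ℝ (Fin m)) q₀).source ∧
      ∀ j, ∀ y : N, coeff A q₀ j (x.1, y) =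
      A.components ρ (EuclideanSpace.single j 1) (extChartAt (𝓡 m) q₀ x.1, y) :=
    (continuous_fst.tendsto (q₀, y₀)).eventually
      (Filter.Eventually.and (chart_source_mem_nhds (EuclideanSpace ℝ (Fin m)) q₀) h1)
  filter_upwards [h2] with x hx
  have h3 := TangentBundle.symmL_trivializationAt (I := 𝓡 m) hx.1
  refine ContinuousLinearMap.ext fun v => ?_
  have h4 : ∀ j, ((trivializationAt (EuclideanSpace ℝ (Fin m))
      (TangentSpace (𝓡 m) : Q → Type _) q₀).symmL ℝ x.1 (EuclideanSpace.single j 1)) =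
      coordVec q₀ j x.1 := by
    intro j
    rw [h3]
    simp only [ModelWithCorners.range_eq_univ, mfderivWithin_univ]
    rfl
  rw [clm_apply_eq_sum]
  simp only [_root_.sum_apply, _root_.smul_apply, ← hx.2]
  refine Finset.sum_congr rfl fun j _ => ?_
  have h5 : coeff A q₀ j (x.1, x.2) = A x (coordVec q₀ j x.1) := rfl
  have h6 : ∀ v, ContinuousLinearMap.inCoordinates (EuclideanSpace ℝ (Fin m))
      (TangentSpace (𝓡 m) : Q → Type _) ℝ (Bundle.Trivial Q ℝ) q₀ x.1 q₀ x.1 (A x) v =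
      A x ((trivializationAt (EuclideanSpace ℝ (Fin m))
        (TangentSpace (𝓡 m) : Q → Type _) q₀).symmL ℝ x.1 v) := by
    intro v
    simp only [ContinuousLinearMap.inCoordinates, ContinuousLinearMap.comp_apply]
    exact congrArg (fun L : ℝ →L[ℝ] ℝ => L _)
      (Bundle.Trivial.continuousLinearMapAt_trivialization ℝ Q ℝ x.1)
  rw [h5, ← h4, smul_eq_mul, smul_eq_mul, mul_comm]
  exact congrArg (· * v j) (h6 _)

end LocalComponents

section AveragedForm

variable {k m n : ℕ} {G : Type*} [TopologicalSpace G] [ChartedSpace (EuclideanSpace ℝ (Fin k)) G]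
  [Group G] [LieGroup (𝓡 k) ∞ G] [T2Space G] [MeasurableSpace G] [BorelSpace G]
  {μ : Measure G} [IsProbabilityMeasure μ]
  {Q : Type*} [TopologicalSpace Q] [ChartedSpace (EuclideanSpace ℝ (Fin m)) Q]
  [IsManifold (𝓡 m) ∞ Q]
  {N : Type*} [TopologicalSpace N] [ChartedSpace (EuclideanSpace ℝ (Fin n)) N]
  [IsManifold (𝓡 n) ∞ N]
  {Ψ : PoissonTensor (𝓡 n) N}
  {Φ : FiberwiseAction (k := k) (m := m) (n := n) G Q N}
  {J : Q × N → Module.Dual ℝ (GroupLieAlgebra (𝓡 k) G)}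
  (hJ : IsFiberwiseMomentumMap Ψ Φ J)
  {ℓ : G → GroupLieAlgebra (𝓡 k) G} (hℓ : IsLogarithm μ ℓ)
  {C : HorizontalForm (m := m) Q N}
  (hC : ContMDiff ((𝓡 m).prod (𝓡 n)) (cotangentModel m) ∞
    (fun x : Q × N => (⟨x.1, C x⟩ : Cotangent (m := m) Q)))

include hJ hℓ hC

omit [BorelSpace G] in
theorem smooth_components_averagedForm {ρ : EuclideanSpace ℝ (Fin m) → Q}
    (hρ : ContMDiff (𝓡 m) (𝓡 m) ∞ ρ) (u : EuclideanSpace ℝ (Fin m)) :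
    SmoothFamily n (HorizontalForm.components ρ (averagedForm μ Φ J ℓ C) u) := by
  rw [components_averagedForm hℓ hJ C hρ]
  exact (hJ.pullback hρ).smooth_gauge hℓ (contMDiff_form_modelDeriv hρ hC) u

omit [BorelSpace G] in
/-- The averaged form is smooth. -/
theorem contMDiff_averagedForm : ContMDiff ((𝓡 m).prod (𝓡 n)) (cotangentModel m) ∞
    (fun x : Q × N => (⟨x.1, averagedForm μ Φ J ℓ C x⟩ : Cotangent (m := m) Q)) := by
  rintro ⟨q, y⟩
  obtain ⟨ρ, hρ, h⟩ := exists_chart_extension (m := m) q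
  exact contMDiffAt_of_components h (smooth_components_averagedForm hJ hℓ hC hρ) y

variable [T2Space N] [CompactSpace G] [μ.IsHaarMeasure]
  (hCc : ∀ (q : Q) (u : TangentSpace (𝓡 m) q) (y : N),
    hamiltonianField Ψ.sharp (fun y' => C (q, y') u) y = 0)

include hCc

theorem curvature_averagedForm_act (g : G) (i j : Fin m) (q : Q) (y : N) :
    curvature Ψ (averagedForm μ Φ J ℓ C) i j q (Φ.act g q y) =
      curvature Ψ (averagedForm μ Φ J ℓ C) i j q y := by
  obtain ⟨ρ, hρ, h⟩ := exists_chart_extension (m := m) q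
  have h0 : ρ (extChartAt (𝓡 m) q q) = q := by rw [h.eq_of_nhds, extChartAt_to_inv]
  have hA := fun u => smooth_components_averagedForm hJ hℓ hC hρ u
  rw [curvature_eq h Ψ hA, curvature_eq h Ψ hA, components_averagedForm hℓ hJ C hρ]
  have h1 := ((hJ.pullback hρ).gauge_invariant hℓ (contMDiff_form_modelDeriv hρ hC)
    (isCasimir_components hCc) g).2.1 (EuclideanSpace.single i 1) (EuclideanSpace.single j 1)
    (extChartAt (𝓡 m) q q, y)
  simp only [FiberwiseAction.pullback, h0] at h1
  exact h1

theorem hor_averagedForm_act (g : G) {f : N → ℝ} (hf : ContMDiff (𝓡 n) 𝓘(ℝ, ℝ) ∞ f) (i : Fin m)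
    (q : Q) (y : N) :
    dQ (m := m) (fun z => f (Φ.act g z.1 z.2)) (q, y) (EuclideanSpace.single i 1) +
      Ψ.form y (dN n (fun y => coeff (averagedForm μ Φ J ℓ C) q i (q, y)) y)
        (dN n (fun y => f (Φ.act g q y)) y) =
      Ψ.form (Φ.act g q y)
        (dN n (fun y => coeff (averagedForm μ Φ J ℓ C) q i (q, y)) (Φ.act g q y))
        (dN n f (Φ.act g q y)) := by
  obtain ⟨ρ, hρ, h⟩ := exists_chart_extension (m := m) q
  have h0 : ρ (extChartAt (𝓡 m) q q) = q := by rw [h.eq_of_nhds, extChartAt_to_inv]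
  have hf' : ContMDiff ((𝓡 m).prod (𝓡 n)) 𝓘(ℝ, ℝ) ∞ (fun z : Q × N => f (Φ.act g z.1 z.2)) :=
    hf.comp (Φ.smooth_act g)
  rw [dQ_eq_dirDeriv h ((contMDiff_basePull hρ hf').differentiableAt _ _), dN_coeff_eq h,
    dN_coeff_eq h, components_averagedForm hℓ hJ C hρ]
  have h1 := ((hJ.pullback hρ).gauge_invariant hℓ (contMDiff_form_modelDeriv hρ hC)
    (isCasimir_components hCc) g).1 (SmoothFamily.of_function hf) (EuclideanSpace.single i 1)
    (extChartAt (𝓡 m) q q, y)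
  simp only [PoissonTensor.hor, PoissonTensor.fbr, PoissonTensor.br, fpull,
    FiberwiseAction.pullback, h0] at h1
  have h2 : ∀ z, dirDeriv (EuclideanSpace.single i (1 : ℝ))
      (fun z : EuclideanSpace ℝ (Fin m) × N => f z.2) z = 0 := by
    intro z
    simp [dirDeriv]
  rw [h2, zero_add] at h1
  exact h1

omit hC hCc [BorelSpace G] [IsProbabilityMeasure μ] [CompactSpace G] in
theorem br_act (g : G) {f f' : N → ℝ} (hf : ContMDiff (𝓡 n) 𝓘(ℝ, ℝ) ∞ f)
    (hf' : ContMDiff (𝓡 n) 𝓘(ℝ, ℝ) ∞ f') (q : Q) (y : N) :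
    Ψ.br (fun y => f (Φ.act g q y)) (fun y => f' (Φ.act g q y)) y = Ψ.br f f' (Φ.act g q y) := by
  obtain ⟨ρ, hρ, h⟩ := exists_chart_extension (m := m) q
  have h0 : ρ (extChartAt (𝓡 m) q q) = q := by rw [h.eq_of_nhds, extChartAt_to_inv]
  obtain ⟨b, hb⟩ := hℓ.lieExp_surjective g
  rw [← one_smul ℝ b] at hb
  have h1 := ((hJ.pullback hρ).isTwist_act b 1 hb).br (SmoothFamily.of_function hf)
    (SmoothFamily.of_function hf') (extChartAt (𝓡 m) q q, y)
  simp only [PoissonTensor.fbr, fpull, FiberwiseAction.pullback, h0] at h1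
  exact h1

theorem hor_momentum_eq_zero (a : GroupLieAlgebra (𝓡 k) G) (i : Fin m) (q : Q) (y : N)
    (hz : ∫ g, dQ (m := m) (fun z => J z a) (q, Φ.act g q y) ∂μ = 0) :
    dQ (m := m) (fun z => J z a) (q, y) (EuclideanSpace.single i 1) +
      Ψ.form y (dN n (fun y => coeff (averagedForm μ Φ J ℓ C) q i (q, y)) y)
        (dN n (fun y => J (q, y) a) y) = 0 := by
  obtain ⟨ρ, hρ, h⟩ := exists_chart_extension (m := m) q
  have h0 : ρ (extChartAt (𝓡 m) q q) = q := by rw [h.eq_of_nhds, extChartAt_to_inv]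
  have hJa : SmoothFamily n (fun z : EuclideanSpace ℝ (Fin m) × N => J (ρ z.1, z.2) a) :=
    (hJ.pullback hρ).1 a
  have hval : ∀ g v, dQ (m := m) (fun z => J z a) (q, Φ.act g q y) v =
      dirDeriv v (fun z => J (ρ z.1, z.2) a)
        (extChartAt (𝓡 m) q q, (Φ.pullback hρ).act g (extChartAt (𝓡 m) q q) y) := fun g v =>
    hJ.dQ_eq_integrand hρ h a g y v
  have hint : Integrable (fun g => dQ (m := m) (fun z => J z a) (q, Φ.act g q y)) μ := by
    refine integrable_clm_of_apply fun v => ?_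
    simp only [hval]
    refine Continuous.integrable_of_hasCompactSupport ?_ (HasCompactSupport.of_compactSpace _)
    refine (hJa.smooth_dirDeriv v).continuous.comp (f := fun g =>
      (extChartAt (𝓡 m) q q, (Φ.pullback hρ).act g (extChartAt (𝓡 m) q q) y)) ?_
    refine Continuous.prodMk continuous_const ?_
    exact (Φ.pullback hρ).smooth.continuous.comp (f := fun g => (g, extChartAt (𝓡 m) q q, y))
      (Continuous.prodMk continuous_id continuous_const)
  have hz' : ∫ g, dirDeriv (EuclideanSpace.single i 1) (fun z => J (ρ z.1, z.2) a)
      (extChartAt (𝓡 m) q q, (Φ.pullback hρ).act g (extChartAt (𝓡 m) q q) y) ∂μ = 0 := by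
    have h1 := ContinuousLinearMap.integral_apply hint (EuclideanSpace.single i 1)
    simp only [hz, hval] at h1
    exact h1.symm
  have h1 := (hJ.pullback hρ).hor_eq_zero hℓ (contMDiff_form_modelDeriv hρ hC)
    (isCasimir_components hCc) a (EuclideanSpace.single i 1) (extChartAt (𝓡 m) q q, y) hz'
  have hd := hJa.differentiableAt (extChartAt (𝓡 m) q q) y
  rw [dQ_eq_dirDeriv h hd, dN_coeff_eq h, components_averagedForm hℓ hJ C hρ]
  simp only [PoissonTensor.hor, PoissonTensor.fbr, PoissonTensor.br, h0] at h1
  exact h1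

end AveragedForm

section BundleProjection

/-- In the charts of a bundle, the projection is the first component. -/
theorem hasMFDerivAt_bundle_proj {B F : Type*} {E : B → Type*} [NormedAddCommGroup F]
    [NormedSpace ℝ F] [TopologicalSpace (TotalSpace F E)] [∀ x, TopologicalSpace (E x)]
    {EB : Type*} [NormedAddCommGroup EB] [NormedSpace ℝ EB] {HB : Type*} [TopologicalSpace HB]
    (IB : ModelWithCorners ℝ EB HB) [IB.Boundaryless] [TopologicalSpace B] [ChartedSpace HB B]
    [FiberBundle F E] (x : TotalSpace F E) :
    HasMFDerivAt (IB.prod 𝓘(ℝ, F)) IB (TotalSpace.proj : TotalSpace F E → B) x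
      (ContinuousLinearMap.fst ℝ EB F) := by
  refine ⟨(FiberBundle.continuous_proj F E).continuousAt, ?_⟩
  have h1 : (writtenInExtChartAt (IB.prod 𝓘(ℝ, F)) IB x (TotalSpace.proj : TotalSpace F E → B))
      =ᶠ[𝓝 (extChartAt (IB.prod 𝓘(ℝ, F)) x x)] Prod.fst := by
    filter_upwards [extChartAt_target_mem_nhds (I := IB.prod 𝓘(ℝ, F)) x] with z hz
    have h2 := (extChartAt (IB.prod 𝓘(ℝ, F)) x).right_inv hz
    have h3 := (extChartAt (IB.prod 𝓘(ℝ, F)) x).map_target hz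
    set p := (extChartAt (IB.prod 𝓘(ℝ, F)) x).symm z with hp
    have h4 : p ∈ (trivializationAt F E x.proj).source := by
      rw [FiberBundle.extChartAt, PartialEquiv.trans_source] at h3
      exact h3.1
    have h5 : (extChartAt (IB.prod 𝓘(ℝ, F)) x p).1 = extChartAt IB x.proj p.proj := by
      rw [FiberBundle.extChartAt]
      simp only [PartialEquiv.coe_trans, Function.comp_apply, PartialEquiv.prod_coe]
      exact congrArg (extChartAt IB x.proj) ((trivializationAt F E x.proj).coe_fst h4)
    simp only [writtenInExtChartAt, Function.comp_apply]
    rw [← hp, ← h5, h2]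
  refine (HasFDerivWithinAt.congr_of_eventuallyEq (hasFDerivWithinAt_fst)
    (h1.filter_mono nhdsWithin_le_nhds) h1.eq_of_nhds)

end BundleProjection

section LinearAlgebra

variable {V V' : Type*} [TopologicalSpace V] [AddCommGroup V] [Module ℝ V]
  [TopologicalSpace V'] [AddCommGroup V'] [Module ℝ V'] {m : ℕ}

theorem couplingTensor_apply (u v : Fin m → V) (F : Fin m → Fin m → ℝ) (α : V →L[ℝ] ℝ) :
    couplingTensor u v F α = ∑ i, (α (u i) • v i - α (v i) • u i) +
      (1 / 2 : ℝ) • ∑ i, ∑ j, F i j • (α (u i) • u j - α (u j) • u i) := by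
  simp only [couplingTensor, LinearMap.add_apply, LinearMap.smul_apply, LinearMap.sum_apply]
  rfl

/-- A linear map carries coupling tensors to coupling tensors. -/
theorem map_couplingTensor (L : V →L[ℝ] V') {u v : Fin m → V} {u' v' : Fin m → V'}
    (hu : ∀ i, L (u i) = u' i) (hv : ∀ i, L (v i) = v' i) (F : Fin m → Fin m → ℝ)
    (α : V' →L[ℝ] ℝ) :
    L (couplingTensor u v F (α.comp L)) = couplingTensor u' v' F α := by
  simp only [couplingTensor_apply, ContinuousLinearMap.comp_apply, hu, hv, map_add, map_sum,
    map_smul, map_sub]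

theorem couplingTensor_skew (u v : Fin m → V) (F : Fin m → Fin m → ℝ) (α β : V →L[ℝ] ℝ) :
    β (couplingTensor u v F α) = -α (couplingTensor u v F β) := by
  simp only [couplingTensor_apply, map_add, map_sum, map_smul, map_sub, smul_eq_mul, neg_add,
    ← mul_neg, ← Finset.sum_neg_distrib]
  congr 1
  · exact Finset.sum_congr rfl fun i _ => by ring
  · congr 1
    exact Finset.sum_congr rfl fun i _ => Finset.sum_congr rfl fun j _ => by ring

theorem couplingTensor_eq_zero {u v : Fin m → V} (F : Fin m → Fin m → ℝ) {α : V →L[ℝ] ℝ}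
    (hu : ∀ i, α (u i) = 0) (hv : ∀ i, α (v i) = 0) : couplingTensor u v F α = 0 := by
  simp [couplingTensor_apply, hu, hv]

end LinearAlgebra

section Invariance

variable {E : Type*} [NormedAddCommGroup E] [NormedSpace ℝ E]
  {H : Type*} [TopologicalSpace H] {I : ModelWithCorners ℝ E H}
  {M : Type*} [TopologicalSpace M] [ChartedSpace H M]

theorem tensorInvariant_of_hasMFDerivAt {P : TwoTensorField I M} {φ : M → M}
    (h : ∀ x, ∃ L : TangentSpace I x →L[ℝ] TangentSpace I (φ x), HasMFDerivAt I I φ x L ∧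
      ∀ α : TangentSpace I (φ x) →L[ℝ] ℝ, L (P x (α.comp L)) = P (φ x) α) :
    TensorInvariant P φ := by
  intro x α
  obtain ⟨L, hL, h⟩ := h x
  rw [hL.mfderiv]
  exact h α

theorem mvfderiv_eq_comp_of_invariant {φ ψ : M → M} (hφ : MDifferentiable I I φ)
    (hψ : MDifferentiable I I ψ) (hinv : ∀ x, ψ (φ x) = x)
    (hinv' : ∀ x, φ (ψ x) = x) {h : M → ℝ} (hh : ∀ x, h (φ x) = h x)
    (x : M) : mvfderiv I h x = (mvfderiv I h (φ x)).comp (mfderiv I I φ x) := by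
  by_cases hd : MDifferentiableAt I 𝓘(ℝ, ℝ) h (φ x)
  · have h1 : h = h ∘ φ := funext fun x => (hh x).symm
    conv_lhs => rw [h1]
    exact mvfderiv_comp x hd (hφ x)
  · have hd' : ¬ MDifferentiableAt I 𝓘(ℝ, ℝ) h x := by
      intro hx
      apply hd
      have h1 : MDifferentiableAt I 𝓘(ℝ, ℝ) (h ∘ ψ) (φ x) :=
        MDifferentiableAt.comp (φ x) (by rwa [hinv]) (hψ (φ x))
      have h2 : h ∘ ψ = h := funext fun z => by rw [Function.comp_apply, ← hh, hinv']
      rwa [h2] at h1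
    rw [mvfderiv, mvfderiv, mfderiv_zero_of_not_mdifferentiableAt hd,
      mfderiv_zero_of_not_mdifferentiableAt hd']
    rfl

/-- The Hamiltonian vector field of an invariant function is invariant if the tensor is. -/
theorem TensorInvariant.fieldInvariant {P : TwoTensorField I M} {φ ψ : M → M}
    (hP : TensorInvariant P φ) (hφ : MDifferentiable I I φ)
    (hψ : MDifferentiable I I ψ) (hinv : ∀ x, ψ (φ x) = x)
    (hinv' : ∀ x, φ (ψ x) = x) {h : M → ℝ} (hh : ∀ x, h (φ x) = h x) :
    FieldInvariant (hamiltonianField P h) φ := by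
  intro x
  rw [hamiltonianField, mvfderiv_eq_comp_of_invariant hφ hψ hinv hinv' hh]
  exact hP x _

end Invariance

section LiftedAction

variable {k m n : ℕ} {G : Type*} [TopologicalSpace G] [ChartedSpace (EuclideanSpace ℝ (Fin k)) G]
  [Group G]
  {Q : Type*} [TopologicalSpace Q] [ChartedSpace (EuclideanSpace ℝ (Fin m)) Q]
  {N : Type*} [TopologicalSpace N] [ChartedSpace (EuclideanSpace ℝ (Fin n)) N]

/-- The differential of a function on a product is the sum of its partial differentials. -/
theorem MDifferentiableAt.hasMFDerivAt_dQ_dN {F : Q × N → ℝ} {z : Q × N}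
    (hF : MDifferentiableAt ((𝓡 m).prod (𝓡 n)) 𝓘(ℝ, ℝ) F z) :
    HasMFDerivAt ((𝓡 m).prod (𝓡 n)) 𝓘(ℝ, ℝ) F z
      ((dQ (m := m) F z).coprod (dN n (fun y => F (z.1, y)) z.2)) := by
  have h := hF.hasMFDerivAt
  rw [mfderiv_prod_eq_add_comp hF] at h
  exact h

variable [IsManifold (𝓡 m) ∞ Q]

theorem hasMFDerivAt_tauBar (x : Cotangent (m := m) Q × N) :
    HasMFDerivAt (phaseModel m n) ((𝓡 m).prod (𝓡 n)) (tauBar (m := m) (Q := Q) (N := N)) x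
      (((ContinuousLinearMap.fst ℝ (EuclideanSpace ℝ (Fin m))
        (EuclideanSpace ℝ (Fin m) →L[ℝ] ℝ)).prodMap
        (ContinuousLinearMap.id ℝ (EuclideanSpace ℝ (Fin n))))) := by
  have h1 := (hasMFDerivAt_bundle_proj (F := EuclideanSpace ℝ (Fin m) →L[ℝ] ℝ)
    (E := fun q : Q => TangentSpace (𝓡 m) q →L[ℝ] ℝ) (𝓡 m) x.1).comp x
    (hasMFDerivAt_fst (I := cotangentModel m) (I' := 𝓡 n) x)
  exact h1.prodMk (hasMFDerivAt_snd (I := cotangentModel m) (I' := 𝓡 n) x)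

/-- The differential of the action on `Q × N`, as a map of model spaces. -/
def FiberwiseAction.actDeriv (Φ : FiberwiseAction (k := k) (m := m) (n := n) G Q N) (g : G)
    (z : Q × N) : EuclideanSpace ℝ (Fin m) × EuclideanSpace ℝ (Fin n) →L[ℝ]
      EuclideanSpace ℝ (Fin n) :=
  mfderiv ((𝓡 m).prod (𝓡 n)) (𝓡 n) (fun z : Q × N => Φ.act g z.1 z.2) z

/-- The differential of the lifted action, as a map of model spaces. -/
def FiberwiseAction.liftDeriv (Φ : FiberwiseAction (k := k) (m := m) (n := n) G Q N) (g : G)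
    (x : Cotangent (m := m) Q × N) :
    (EuclideanSpace ℝ (Fin m) × (EuclideanSpace ℝ (Fin m) →L[ℝ] ℝ)) × EuclideanSpace ℝ (Fin n) →L[ℝ]
    (EuclideanSpace ℝ (Fin m) × (EuclideanSpace ℝ (Fin m) →L[ℝ] ℝ)) × EuclideanSpace ℝ (Fin n) :=
  (ContinuousLinearMap.fst ℝ _ _).prod ((Φ.actDeriv g (tauBar x)).comp
    ((ContinuousLinearMap.fst ℝ (EuclideanSpace ℝ (Fin m))
        (EuclideanSpace ℝ (Fin m) →L[ℝ] ℝ)).prodMap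
        (ContinuousLinearMap.id ℝ (EuclideanSpace ℝ (Fin n)))))

omit [IsManifold (𝓡 m) ∞ Q] in
theorem FiberwiseAction.hasMFDerivAt_act
    (Φ : FiberwiseAction (k := k) (m := m) (n := n) G Q N) (g : G) (z : Q × N) :
    HasMFDerivAt ((𝓡 m).prod (𝓡 n)) (𝓡 n) (fun z : Q × N => Φ.act g z.1 z.2) z
      (Φ.actDeriv g z) :=
  ((Φ.smooth_act g z).mdifferentiableAt (by simp)).hasMFDerivAt

theorem FiberwiseAction.hasMFDerivAt_lift
    (Φ : FiberwiseAction (k := k) (m := m) (n := n) G Q N) (g : G)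
    (x : Cotangent (m := m) Q × N) :
    HasMFDerivAt (phaseModel m n) (phaseModel m n) (Φ.lift g) x (Φ.liftDeriv g x) := by
  have h1 := (Φ.hasMFDerivAt_act g (tauBar x)).comp x (hasMFDerivAt_tauBar x)
  exact (hasMFDerivAt_fst (I := cotangentModel m) (I' := 𝓡 n) x).prodMk h1

omit [IsManifold (𝓡 m) ∞ Q] in
theorem FiberwiseAction.lift_lift_inv (Φ : FiberwiseAction (k := k) (m := m) (n := n) G Q N)
    (g : G) (x : Cotangent (m := m) Q × N) : Φ.lift g (Φ.lift g⁻¹ x) = x := by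
  simp [FiberwiseAction.lift, ← Φ.mul_act, Φ.one_act]

omit [IsManifold (𝓡 m) ∞ Q] in
/-- The chain rule for a function on `N` and the action. -/
theorem FiberwiseAction.dN_actDeriv (Φ : FiberwiseAction (k := k) (m := m) (n := n) G Q N)
    (g : G) {f : N → ℝ} (hf : ContMDiff (𝓡 n) 𝓘(ℝ, ℝ) ∞ f) (q : Q) (y : N)
    (v : EuclideanSpace ℝ (Fin m)) (w : EuclideanSpace ℝ (Fin n)) :
    dN n f (Φ.act g q y) (Φ.actDeriv g (q, y) (v, w)) =
      dQ (m := m) (fun z => f (Φ.act g z.1 z.2)) (q, y) v +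
        dN n (fun y => f (Φ.act g q y)) y w := by
  have h1 := HasMFDerivAt.comp (q, y) (((hf (Φ.act g q y)).mdifferentiableAt
    (by simp)).hasMFDerivAt_dN) (Φ.hasMFDerivAt_act g (q, y))
  have h2 := h1.mdifferentiableAt.hasMFDerivAt_dQ_dN
  have h3 := hasMFDerivAt_unique h1 h2
  exact congrArg (fun T : EuclideanSpace ℝ (Fin m) × EuclideanSpace ℝ (Fin n) →L[ℝ] ℝ => T (v, w)) h3

end LiftedAction

section GaugeTensor

theorem eq_of_forall_covector {d : ℕ} {v w : EuclideanSpace ℝ (Fin d)}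
    (h : ∀ α : EuclideanSpace ℝ (Fin d) →L[ℝ] ℝ, α v = α w) : v = w := by
  ext i
  exact h (EuclideanSpace.proj i)

theorem map_add_tensor {V V' : Type*} [TopologicalSpace V] [AddCommGroup V] [Module ℝ V]
    [TopologicalSpace V'] [AddCommGroup V'] [Module ℝ V'] (L : V →L[ℝ] V')
    (S T : (V →L[ℝ] ℝ) →ₗ[ℝ] V) (α : V →L[ℝ] ℝ) : L ((S + T) α) = L (S α) + L (T α) :=
  map_add L _ _

variable {n : ℕ} {N : Type*} [TopologicalSpace N] [ChartedSpace (EuclideanSpace ℝ (Fin n)) N] in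
/-- The Hamiltonian vector of a covector, in the model space. -/
def PoissonTensor.modelSharp (Ψ : PoissonTensor (𝓡 n) N) (y : N)
    (α : EuclideanSpace ℝ (Fin n) →L[ℝ] ℝ) : EuclideanSpace ℝ (Fin n) := Ψ.sharp y α

variable {k m n : ℕ} {G : Type*} [TopologicalSpace G] [ChartedSpace (EuclideanSpace ℝ (Fin k)) G]
  [Group G] {Q : Type*} [TopologicalSpace Q] [ChartedSpace (EuclideanSpace ℝ (Fin m)) Q]
  [IsManifold (𝓡 m) ∞ Q]
  {N : Type*} [TopologicalSpace N] [ChartedSpace (EuclideanSpace ℝ (Fin n)) N] in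
theorem liftDeriv_vecP (Φ : FiberwiseAction (k := k) (m := m) (n := n) G Q N) (g : G)
    (x : Cotangent (m := m) Q × N) (i : Fin m) :
    Φ.liftDeriv g x (vecP (n := n) x i) = vecP (n := n) (Φ.lift g x) i := by
  have h : Φ.actDeriv g (x.1.proj, x.2) 0 = 0 := map_zero _
  exact congrArg (fun w : EuclideanSpace ℝ (Fin n) =>
    (((0, EuclideanSpace.proj i), w) : (EuclideanSpace ℝ (Fin m) ×
      (EuclideanSpace ℝ (Fin m) →L[ℝ] ℝ)) × EuclideanSpace ℝ (Fin n))) h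

variable {k m n : ℕ} {G : Type*} [TopologicalSpace G] [ChartedSpace (EuclideanSpace ℝ (Fin k)) G]
  [Group G] [LieGroup (𝓡 k) ∞ G] [T2Space G] [MeasurableSpace G] [BorelSpace G]
  {μ : Measure G} [IsProbabilityMeasure μ]
  {Q : Type*} [TopologicalSpace Q] [ChartedSpace (EuclideanSpace ℝ (Fin m)) Q]
  [IsManifold (𝓡 m) ∞ Q]
  {N : Type*} [TopologicalSpace N] [ChartedSpace (EuclideanSpace ℝ (Fin n)) N]
  [IsManifold (𝓡 n) ∞ N] [T2Space N] [CompactSpace G] [μ.IsHaarMeasure]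
  {Ψ : PoissonTensor (𝓡 n) N}
  {Φ : FiberwiseAction (k := k) (m := m) (n := n) G Q N}
  {J : Q × N → Module.Dual ℝ (GroupLieAlgebra (𝓡 k) G)}
  (hJ : IsFiberwiseMomentumMap Ψ Φ J)
  {ℓ : G → GroupLieAlgebra (𝓡 k) G} (hℓ : IsLogarithm μ ℓ)
  {C : HorizontalForm (m := m) Q N}
  (hC : ContMDiff ((𝓡 m).prod (𝓡 n)) (cotangentModel m) ∞
    (fun x : Q × N => (⟨x.1, C x⟩ : Cotangent (m := m) Q)))
  (hCc : ∀ (q : Q) (u : TangentSpace (𝓡 m) q) (y : N),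
    hamiltonianField Ψ.sharp (fun y' => C (q, y') u) y = 0)

include hJ hℓ

omit [BorelSpace G] [IsProbabilityMeasure μ] [CompactSpace G] in
theorem actDeriv_sharp (g : G) (q : Q) (y : N)
    (β : EuclideanSpace ℝ (Fin n) →L[ℝ] ℝ) :
    Φ.actDeriv g (q, y) (0, Ψ.modelSharp y ((β.comp (Φ.actDeriv g (q, y))).comp
      (ContinuousLinearMap.inr ℝ (EuclideanSpace ℝ (Fin m)) (EuclideanSpace ℝ (Fin n))))) =
      Ψ.modelSharp (Φ.act g q y) β := by
  refine eq_of_forall_covector fun α => ?_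
  obtain ⟨f, hf, rfl⟩ := exists_dN_eq (n := n) (Φ.act g q y) β
  obtain ⟨f', hf', rfl⟩ := exists_dN_eq (n := n) (Φ.act g q y) α
  rw [Φ.dN_actDeriv g hf', map_zero, zero_add]
  have h1 : ((dN n f (Φ.act g q y)).comp (Φ.actDeriv g (q, y))).comp
      (ContinuousLinearMap.inr ℝ (EuclideanSpace ℝ (Fin m)) (EuclideanSpace ℝ (Fin n))) =
      dN n (fun y => f (Φ.act g q y)) y := by
    refine ContinuousLinearMap.ext fun w => ?_
    have := Φ.dN_actDeriv g hf q y 0 w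
    rw [map_zero, zero_add] at this
    exact this
  rw [h1]
  exact br_act hJ hℓ g hf hf' q y

include hC hCc

theorem actDeriv_hor (g : G) (q : Q) (y : N) (i : Fin m) :
    Φ.actDeriv g (q, y) (EuclideanSpace.single i 1,
      Ψ.modelSharp y (dN n (fun y => coeff (averagedForm μ Φ J ℓ C) q i (q, y)) y)) =
      Ψ.modelSharp (Φ.act g q y)
        (dN n (fun y => coeff (averagedForm μ Φ J ℓ C) q i (q, y)) (Φ.act g q y)) := by
  refine eq_of_forall_covector fun α => ?_
  obtain ⟨f, hf, rfl⟩ := exists_dN_eq (n := n) (Φ.act g q y) α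
  rw [Φ.dN_actDeriv g hf]
  exact hor_averagedForm_act hJ hℓ hC hCc g hf i q y

omit hC hCc [BorelSpace G] [IsProbabilityMeasure μ] [CompactSpace G] in
theorem liftDeriv_verticalTensor (g : G) (x : Cotangent (m := m) Q × N)
    (α : TangentSpace (phaseModel m n) (Φ.lift g x) →L[ℝ] ℝ)
    (L : TangentSpace (phaseModel m n) x →L[ℝ] TangentSpace (phaseModel m n) (Φ.lift g x))
    (hL : L = Φ.liftDeriv g x) :
    L (verticalTensor Ψ x (α.comp L)) = verticalTensor Ψ (Φ.lift g x) α := by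
  subst hL
  obtain ⟨α', rfl⟩ : ∃ α' : (EuclideanSpace ℝ (Fin m) × (EuclideanSpace ℝ (Fin m) →L[ℝ] ℝ)) ×
    EuclideanSpace ℝ (Fin n) →L[ℝ] ℝ, α' = α := ⟨α, rfl⟩
  have h1 := actDeriv_sharp hJ hℓ g x.1.proj x.2
    (α'.comp (ContinuousLinearMap.inr ℝ _ (EuclideanSpace ℝ (Fin n))))
  exact congrArg (fun w : EuclideanSpace ℝ (Fin n) =>
    ((0, w) : (EuclideanSpace ℝ (Fin m) ×
      (EuclideanSpace ℝ (Fin m) →L[ℝ] ℝ)) × EuclideanSpace ℝ (Fin n))) h1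

theorem liftDeriv_vecHor (g : G) (x : Cotangent (m := m) Q × N) (i : Fin m) :
    Φ.liftDeriv g x (vecHor Ψ (averagedForm μ Φ J ℓ C) x i) =
      vecHor Ψ (averagedForm μ Φ J ℓ C) (Φ.lift g x) i :=
  congrArg (fun w : EuclideanSpace ℝ (Fin n) =>
    (((EuclideanSpace.single i 1, 0), w) : (EuclideanSpace ℝ (Fin m) ×
      (EuclideanSpace ℝ (Fin m) →L[ℝ] ℝ)) × EuclideanSpace ℝ (Fin n)))
    (actDeriv_hor hJ hℓ hC hCc g x.1.proj x.2 i)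

/-- The gauge tensor of the averaged form is invariant. -/
theorem tensorInvariant_gaugeTensor (g : G) :
    TensorInvariant (gaugeTensor Ψ (averagedForm μ Φ J ℓ C)) (Φ.lift g) := by
  refine tensorInvariant_of_hasMFDerivAt fun x => ⟨Φ.liftDeriv g x, Φ.hasMFDerivAt_lift g x, ?_⟩
  intro α
  obtain ⟨L, hL⟩ : ∃ L : TangentSpace (phaseModel m n) x →L[ℝ]
    TangentSpace (phaseModel m n) (Φ.lift g x), L = Φ.liftDeriv g x := ⟨_, rfl⟩
  have hu : ∀ i, L (vecP x i) = vecP (Φ.lift g x) i := by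
    intro i
    rw [hL]
    exact liftDeriv_vecP Φ g x i
  have hv : ∀ i, L (vecHor Ψ (averagedForm μ Φ J ℓ C) x i) =
      vecHor Ψ (averagedForm μ Φ J ℓ C) (Φ.lift g x) i := by
    intro i
    rw [hL]
    exact liftDeriv_vecHor hJ hℓ hC hCc g x i
  have h2 := liftDeriv_verticalTensor hJ hℓ g x α L hL
  suffices h : L (gaugeTensor Ψ (averagedForm μ Φ J ℓ C) x (α.comp L)) =
      gaugeTensor Ψ (averagedForm μ Φ J ℓ C) (Φ.lift g x) α by
    rw [hL] at h
    exact h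
  have h3 := map_couplingTensor L hu hv
    (fun i j => curvature Ψ (averagedForm μ Φ J ℓ C) i j x.1.proj x.2) α
  have hF : (fun i j => curvature Ψ (averagedForm μ Φ J ℓ C) i j x.1.proj x.2) =
      fun i j => curvature Ψ (averagedForm μ Φ J ℓ C) i j x.1.proj (Φ.act g x.1.proj x.2) :=
    funext fun i => funext fun j =>
      (curvature_averagedForm_act hJ hℓ hC hCc g i j x.1.proj x.2).symm
  refine (map_add_tensor L _ _ _).trans ((congrArg₂ (· + ·) h2 h3).trans ?_)
  rw [hF]
  rfl

end GaugeTensor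

section LiftedMomentum

section Generator

variable {k m n : ℕ} {G : Type*} [TopologicalSpace G] [ChartedSpace (EuclideanSpace ℝ (Fin k)) G]
  [Group G]
  {Q : Type*} [TopologicalSpace Q] [ChartedSpace (EuclideanSpace ℝ (Fin m)) Q]
  [IsManifold (𝓡 m) ∞ Q]
  {N : Type*} [TopologicalSpace N] [ChartedSpace (EuclideanSpace ℝ (Fin n)) N]

theorem gaugeTensor_skew (Ψ : PoissonTensor (𝓡 n) N) (A : HorizontalForm (m := m) Q N)
    (x : Cotangent (m := m) Q × N) (α β : TangentSpace (phaseModel m n) x →L[ℝ] ℝ) :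
    β (gaugeTensor Ψ A x α) = -α (gaugeTensor Ψ A x β) := by
  have h1 := couplingTensor_skew (vecP x) (vecHor Ψ A x)
    (fun i j => curvature Ψ A i j x.1.proj x.2) α β
  have h2 : β (verticalTensor Ψ x α) = -α (verticalTensor Ψ x β) :=
    Ψ.skew x.2 (α.comp (ContinuousLinearMap.inr ℝ (TangentSpace (cotangentModel m) x.1)
      (TangentSpace (𝓡 n) x.2))) (β.comp (ContinuousLinearMap.inr ℝ
      (TangentSpace (cotangentModel m) x.1) (TangentSpace (𝓡 n) x.2)))
  have h3 := map_add_tensor β (verticalTensor Ψ x) (couplingTensor (vecP x) (vecHor Ψ A x)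
    (fun i j => curvature Ψ A i j x.1.proj x.2)) α
  have h4 := map_add_tensor α (verticalTensor Ψ x) (couplingTensor (vecP x) (vecHor Ψ A x)
    (fun i j => curvature Ψ A i j x.1.proj x.2)) β
  refine h3.trans ?_
  rw [h1, h2, ← neg_add]
  exact congrArg Neg.neg h4.symm

variable [LieGroup (𝓡 k) ∞ G] [T2Space G]

/-- The velocity of the orbit of a one-parameter group, as a vector of the model space. -/
def FiberwiseAction.generator (Φ : FiberwiseAction (k := k) (m := m) (n := n) G Q N)
    (a : GroupLieAlgebra (𝓡 k) G) (q : Q) (y : N) : EuclideanSpace ℝ (Fin n) :=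
  infinitesimalGenerator (𝓡 n) (fun g y => Φ.act g q y) a y

theorem FiberwiseAction.hasMFDerivAt_orbit
    (Φ : FiberwiseAction (k := k) (m := m) (n := n) G Q N)
    (a : GroupLieAlgebra (𝓡 k) G) (x : Cotangent (m := m) Q × N) :
    HasMFDerivAt 𝓘(ℝ, ℝ) (phaseModel m n) (fun t : ℝ => Φ.lift (lieExp (t • a)) x) 0
      ((1 : ℝ →L[ℝ] ℝ).smulRight (((0, Φ.generator a x.1.proj x.2)) :
        (EuclideanSpace ℝ (Fin m) × (EuclideanSpace ℝ (Fin m) →L[ℝ] ℝ)) ×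
          EuclideanSpace ℝ (Fin n))) := by
  have h1 : ContMDiff 𝓘(ℝ, ℝ) (𝓡 n) ∞
      (fun t : ℝ => Φ.act (lieExp (t • a)) x.1.proj x.2) :=
    ContMDiff.comp (I' := (𝓡 k).prod ((𝓡 m).prod (𝓡 n))) Φ.smooth
      (f := fun t : ℝ => (lieExp (t • a), x.1.proj, x.2))
      ((contMDiff_lieExp_smul a).prodMk contMDiff_const)
  have h2 := ((h1 0).mdifferentiableAt (by simp)).hasMFDerivAt
  have h3 := (hasMFDerivAt_const (I := 𝓘(ℝ, ℝ)) (I' := cotangentModel m) x.1 (0 : ℝ)).prodMk h2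
  obtain ⟨D, hD⟩ : ∃ D : ℝ →L[ℝ] EuclideanSpace ℝ (Fin n), D = mfderiv 𝓘(ℝ, ℝ) (𝓡 n)
    (fun t : ℝ => Φ.act (lieExp (t • a)) x.1.proj x.2) 0 := ⟨_, rfl⟩
  have h4 : D 1 = Φ.generator a x.1.proj x.2 := by rw [hD]; rfl
  have h5 : (0 : ℝ →L[ℝ] EuclideanSpace ℝ (Fin m) × (EuclideanSpace ℝ (Fin m) →L[ℝ] ℝ)).prod D =
      (1 : ℝ →L[ℝ] ℝ).smulRight (((0, Φ.generator a x.1.proj x.2)) :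
        (EuclideanSpace ℝ (Fin m) × (EuclideanSpace ℝ (Fin m) →L[ℝ] ℝ)) ×
          EuclideanSpace ℝ (Fin n)) := by
    refine ContinuousLinearMap.ext_ring ?_
    rw [← h4]
    simp
  rw [← hD] at h3
  exact HasMFDerivAt.congr_mfderiv h3 h5

theorem FiberwiseAction.infinitesimalGenerator_lift
    (Φ : FiberwiseAction (k := k) (m := m) (n := n) G Q N)
    (a : GroupLieAlgebra (𝓡 k) G) (x : Cotangent (m := m) Q × N) :
    infinitesimalGenerator (phaseModel m n) Φ.lift a x = (((0, Φ.generator a x.1.proj x.2)) :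
        (EuclideanSpace ℝ (Fin m) × (EuclideanSpace ℝ (Fin m) →L[ℝ] ℝ)) ×
          EuclideanSpace ℝ (Fin n)) := by
  rw [infinitesimalGenerator, (Φ.hasMFDerivAt_orbit a x).mfderiv]
  exact one_smul ℝ _

/-- Invariant functions have vanishing derivative along the generators of the action. -/
theorem mvfderiv_infinitesimalGenerator_lift
    (Φ : FiberwiseAction (k := k) (m := m) (n := n) G Q N) {h : Cotangent (m := m) Q × N → ℝ}
    (hh : ContMDiff (phaseModel m n) 𝓘(ℝ, ℝ) ∞ h) (hinv : ∀ g x, h (Φ.lift g x) = h x)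
    (a : GroupLieAlgebra (𝓡 k) G) (x : Cotangent (m := m) Q × N) :
    mvfderiv (phaseModel m n) h x (infinitesimalGenerator (phaseModel m n) Φ.lift a x) = 0 := by
  obtain ⟨D, hD⟩ : ∃ D : (EuclideanSpace ℝ (Fin m) × (EuclideanSpace ℝ (Fin m) →L[ℝ] ℝ)) ×
          EuclideanSpace ℝ (Fin n) →L[ℝ] ℝ, D = mvfderiv (phaseModel m n) h x := ⟨_, rfl⟩
  have h0 : Φ.lift (lieExp ((0 : ℝ) • a)) x = x := by
    rw [zero_smul, lieExp_zero]
    exact Prod.ext rfl (Φ.one_act _ _)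
  have h1 : HasMFDerivAt (phaseModel m n) 𝓘(ℝ, ℝ) h (Φ.lift (lieExp ((0 : ℝ) • a)) x) D := by
    rw [h0, hD]
    exact ((hh x).mdifferentiableAt (by simp)).hasMFDerivAt
  have h2 := HasMFDerivAt.comp (0 : ℝ) h1 (Φ.hasMFDerivAt_orbit a x)
  have h3 : h ∘ (fun t : ℝ => Φ.lift (lieExp (t • a)) x) = fun _ => h x :=
    funext fun t => hinv _ _
  rw [h3] at h2
  have h4 := hasMFDerivAt_unique h2 (hasMFDerivAt_const (h x) (0 : ℝ))
  rw [Φ.infinitesimalGenerator_lift]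
  have h5 := congrArg (fun T : ℝ →L[ℝ] ℝ => T 1) h4
  have h6 : D ((1 : ℝ) • (((0, Φ.generator a x.1.proj x.2)) :
        (EuclideanSpace ℝ (Fin m) × (EuclideanSpace ℝ (Fin m) →L[ℝ] ℝ)) ×
          EuclideanSpace ℝ (Fin n))) = 0 := h5
  rw [one_smul] at h6
  rw [hD] at h6
  exact h6

end Generator

variable {E : Type*} [NormedAddCommGroup E] [NormedSpace ℝ E]
  {H : Type*} [TopologicalSpace H] {I : ModelWithCorners ℝ E H}
  {M : Type*} [TopologicalSpace M] [ChartedSpace H M]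

/-- A function that commutes with the Hamiltonian is a constant of motion. -/
theorem IsMIntegralCurveOn.eq_of_bracket_eq_zero {P : TwoTensorField I M} {h f : M → ℝ}
    (hf : MDifferentiable I 𝓘(ℝ, ℝ) f) (hb : ∀ x, bracket P h f x = 0) {c : ℝ → M} {t₀ t₁ : ℝ}
    (hc : IsMIntegralCurveOn (I := I) c (hamiltonianField P h) (Set.Ioo t₀ t₁)) {s t : ℝ}
    (hs : s ∈ Set.Ioo t₀ t₁) (ht : t ∈ Set.Ioo t₀ t₁) : f (c s) = f (c t) := by
  have h1 : ∀ r ∈ Set.Ioo t₀ t₁, HasDerivAt (fun r => f (c r)) 0 r := by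
    intro r hr
    have h2 := (hc r hr).hasMFDerivAt (Ioo_mem_nhds hr.1 hr.2)
    have h3 := HasMFDerivAt.comp r (hf (c r)).hasMFDerivAt h2
    obtain ⟨D, hD⟩ : ∃ D : ℝ →L[ℝ] ℝ, D = (mfderiv I 𝓘(ℝ, ℝ) f (c r)).comp
      ((1 : ℝ →L[ℝ] ℝ).smulRight (hamiltonianField P h (c r))) := ⟨_, rfl⟩
    have h4 : D = 0 := by
      refine ContinuousLinearMap.ext_ring ?_
      have h5 : D 1 = mvfderiv I f (c r) ((1 : ℝ) • hamiltonianField P h (c r)) := by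
        rw [hD]
        rfl
      rw [h5, one_smul]
      exact hb (c r)
    have h6 : HasFDerivAt (f ∘ c) D r := by
      rw [hD]
      exact hasMFDerivAt_iff_hasFDerivAt.1 h3
    rw [h4] at h6
    have h7 := h6.hasDerivAt
    exact h7
  exact isOpen_Ioo.is_const_of_deriv_eq_zero isPreconnected_Ioo
    (fun r hr => (h1 r hr).differentiableAt.differentiableWithinAt)
    (fun r hr => (h1 r hr).deriv) hs ht

end LiftedMomentum

section MomentumMap

variable {k m n : ℕ} {G : Type*} [TopologicalSpace G] [ChartedSpace (EuclideanSpace ℝ (Fin k)) G]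
  [Group G] [LieGroup (𝓡 k) ∞ G] [T2Space G] [MeasurableSpace G] [BorelSpace G]
  {μ : Measure G} [IsProbabilityMeasure μ]
  {Q : Type*} [TopologicalSpace Q] [ChartedSpace (EuclideanSpace ℝ (Fin m)) Q]
  [IsManifold (𝓡 m) ∞ Q]
  {N : Type*} [TopologicalSpace N] [ChartedSpace (EuclideanSpace ℝ (Fin n)) N]
  [IsManifold (𝓡 n) ∞ N] [T2Space N] [CompactSpace G] [μ.IsHaarMeasure]
  {Ψ : PoissonTensor (𝓡 n) N}
  {Φ : FiberwiseAction (k := k) (m := m) (n := n) G Q N}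
  {J : Q × N → Module.Dual ℝ (GroupLieAlgebra (𝓡 k) G)}
  (hJ : IsFiberwiseMomentumMap Ψ Φ J)
  {ℓ : G → GroupLieAlgebra (𝓡 k) G} (hℓ : IsLogarithm μ ℓ)
  {C : HorizontalForm (m := m) Q N}
  (hC : ContMDiff ((𝓡 m).prod (𝓡 n)) (cotangentModel m) ∞
    (fun x : Q × N => (⟨x.1, C x⟩ : Cotangent (m := m) Q)))
  (hCc : ∀ (q : Q) (u : TangentSpace (𝓡 m) q) (y : N),
    hamiltonianField Ψ.sharp (fun y' => C (q, y') u) y = 0)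

omit [Group G] [LieGroup (𝓡 k) ∞ G] [T2Space G] [MeasurableSpace G] [BorelSpace G]
  [CompactSpace G] [T2Space N] [IsManifold (𝓡 n) ∞ N] in
theorem contMDiff_tauBar : ContMDiff (phaseModel m n) ((𝓡 m).prod (𝓡 n)) ∞
    (tauBar (m := m) (Q := Q) (N := N)) :=
  ContMDiff.prodMk
    ((Bundle.contMDiff_proj (fun q : Q => TangentSpace (𝓡 m) q →L[ℝ] ℝ)).comp contMDiff_fst)
    contMDiff_snd

omit [LieGroup (𝓡 k) ∞ G] [T2Space G] [MeasurableSpace G] [BorelSpace G] [IsManifold (𝓡 n) ∞ N]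
  [T2Space N] [CompactSpace G] in
theorem FiberwiseAction.mdifferentiable_lift
    (Φ : FiberwiseAction (k := k) (m := m) (n := n) G Q N) (g : G) :
    MDifferentiable (phaseModel m n) (phaseModel m n)
      (Φ.lift g : Cotangent (m := m) Q × N → Cotangent (m := m) Q × N) :=
  fun x => (Φ.hasMFDerivAt_lift g x).mdifferentiableAt

omit [IsManifold (𝓡 n) ∞ N] [T2Space N] in
/-- The differential of the lift of a function on `Q × N`. -/
theorem mvfderiv_comp_tauBar {F : Q × N → ℝ} (hF : ContMDiff ((𝓡 m).prod (𝓡 n)) 𝓘(ℝ, ℝ) ∞ F)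
    (x : Cotangent (m := m) Q × N) (v : EuclideanSpace ℝ (Fin m))
    (p : EuclideanSpace ℝ (Fin m) →L[ℝ] ℝ) (w : EuclideanSpace ℝ (Fin n)) :
    mvfderiv (phaseModel m n) (fun x => F (tauBar x)) x (((v, p), w) : (EuclideanSpace ℝ (Fin m) ×
      (EuclideanSpace ℝ (Fin m) →L[ℝ] ℝ)) × EuclideanSpace ℝ (Fin n)) =
      dQ (m := m) F (tauBar x) v + dN n (fun y => F (x.1.proj, y)) x.2 w := by
  have h1 := HasMFDerivAt.comp x
    ((hF (tauBar x)).mdifferentiableAt (by simp)).hasMFDerivAt_dQ_dN (hasMFDerivAt_tauBar x)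
  have h2 := h1.mfderiv
  exact congrArg (fun T : (EuclideanSpace ℝ (Fin m) ×
      (EuclideanSpace ℝ (Fin m) →L[ℝ] ℝ)) × EuclideanSpace ℝ (Fin n) →L[ℝ] ℝ => T ((v, p), w)) h2

include hJ hℓ hC hCc

/-- The lifted action is Hamiltonian if the averages of the derivatives of `J` vanish. -/
theorem isMomentumMap_gaugeTensor
    (hz : ∀ (a : GroupLieAlgebra (𝓡 k) G) (q : Q) (y : N),
        ∫ g, dQ (m := m) (fun z => J z a) (q, Φ.act g q y) ∂μ = 0) :
    IsMomentumMap (gaugeTensor Ψ (averagedForm μ Φ J ℓ C)) Φ.lift (J ∘ tauBar) := by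
  intro a
  refine ⟨(hJ.1 a).comp contMDiff_tauBar, fun x => ?_⟩
  rw [Φ.infinitesimalGenerator_lift]
  obtain ⟨β, hβ⟩ : ∃ β : TangentSpace (phaseModel m n) x →L[ℝ] ℝ,
    β = mvfderiv (phaseModel m n) (fun x => J (tauBar x) a) x := ⟨_, rfl⟩
  have hd := mvfderiv_comp_tauBar (hJ.1 a) x
  have hu : ∀ i, β (vecP x i) = 0 := by
    intro i
    rw [hβ]
    refine (hd 0 (EuclideanSpace.proj i) 0).trans ?_
    rw [map_zero, map_zero, add_zero]
  have hv : ∀ i, β (vecHor Ψ (averagedForm μ Φ J ℓ C) x i) = 0 := by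
    intro i
    rw [hβ]
    refine (hd (EuclideanSpace.single i 1) 0 (Ψ.modelSharp x.2
      (dN n (fun y => coeff (averagedForm μ Φ J ℓ C) x.1.proj i (x.1.proj, y)) x.2))).trans ?_
    exact hor_momentum_eq_zero hJ hℓ hC hCc a i x.1.proj x.2 (hz a x.1.proj x.2)
  have h1 := couplingTensor_eq_zero
    (fun i j => curvature Ψ (averagedForm μ Φ J ℓ C) i j x.1.proj x.2) hu hv
  have h2 : (((0, Φ.generator a x.1.proj x.2)) :
        (EuclideanSpace ℝ (Fin m) × (EuclideanSpace ℝ (Fin m) →L[ℝ] ℝ)) ×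
          EuclideanSpace ℝ (Fin n)) = verticalTensor Ψ x β := by
    obtain ⟨β', hβ'⟩ : ∃ β' : (EuclideanSpace ℝ (Fin m) × (EuclideanSpace ℝ (Fin m) →L[ℝ] ℝ)) ×
      EuclideanSpace ℝ (Fin n) →L[ℝ] ℝ, β' = β := ⟨β, rfl⟩
    have h3 : Φ.generator a x.1.proj x.2 =
        Ψ.modelSharp x.2 (dN n (fun y => J (x.1.proj, y) a) x.2) := (hJ.2 x.1.proj a).2 x.2
    have h4 : β'.comp (ContinuousLinearMap.inr ℝ _ (EuclideanSpace ℝ (Fin n))) =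
        dN n (fun y => J (x.1.proj, y) a) x.2 := by
      refine ContinuousLinearMap.ext fun w => ?_
      have h5 := hd 0 0 w
      rw [map_zero, zero_add, ← hβ, ← hβ'] at h5
      exact h5
    rw [h3, ← h4, hβ']
    rfl
  have h6 : gaugeTensor Ψ (averagedForm μ Φ J ℓ C) x β = verticalTensor Ψ x β + 0 := by
    rw [← h1]
    rfl
  rw [h2, hamiltonianField]
  have h7 := h6.trans (add_zero (verticalTensor Ψ x β))
  rw [hβ] at h7 ⊢
  exact h7.symm

end MomentumMap

end

theorem mainTheorem1 {k m n : ℕ}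
    {G : Type*} [TopologicalSpace G] [ChartedSpace (EuclideanSpace ℝ (Fin k)) G] [Group G]
    [LieGroup (𝓡 k) ∞ G] [T2Space G] [CompactSpace G] [ConnectedSpace G]
    [MeasurableSpace G] [BorelSpace G]
    (μ : Measure G) [μ.IsHaarMeasure] [IsProbabilityMeasure μ]
    {Q : Type*} [TopologicalSpace Q] [ChartedSpace (EuclideanSpace ℝ (Fin m)) Q]
    [IsManifold (𝓡 m) ∞ Q] [T2Space Q] [SecondCountableTopology Q]
    {N : Type*} [TopologicalSpace N] [ChartedSpace (EuclideanSpace ℝ (Fin n)) N]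
    [IsManifold (𝓡 n) ∞ N] [T2Space N] [SecondCountableTopology N]
    (Ψ : PoissonTensor (𝓡 n) N)
    (Φ : FiberwiseAction (k := k) (m := m) (n := n) G Q N)
    (J : Q × N → Module.Dual ℝ (GroupLieAlgebra (𝓡 k) G))
    (hJ : IsFiberwiseMomentumMap Ψ Φ J)
    (ℓ : G → GroupLieAlgebra (𝓡 k) G) (hℓ : IsLogarithm μ ℓ)
    (C : HorizontalForm (m := m) Q N)
    (hC_smooth : ContMDiff ((𝓡 m).prod (𝓡 n)) (cotangentModel m) ∞
      (fun x : Q × N => (⟨x.1, C x⟩ : Cotangent (m := m) Q)))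
    (hC_casimir : ∀ (q : Q) (u : TangentSpace (𝓡 m) q) (y : N),
      hamiltonianField Ψ.sharp (fun y' => C (q, y') u) y = 0)
    (A : HorizontalForm (m := m) Q N) (hA : A = averagedForm μ Φ J ℓ C) :
    -- `A` is a smooth gauge form
    ContMDiff ((𝓡 m).prod (𝓡 n)) (cotangentModel m) ∞
      (fun x : Q × N => (⟨x.1, A x⟩ : Cotangent (m := m) Q)) ∧
    -- the gauge tensor is invariant
    (∀ g : G, TensorInvariant (gaugeTensor Ψ A) (Φ.lift g)) ∧
    -- Hamiltonian systems with invariant Hamiltonian are invariant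
    (∀ h : Cotangent (m := m) Q × N → ℝ, ContMDiff (phaseModel m n) 𝓘(ℝ, ℝ) ∞ h →
      (∀ g x, h (Φ.lift g x) = h x) →
      ∀ g : G, FieldInvariant (hamiltonianField (gaugeTensor Ψ A) h) (Φ.lift g)) ∧
    -- in particular, those of kinetic energies
    (∀ γ : PseudoRiemannianMetric m Q,
      (∀ g x, kineticEnergy (N := N) γ (Φ.lift g x) = kineticEnergy γ x) ∧
      ∀ g : G, FieldInvariant (hamiltonianField (gaugeTensor Ψ A) (kineticEnergy γ)) (Φ.lift g)) ∧
    -- the case of vanishing averages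
    ((∀ (a : GroupLieAlgebra (𝓡 k) G) (q : Q) (y : N),
        ∫ g, dQ (m := m) (fun z => J z a) (q, Φ.act g q y) ∂μ = 0) →
      ((∀ g : G, TensorInvariant (gaugeTensor Ψ A) (Φ.lift g)) ∧
        IsMomentumMap (gaugeTensor Ψ A) Φ.lift (J ∘ tauBar)) ∧
      ∀ h : Cotangent (m := m) Q × N → ℝ, ContMDiff (phaseModel m n) 𝓘(ℝ, ℝ) ∞ h →
        (∀ g x, h (Φ.lift g x) = h x) →
        ∀ a : GroupLieAlgebra (𝓡 k) G,
          (∀ x, bracket (gaugeTensor Ψ A) h (fun z => J (tauBar z) a) x = 0) ∧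
          ∀ (c : ℝ → Cotangent (m := m) Q × N) (t₀ t₁ : ℝ),
            IsMIntegralCurveOn (I := phaseModel m n) c (hamiltonianField (gaugeTensor Ψ A) h)
              (Set.Ioo t₀ t₁) →
            ∀ s ∈ Set.Ioo t₀ t₁, ∀ t ∈ Set.Ioo t₀ t₁,
              J (tauBar (c s)) a = J (tauBar (c t)) a) := by
  subst hA
  have hT := tensorInvariant_gaugeTensor hJ hℓ hC_smooth hC_casimir
  have hF : ∀ h : Cotangent (m := m) Q × N → ℝ, (∀ g x, h (Φ.lift g x) = h x) → ∀ g : G,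
      FieldInvariant (hamiltonianField (gaugeTensor Ψ (averagedForm μ Φ J ℓ C)) h) (Φ.lift g) :=
    fun h hinv g => (hT g).fieldInvariant (ψ := Φ.lift g⁻¹) (Φ.mdifferentiable_lift g)
      (Φ.mdifferentiable_lift g⁻¹) (fun x => by
        simpa using Φ.lift_lift_inv g⁻¹ x) (Φ.lift_lift_inv g) (hinv g)
  refine ⟨contMDiff_averagedForm hJ hℓ hC_smooth, hT, fun h _ => hF h,
    fun γ => ⟨fun _ _ => rfl, hF _ fun _ _ => rfl⟩, fun hz => ?_⟩
  have hM := isMomentumMap_gaugeTensor hJ hℓ hC_smooth hC_casimir hz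
  refine ⟨⟨hT, hM⟩, fun h hh hinv a => ?_⟩
  have hb : ∀ x, bracket (gaugeTensor Ψ (averagedForm μ Φ J ℓ C)) h
      (fun z => J (tauBar z) a) x = 0 := by
    intro x
    refine (gaugeTensor_skew Ψ _ x _ _).trans ?_
    have h1 := mvfderiv_infinitesimalGenerator_lift Φ hh hinv a x
    rw [(hM a).2 x] at h1
    exact neg_eq_zero.2 h1
  exact ⟨hb, fun c t₀ t₁ hc s hs t ht => hc.eq_of_bracket_eq_zero
    (f := fun z => J (tauBar z) a) ((hM a).1.mdifferentiable (by simp)) hb hs ht⟩
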